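/- **Setting.** Let $\mathfrak g$ be a simple Lie algebra over $\mathbb C$ with untwisted affine Cartan matrix $A=(a_{ij})_{i,j\in I}$, $I=\{0,\dots,N\}$; let $d_i$ be positive integers such that $b_{ij}=d_ia_{ij}$ is symmetric, let $(a_i)_{i\in I}$ be the labels of the affine diagram ($\sum_j a_{ij}a_j=0$, $a_0=1$), and let $m_{ij}=\delta_{i,j+1}-\delta_{i+1,j}$ (indices mod $N+1$) if $\mathfrak g$ is of type $A_N$ and $m_{ij}=0$ otherwise. Let $\kappa\in\mathbb C^\times$, $k,l\in\mathbb C$, and $q=e^\tau\in\mathbb C^\times$ not a root of unity, with $|q^{2k}|<1$, where $q^x:=e^{x\tau}$. Put $q_i=q^{d_i}$, $[x]=\frac{q^x-q^{-x}}{q-q^{-1}}$, $[n]_i=\frac{q_i^n-q_i^{-n}}{q_i-q_i^{-1}}$ (with the corresponding $q_i$-binomials), $\delta(z)=\sum_{n\in\mathbb Z}z^n$ and $(x;t)_\infty=\prod_{n\ge0}(1-xt^n)$. All relations between currents are identities of formal series, coefficient by coefficient; a quotient of infinite products in a variable $x$ is expanded in nonnegative powers of $x$. *Quantum toroidal algebra.*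 $U_{q,\kappa}(\mathfrak g_{tor})$ is the unital $\mathbb C$-algebra with generators $a^\vee_{i,n}$ $(n\neq0)$, $X^\pm_{i,n}$ $(n\in\mathbb Z)$, $k_i^{\pm1}$, $q^{\pm c/2}$, $q^{\pm d}$ ($i\in I$). Put $X^\pm_i(z)=\sum_nX^\pm_{i,n}z^{-n}$ and $\Phi^\pm_i(z)=k_i^{\pm1}\exp\big(\pm(q_i-q_i^{-1})\sum_{n>0}a^\vee_{i,\pm n}z^{\mp n}\big)$. The relations are: $k_i^{\pm1}$, $q^{\pm c/2}$, $q^{\pm d}$ are mutually inverse pairs; $q^{\pm c/2}$ and $\prod_ik_i^{a_i}$ are central; the $k_i$ commute with each other, with all $a^\vee_{j,n}$ and with $q^d$; $q^da^\vee_{i,n}q^{-d}=q^na^\vee_{i,n}$; $q^dX^\pm_i(z)q^{-d}=X^\pm_i(q^{-1}z)$; $k_iX^\pm_j(z)k_i^{-1}=q^{\pm b_{ij}}X^\pm_j(z)$; and $$[a^\vee_{i,n},a^\vee_{j,m}]=\delta_{n+m,0}\tfrac{[a_{ij}n]_i}{n}\tfrac{q^{nc}-q^{-nc}}{q_j-q_j^{-1}}\kappa^{-nm_{ij}},\qquad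 [a^\vee_{i,n},X^\pm_j(z)]=\pm\tfrac{[a_{ij}n]_i}{n}q^{\mp|n|c/2}\kappa^{-nm_{ij}}z^nX^\pm_j(z),$$ $$(\kappa^{m_{ij}}z-q^{\pm b_{ij}}w)X^\pm_i(z)X^\pm_j(w)=(\kappa^{m_{ij}}q^{\pm b_{ij}}z-w)X^\pm_j(w)X^\pm_i(z),$$ $$[X^+_i(z),X^-_j(w)]=\tfrac{\delta_{ij}}{q_i-q_i^{-1}}\big(\delta(q^c\tfrac wz)\Phi^+_i(q^{c/2}w)-\delta(q^c\tfrac zw)\Phi^-_i(q^{c/2}z)\big),$$ and, for $i\neq j$ and $a=1-a_{ij}$, the Serre relations $$\sum_{\sigma\in\mathfrak S_a}\sum_{r=0}^a(-1)^r\left[{a\atop r}\right]_iX^\pm_i(z_{\sigma(1)})\cdots X^\pm_i(z_{\sigma(r)})X^\pm_j(w)X^\pm_i(z_{\sigma(r+1)})\cdots X^\pm_i(z_{\sigma(a)})=0.$$ A complex vector space $V$ with an invertible operator $q^d$ is called *restricted* if $V$ is the direct sum of the eigenspaces of $q^d$ and, for every $c\in\mathbb C$, the eigenspace for $cq^n$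 is $0$ for all large $n\in\mathbb N$. A $U_{q,\kappa}(\mathfrak g_{tor})$-module is *restricted of level $(k,l)$* if it is restricted for $q^d$, and $q^{c/2}$, $\prod_ik_i^{a_i}$ act as $q^{k/2}$, $q^{-l}$. *Quantum $Z$-algebra.* A *restricted $Z$-module of level $(k,l)$* is a vector space $W$ with operators $Z^\pm_{i,n}$ and invertible operators $k_i$, $q^d$ such that $W$ is restricted for $q^d$; the $k_i$ and $q^d$ commute with one another; $\prod_ik_i^{a_i}=q^{-l}$; and, with $Z^\pm_i(z)=\sum_nZ^\pm_{i,n}z^{-n}$, $k_iZ^\pm_j(z)k_i^{-1}=q^{\pm b_{ij}}Z^\pm_j(z)$, $q^dZ^\pm_i(z)q^{-d}=Z^\pm_i(q^{-1}z)$, and $$z\frac{(q^{-b_{ij}}\kappa^{-m_{ij}}\frac wz;q^{2k})_\infty}{(q^{2k}q^{b_{ij}}\kappa^{-m_{ij}}\frac wz;q^{2k})_\infty}Z^\pm_i(z)Z^\pm_j(w)=-w\kappa^{-m_{ij}}\frac{(q^{-b_{ij}}\kappa^{m_{ij}}\frac zw;q^{2k})_\infty}{(q^{2k}q^{b_{ij}}\kappa^{m_{ij}}\frac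 zw;q^{2k})_\infty}Z^\pm_j(w)Z^\pm_i(z),$$ $$\frac{(q^{k+b_{ij}}\kappa^{-m_{ij}}\frac wz;q^{2k})_\infty}{(q^{k-b_{ij}}\kappa^{-m_{ij}}\frac wz;q^{2k})_\infty}Z^+_i(z)Z^-_j(w)-\frac{(q^{k+b_{ij}}\kappa^{m_{ij}}\frac zw;q^{2k})_\infty}{(q^{k-b_{ij}}\kappa^{m_{ij}}\frac zw;q^{2k})_\infty}Z^-_j(w)Z^+_i(z)=\tfrac{\delta_{ij}}{q_i-q_i^{-1}}\big(\delta(q^k\tfrac wz)k_i-\delta(q^{-k}\tfrac wz)k_i^{-1}\big),$$ and, for $i\ne j$, $a=1-a_{ij}$, the Serre relations obtained from those above by replacing $X^\pm$ by $Z^\pm$ and multiplying each monomial $Y_0(x_0)Y_1(x_1)\cdots Y_a(x_a)$ (with factors of colours $c_0,\dots,c_a\in\{i,j\}$) by $\prod_{p<p'}F^\pm_{c_pc_{p'}}(x_{p'}/x_p)$, where $F^+_{ij}(x)=\frac{(q^{-b_{ij}}\kappa^{-m_{ij}}x;q^{2k})_\infty}{(q^{b_{ij}}\kappa^{-m_{ij}}x;q^{2k})_\infty}$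 and $F^-_{ij}(x)=F^+_{ij}(q^{2k}x)$. *Heisenberg algebra.* It has generators $a_{i,n}$ $(i\in I,\ n\ne0)$ with $[a_{i,n},a_{j,m}]=\delta_{n+m,0}\frac{[b_{ij}n]}{n}[kn]\kappa^{-nm_{ij}}$. Its Fock module is $\mathcal F=\mathbb C[a_{i,-n}: i\in I,n>0]$, where $a_{i,-n}$ acts by multiplication, $a_{i,n}$ by $\sum_j\frac{[b_{ij}n]}{n}[kn]\kappa^{-nm_{ij}}\frac{\partial}{\partial a_{j,-n}}$ for $n>0$, and $q^d$ by the algebra automorphism $a_{i,-n}\mapsto q^{-n}a_{i,-n}$. Put $E^\pm(a_j,z)=\exp\big(\pm\sum_{n>0}\frac{q-q^{-1}}{q^{kn}-q^{-kn}}a_{j,\pm n}z^{\mp n}\big)$. A *restricted Heisenberg–$Z$-module of level $(k,l)$* is a restricted $Z$-module of level $(k,l)$ with an action of the Heisenberg algebra commuting with all $Z^\pm_{i,n}$ and $k_i$, and with $q^da_{i,n}q^{-d}=q^na_{i,n}$; that is, a restricted module over the tensor product of the Heisenberg algebra and the $Z$-algebra. On it define the dressed currents (a product $A\otimes B$ acting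 as $AB$) $$X^{+'}_j(z)=E^-(a_j,q^{-k/2}z)^{-1}E^+(a_j,q^{k/2}z)^{-1}\otimes Z^+_j(z),\qquad X^{-'}_j(z)=E^-(a_j,q^{k/2}z)\,E^+(a_j,q^{-k/2}z)\otimes Z^-_j(z).$$ **Proposition.** The currents $X^{\pm'}_j(z)$ and $k_j^{\pm1}$ generate the quantum toroidal algebra $U_{q,\kappa}(\mathfrak g_{tor})$ at level $(k,l)$, in the following sense. 1. If $W$ is a restricted $Z$-module of level $(k,l)$, then $\mathcal F\otimes W$, with $a_{i,n}\otimes1$, $1\otimes Z^\pm_{i,n}$, $1\otimes k_i$, $q^d\otimes q^d$, is a restricted Heisenberg–$Z$-module of level $(k,l)$. 2. On every restricted Heisenberg–$Z$-module $V$ of level $(k,l)$ there is a unique representation $\pi$ of $U_{q,\kappa}(\mathfrak g_{tor})$ in which $X^\pm_j(z)$ acts as $X^{\pm'}_j(z)$, $k_j$ as $k_j$, $[d_j]a^\vee_{j,n}$ as $a_{j,n}$, $q^{c/2}$ as $q^{k/2}$ and $q^d$ as $q^d$. It is restricted of level $(k,l)$, and the coefficients of $X^{\pm'}_j(z)$ together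 with $k_j^{\pm1}$ $(j\in I)$ generate the image under $\pi$ of the subalgebra of $U_{q,\kappa}(\mathfrak g_{tor})$ generated by all generators except $q^{\pm d}$. 3. Conversely, every restricted $U_{q,\kappa}(\mathfrak g_{tor})$-module of level $(k,l)$ is obtained as in 2 from exactly one structure of restricted Heisenberg–$Z$-module of level $(k,l)$ on the same space. -/

import Mathlib

open scoped TensorProduct

namespace QToroidal

noncomputable section

/-! ## Numbers and formal power series -/

/-- The `x`-integer `[n] = (x ^ n - x ^ (-n)) / (x - x⁻¹)`. -/
def qInt (x : ℂ) (n : ℤ) : ℂ := (x ^ n - x ^ (-n)) / (x - x⁻¹)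

/-- The `x`-factorial `[n]! = [1] [2] ⋯ [n]`. -/
def qFact (x : ℂ) (n : ℕ) : ℂ := ∏ j ∈ Finset.range n, qInt x (j + 1)

/-- The `x`-binomial coefficient `[n]! / ([n - r]! [r]!)` (used for `r ≤ n` only). -/
def qBinom (x : ℂ) (n r : ℕ) : ℂ := qFact x n / (qFact x (n - r) * qFact x r)

/-- The infinite product `(X; t)_∞ = ∏_{n ≥ 0} (1 - t ^ n X)` as a formal power series in `X`,
expanded by Euler's formula
`∑_n (-1)^n t^(n(n-1)/2) / ((1 - t) ⋯ (1 - t^n)) X^n`. It is pinned down by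
`constantCoeff_poch` and `poch_eq` below. -/
def poch (t : ℂ) : PowerSeries ℂ :=
  PowerSeries.mk fun n =>
    (-1) ^ n * t ^ (n * (n - 1) / 2) / ∏ j ∈ Finset.range n, (1 - t ^ (j + 1))

theorem constantCoeff_poch (t : ℂ) : PowerSeries.coeff 0 (poch t) = 1 := by
  simp [poch]

/-- The functional equation `(X; t)_∞ = (1 - X) (t X; t)_∞`. -/
theorem poch_eq (t : ℂ) (ht : ∀ n : ℕ, t ^ (n + 1) ≠ 1) :
    poch t = (1 - PowerSeries.X) * PowerSeries.rescale t (poch t) := by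
  ext n
  cases n with
  | zero =>
    rw [sub_mul, one_mul, map_sub, PowerSeries.coeff_zero_X_mul, sub_zero,
      PowerSeries.coeff_rescale, pow_zero, one_mul]
  | succ n =>
    rw [sub_mul, one_mul, map_sub, PowerSeries.coeff_succ_X_mul]
    simp only [poch, PowerSeries.coeff_rescale, PowerSeries.coeff_mk, Finset.prod_range_succ]
    have hn : (n + 1) * (n + 1 - 1) / 2 = n * (n - 1) / 2 + n := by
      rcases n with _ | n
      · rfl
      · simp only [Nat.add_sub_cancel]
        have : (n + 1 + 1) * (n + 1) = (n + 1) * n + (n + 1) * 2 := by ring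
        rw [this, Nat.add_mul_div_right _ _ (by norm_num)]
    have h1 : (1 - t ^ (n + 1)) ≠ 0 := sub_ne_zero.mpr (Ne.symm (ht n))
    have h2 : ∏ j ∈ Finset.range n, (1 - t ^ (j + 1)) ≠ 0 :=
      Finset.prod_ne_zero_iff.mpr fun j _ => sub_ne_zero.mpr (Ne.symm (ht j))
    rw [hn]
    field_simp
    ring

/-- The power series `(α X; t)_∞ / (β X; t)_∞`. -/
def ratio (t α β : ℂ) : PowerSeries ℂ :=
  PowerSeries.rescale α (poch t) * (PowerSeries.rescale β (poch t))⁻¹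

/-- The coefficient of `z ^ n` in `exp (∑_{m ≥ 0} x_m z ^ (m + 1))`, for `x_m` in a (not necessarily
commutative) algebra. -/
def expCoeff {B : Type*} [Ring B] [Algebra ℂ B] (x : ℕ → B) (n : ℕ) : B :=
  ∑ j ∈ Finset.range (n + 1), ((j.factorial : ℂ)⁻¹) •
    PowerSeries.coeff n ((PowerSeries.X * PowerSeries.mk x) ^ j)

/-- The nonzero integers, indexing the modes of the Heisenberg generators. -/
abbrev NZ : Type := {l : ℤ // l ≠ 0}

/-- The nonzero integer `m + 1`. -/
def pos (m : ℕ) : NZ := ⟨(m : ℤ) + 1, by omega⟩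

/-- The nonzero integer `-(m + 1)`. -/
def neg (m : ℕ) : NZ := ⟨-((m : ℤ) + 1), by omega⟩

/-! ## The Cartan data -/

section Cartan

variable {ι X Y : Type*} [AddCommGroup X] [Module ℂ X] [AddCommGroup Y] [Module ℂ Y]
  {P : RootPairing ι ℂ X Y}

/-- `θ` is the highest root with respect to the base `b`. -/
def IsHighestRoot (b : P.Base) (θ : ι) : Prop :=
  ∀ j, P.root θ - P.root j ∈ AddSubmonoid.closure (P.root '' b.support)

/-- The untwisted affine Cartan matrix `a_ij = ⟨α_j, h_i⟩`. The affine node is `none`, with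
`α_0 = δ - θ` and `h_0 = c - θ^∨`. -/
def affineCartan [P.IsCrystallographic] (b : P.Base) (θ : ι) :
    Matrix (Option b.support) (Option b.support) ℤ
  | none, none => 2
  | none, some j => -P.pairingIn ℤ j θ
  | some i, none => -P.pairingIn ℤ θ i
  | some i, some j => P.pairingIn ℤ j i

end Cartan

open scoped Classical in
/-- `e` numbers the vertices of the affine Dynkin diagram of type `A_N`, `N ≥ 1`, cyclically. -/
def IsCyclicNumbering {J : Type*} (A : Matrix (Option J) (Option J) ℤ) (N : ℕ)
    (e : Option J ≃ ZMod (N + 1)) : Prop :=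
  1 ≤ N ∧ e none = 0 ∧ ∀ i j, A i j = 2 * (if e i = e j then 1 else 0)
    - (if e i = e j + 1 then 1 else 0) - (if e i + 1 = e j then 1 else 0)

open scoped Classical in
/-- `M` is the matrix `m_ij = δ_{i,j+1} - δ_{i+1,j}` (indices modulo `N + 1`) if the type is `A_N`,
and `0` otherwise. -/
def IsTwistMatrix {J : Type*} (A M : Matrix (Option J) (Option J) ℤ) : Prop :=
  (∃ (N : ℕ) (e : Option J ≃ ZMod (N + 1)), IsCyclicNumbering A N e ∧
    ∀ i j, M i j = (if e i = e j + 1 then 1 else 0) - (if e i + 1 = e j then 1 else 0)) ∨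
  ((¬ ∃ (N : ℕ) (e : Option J ≃ ZMod (N + 1)), IsCyclicNumbering A N e) ∧ M = 0)

/-- The numerical data entering the relations: the Cartan matrix `A`, the numbers `d_i` that
symmetrize it, the matrix `M`, the labels `a_i` of the diagram, and the parameters `q`, `κ`. -/
structure Datum (I : Type*) where
  A : Matrix I I ℤ
  d : I → ℕ
  M : Matrix I I ℤ
  lab : I → ℕ
  q : ℂ
  κ : ℂ

namespace Datum

variable {I : Type*} (D : Datum I)

/-- `b_ij = d_i a_ij`. -/
def b (i j : I) : ℤ := D.d i * D.A i j

/-- `q_i = q ^ d_i`. -/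
def qi (i : I) : ℂ := D.q ^ D.d i

/-- `1 - a_ij`, the order of the Serre relation. -/
def serreOrder (i j : I) : ℕ := (1 - D.A i j).toNat

end Datum

/-! ## The quantum toroidal algebra -/

/-- The generators of the quantum toroidal algebra: `a i l` is `a^∨_{i,l}`, `xp`, `xm` are
`X^±_{i,n}`, `k`, `kinv` are `k_i^{±1}`, `ch`, `chinv` are `q^{±c/2}` and `qd`, `qdinv` are
`q^{±d}`. -/
inductive Gen (I : Type*)
  | a (i : I) (l : NZ)
  | xp (i : I) (n : ℤ)
  | xm (i : I) (n : ℤ)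
  | k (i : I)
  | kinv (i : I)
  | ch
  | chinv
  | qd
  | qdinv

section Algebra

variable {I : Type*}

local notation "g" => FreeAlgebra.ι ℂ

/-- `q^{nc/2}`. -/
def chPow : ℤ → FreeAlgebra ℂ (Gen I)
  | Int.ofNat n => (g Gen.ch) ^ n
  | Int.negSucc n => (g Gen.chinv) ^ (n + 1)

/-- The coefficient of `z ^ (-n)` in
`Φ^+_i(z) = k_i exp ((q_i - q_i⁻¹) ∑_{m > 0} a^∨_{i,m} z^{-m})`. -/
def phiP (D : Datum I) (i : I) (n : ℤ) : FreeAlgebra ℂ (Gen I) :=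
  if n < 0 then 0 else
    g (Gen.k i) * expCoeff (fun m => (D.qi i - (D.qi i)⁻¹) • g (Gen.a i (pos m))) n.natAbs

/-- The coefficient of `z ^ (-n)` in
`Φ^-_i(z) = k_i⁻¹ exp (-(q_i - q_i⁻¹) ∑_{m > 0} a^∨_{i,-m} z^m)`. -/
def phiM (D : Datum I) (i : I) (n : ℤ) : FreeAlgebra ℂ (Gen I) :=
  if 0 < n then 0 else
    g (Gen.kinv i) * expCoeff (fun m => (-(D.qi i - (D.qi i)⁻¹)) • g (Gen.a i (neg m))) n.natAbs

/-- The coefficient of `z_1^{-n_1} ⋯ z_a^{-n_a} w^{-s}` in the Serre expression for the currents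
`x_i(z) = ∑ x_{i,n} z^{-n}`, before multiplication out: the sum over permutations and positions of
`mono c m`, where `c` lists the colours and `m` the modes of the factors from left to right. -/
def serreSum {B : Type*} [AddCommGroup B] [Module ℂ B] (D : Datum I)
    (mono : ∀ {L : ℕ}, (Fin L → I) → (Fin L → ℤ) → B) (i j : I)
    (n : Fin (D.serreOrder i j) → ℤ) (s : ℤ) : B :=
  ∑ σ : Equiv.Perm (Fin (D.serreOrder i j)), ∑ r : Fin (D.serreOrder i j + 1),
    ((-1) ^ (r : ℕ) * qBinom (D.qi i) (D.serreOrder i j) r) •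
      mono (Fin.insertNth r j fun _ => i) (Fin.insertNth r s fun p => n (σ p))

open scoped Classical in
/-- The defining relations of the quantum toroidal algebra, written in modes: each relation between
currents is replaced by the equalities of all coefficients. -/
inductive Rel [Fintype I] (D : Datum I) : FreeAlgebra ℂ (Gen I) → FreeAlgebra ℂ (Gen I) → Prop
  -- inverses
  | ch_inv : Rel D (g Gen.ch * g Gen.chinv) 1
  | inv_ch : Rel D (g Gen.chinv * g Gen.ch) 1
  | qd_inv : Rel D (g Gen.qd * g Gen.qdinv) 1
  | inv_qd : Rel D (g Gen.qdinv * g Gen.qd) 1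
  | k_inv (i : I) : Rel D (g (Gen.k i) * g (Gen.kinv i)) 1
  | inv_k (i : I) : Rel D (g (Gen.kinv i) * g (Gen.k i)) 1
  -- central elements
  | ch_central (x : Gen I) : Rel D (g Gen.ch * g x) (g x * g Gen.ch)
  | k_central (x : Gen I) :
      Rel D ((Finset.univ.toList.map fun i => g (Gen.k i) ^ D.lab i).prod * g x)
        (g x * (Finset.univ.toList.map fun i => g (Gen.k i) ^ D.lab i).prod)
  -- Cartan part
  | k_k (i j : I) : Rel D (g (Gen.k i) * g (Gen.k j)) (g (Gen.k j) * g (Gen.k i))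
  | k_a (i j : I) (l : NZ) :
      Rel D (g (Gen.k i) * g (Gen.a j l)) (g (Gen.a j l) * g (Gen.k i))
  | qd_k (i : I) : Rel D (g Gen.qd * g (Gen.k i)) (g (Gen.k i) * g Gen.qd)
  | qd_a (i : I) (l : NZ) :
      Rel D (g Gen.qd * g (Gen.a i l)) (D.q ^ (l : ℤ) • (g (Gen.a i l) * g Gen.qd))
  | qd_xp (i : I) (n : ℤ) :
      Rel D (g Gen.qd * g (Gen.xp i n)) (D.q ^ n • (g (Gen.xp i n) * g Gen.qd))
  | qd_xm (i : I) (n : ℤ) :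
      Rel D (g Gen.qd * g (Gen.xm i n)) (D.q ^ n • (g (Gen.xm i n) * g Gen.qd))
  | k_xp (i j : I) (n : ℤ) :
      Rel D (g (Gen.k i) * g (Gen.xp j n)) (D.q ^ D.b i j • (g (Gen.xp j n) * g (Gen.k i)))
  | k_xm (i j : I) (n : ℤ) :
      Rel D (g (Gen.k i) * g (Gen.xm j n)) (D.q ^ (-D.b i j) • (g (Gen.xm j n) * g (Gen.k i)))
  -- Heisenberg part
  | a_a (i j : I) (l m : NZ) :
      Rel D (g (Gen.a i l) * g (Gen.a j m) - g (Gen.a j m) * g (Gen.a i l))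
        (if (l : ℤ) + m = 0 then
          (qInt (D.qi i) (D.A i j * l) / ((l : ℤ) : ℂ) / (D.qi j - (D.qi j)⁻¹)
            * D.κ ^ (-(l : ℤ) * D.M i j)) • (chPow (2 * l) - chPow (-(2 * l)))
        else 0)
  | a_xp (i j : I) (l : NZ) (n : ℤ) :
      Rel D (g (Gen.a i l) * g (Gen.xp j n) - g (Gen.xp j n) * g (Gen.a i l))
        ((qInt (D.qi i) (D.A i j * l) / ((l : ℤ) : ℂ) * D.κ ^ (-(l : ℤ) * D.M i j)) •
          (chPow (-|(l : ℤ)|) * g (Gen.xp j (n + l))))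
  | a_xm (i j : I) (l : NZ) (n : ℤ) :
      Rel D (g (Gen.a i l) * g (Gen.xm j n) - g (Gen.xm j n) * g (Gen.a i l))
        (-(qInt (D.qi i) (D.A i j * l) / ((l : ℤ) : ℂ) * D.κ ^ (-(l : ℤ) * D.M i j)) •
          (chPow |(l : ℤ)| * g (Gen.xm j (n + l))))
  -- currents
  | xp_xp (i j : I) (r s : ℤ) :
      Rel D (D.κ ^ D.M i j • (g (Gen.xp i (r + 1)) * g (Gen.xp j s))
          - D.q ^ D.b i j • (g (Gen.xp i r) * g (Gen.xp j (s + 1))))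
        ((D.κ ^ D.M i j * D.q ^ D.b i j) • (g (Gen.xp j s) * g (Gen.xp i (r + 1)))
          - g (Gen.xp j (s + 1)) * g (Gen.xp i r))
  | xm_xm (i j : I) (r s : ℤ) :
      Rel D (D.κ ^ D.M i j • (g (Gen.xm i (r + 1)) * g (Gen.xm j s))
          - D.q ^ (-D.b i j) • (g (Gen.xm i r) * g (Gen.xm j (s + 1))))
        ((D.κ ^ D.M i j * D.q ^ (-D.b i j)) • (g (Gen.xm j s) * g (Gen.xm i (r + 1)))
          - g (Gen.xm j (s + 1)) * g (Gen.xm i r))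
  | xp_xm (i j : I) (r s : ℤ) :
      Rel D (g (Gen.xp i r) * g (Gen.xm j s) - g (Gen.xm j s) * g (Gen.xp i r))
        (if i = j then
          (D.qi i - (D.qi i)⁻¹)⁻¹ •
            (chPow (r - s) * phiP D i (r + s) - chPow (s - r) * phiM D i (r + s))
        else 0)
  -- Serre relations
  | serre_xp (i j : I) (hij : i ≠ j) (n : Fin (D.serreOrder i j) → ℤ) (s : ℤ) :
      Rel D (serreSum D
        (fun c m => (List.ofFn fun p => g (Gen.xp (c p) (m p))).prod) i j n s) 0
  | serre_xm (i j : I) (hij : i ≠ j) (n : Fin (D.serreOrder i j) → ℤ) (s : ℤ) :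
      Rel D (serreSum D
        (fun c m => (List.ofFn fun p => g (Gen.xm (c p) (m p))).prod) i j n s) 0

end Algebra

/-- The quantum toroidal algebra, by generators and relations. -/
abbrev Toroidal {I : Type*} [Fintype I] (D : Datum I) : Type _ := RingQuot (Rel D)

section Algebra

variable {I : Type*} [Fintype I] (D : Datum I)

/-- The image of a generator in the quantum toroidal algebra. -/
def gen (x : Gen I) : Toroidal D := RingQuot.mkAlgHom ℂ (Rel D) (FreeAlgebra.ι ℂ x)

/-- The subalgebra generated by all the generators except `q^{±d}`. -/
def Toroidal' : Subalgebra ℂ (Toroidal D) :=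
  Algebra.adjoin ℂ {y | ∃ x : Gen I, x ≠ Gen.qd ∧ x ≠ Gen.qdinv ∧ y = gen D x}

end Algebra

/-! ## Restricted modules -/

section Modules

variable {V : Type*} [AddCommGroup V] [Module ℂ V]

/-- The grading condition for `T = q^d`: `V` is the direct sum of the eigenspaces of `T`, and for
every `c` the eigenspaces for `c q ^ n` vanish for all large `n`. -/
def IsRestricted (q : ℂ) (T : Module.End ℂ V) : Prop :=
  (⨆ c : ℂ, Module.End.eigenspace T c) = ⊤ ∧
  ∀ c : ℂ, ∃ n₀ : ℕ, ∀ n : ℕ, n₀ < n → Module.End.eigenspace T (c * q ^ n) = ⊥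

/-- A module over the quantum toroidal algebra has level given by `γ = q^{k/2}` and `ζ = q^{-l}`, and
is restricted. -/
structure IsRestrictedToroidalModule {I : Type*} [Fintype I] (D : Datum I) (γ ζ : ℂ)
    (π : Toroidal D →ₐ[ℂ] Module.End ℂ V) : Prop where
  level_c : π (gen D Gen.ch) = γ • 1
  level_k : π (Finset.univ.toList.map fun i => gen D (Gen.k i) ^ D.lab i).prod = ζ • 1
  restricted : IsRestricted D.q (π (gen D Gen.qd))

/-- The coefficient of `z^{-r} w^{-s}` in `f(w/z) A(z) B(w) v`. On restricted modules only finitely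
many terms of the sum are nonzero. -/
def twoPoint (f : PowerSeries ℂ) (A B : ℤ → Module.End ℂ V) (r s : ℤ) (v : V) : V :=
  ∑ᶠ n : ℕ, PowerSeries.coeff n f • A (r - n) (B (s + n) v)

/-- The coefficient of `∏_p x_p^{-m_p}` in
`(∏_{p < p'} F_{c_p, c_{p'}}(x_{p'} / x_p)) Z_{c_0}(x_0) Z_{c_1}(x_1) ⋯ v`. On restricted modules only
finitely many terms of the sum are nonzero. -/
def nPoint {I : Type*} (F : I → I → PowerSeries ℂ) (Z : I → ℤ → Module.End ℂ V) (v : V) {L : ℕ}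
    (c : Fin L → I) (m : Fin L → ℤ) : V :=
  ∑ᶠ e : {x : Fin L × Fin L // x.1 < x.2} → ℕ,
    (∏ x, PowerSeries.coeff (e x) (F (c x.1.1) (c x.1.2))) •
      (List.ofFn fun p => Z (c p) (m p + (∑ x, if x.1.2 = p then (e x : ℤ) else 0)
        - (∑ x, if x.1.1 = p then (e x : ℤ) else 0))).prod v

/-! ## The quantum `Z`-algebra and the Heisenberg algebra -/

/-- Operators `Z^±_{i,m}`, `k_i^{±1}`, `q^{±d}` on a space. -/
structure ZOps (I V : Type*) [AddCommGroup V] [Module ℂ V] where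
  Zp : I → ℤ → Module.End ℂ V
  Zm : I → ℤ → Module.End ℂ V
  k : I → (Module.End ℂ V)ˣ
  qd : (Module.End ℂ V)ˣ

open scoped Classical in
/-- The operators define a restricted module over the (non-dynamical) quantum `Z`-algebra, of level
given by `γ = q^{k/2}` and `ζ = q^{-l}`. -/
structure IsZModule {I : Type*} [Fintype I] (D : Datum I) (γ ζ : ℂ) (ρ : ZOps I V) : Prop where
  k_k : ∀ i j, ρ.k i * ρ.k j = ρ.k j * ρ.k i
  qd_k : ∀ i, ρ.qd * ρ.k i = ρ.k i * ρ.qd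
  qd_Zp : ∀ i n, (ρ.qd : Module.End ℂ V) * ρ.Zp i n = D.q ^ n • (ρ.Zp i n * ρ.qd)
  qd_Zm : ∀ i n, (ρ.qd : Module.End ℂ V) * ρ.Zm i n = D.q ^ n • (ρ.Zm i n * ρ.qd)
  k_Zp : ∀ i j n, (ρ.k i : Module.End ℂ V) * ρ.Zp j n = D.q ^ D.b i j • (ρ.Zp j n * ρ.k i)
  k_Zm : ∀ i j n, (ρ.k i : Module.End ℂ V) * ρ.Zm j n = D.q ^ (-D.b i j) • (ρ.Zm j n * ρ.k i)
  level_k :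
    (Finset.univ.toList.map fun i => (ρ.k i : Module.End ℂ V) ^ D.lab i).prod = ζ • 1
  restricted : IsRestricted D.q (ρ.qd : Module.End ℂ V)
  /-- With `f_ij(x) = (q^{-b_ij} κ^{-m_ij} x; q^{2k})_∞ / (q^{2k} q^{b_ij} κ^{-m_ij} x; q^{2k})_∞`:
  `z f_ij(w/z) Z_i(z) Z_j(w) = -w κ^{-m_ij} f_ji(z/w) Z_j(w) Z_i(z)`. -/
  Zp_Zp : ∀ i j r s v,
    twoPoint (ratio (γ ^ 4) (D.q ^ (-D.b i j) * D.κ ^ (-D.M i j))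
        (γ ^ 4 * D.q ^ D.b i j * D.κ ^ (-D.M i j))) (ρ.Zp i) (ρ.Zp j) (r + 1) s v
      = -(D.κ ^ (-D.M i j)) • twoPoint (ratio (γ ^ 4) (D.q ^ (-D.b i j) * D.κ ^ D.M i j)
        (γ ^ 4 * D.q ^ D.b i j * D.κ ^ D.M i j)) (ρ.Zp j) (ρ.Zp i) (s + 1) r v
  Zm_Zm : ∀ i j r s v,
    twoPoint (ratio (γ ^ 4) (D.q ^ (-D.b i j) * D.κ ^ (-D.M i j))
        (γ ^ 4 * D.q ^ D.b i j * D.κ ^ (-D.M i j))) (ρ.Zm i) (ρ.Zm j) (r + 1) s v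
      = -(D.κ ^ (-D.M i j)) • twoPoint (ratio (γ ^ 4) (D.q ^ (-D.b i j) * D.κ ^ D.M i j)
        (γ ^ 4 * D.q ^ D.b i j * D.κ ^ D.M i j)) (ρ.Zm j) (ρ.Zm i) (s + 1) r v
  /-- With `h_ij(x) = (q^k q^{b_ij} κ^{-m_ij} x; q^{2k})_∞ / (q^k q^{-b_ij} κ^{-m_ij} x; q^{2k})_∞`:
  `h_ij(w/z) Z^+_i(z) Z^-_j(w) - h_ji(z/w) Z^-_j(w) Z^+_i(z)
    = δ_ij / (q_i - q_i⁻¹) (δ(q^k w/z) k_i - δ(q^{-k} w/z) k_i⁻¹)`. -/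
  Zp_Zm : ∀ i j r s v,
    twoPoint (ratio (γ ^ 4) (γ ^ 2 * D.q ^ D.b i j * D.κ ^ (-D.M i j))
        (γ ^ 2 * D.q ^ (-D.b i j) * D.κ ^ (-D.M i j))) (ρ.Zp i) (ρ.Zm j) r s v
      - twoPoint (ratio (γ ^ 4) (γ ^ 2 * D.q ^ D.b i j * D.κ ^ D.M i j)
        (γ ^ 2 * D.q ^ (-D.b i j) * D.κ ^ D.M i j)) (ρ.Zm j) (ρ.Zp i) s r v
      = if i = j ∧ r + s = 0 then
          (D.qi i - (D.qi i)⁻¹)⁻¹ • ((γ ^ 2) ^ r • (ρ.k i : Module.End ℂ V) v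
            - (γ ^ 2) ^ (-r) • ((ρ.k i)⁻¹ : (Module.End ℂ V)ˣ).val v)
        else 0
  serre_Zp : ∀ i j, i ≠ j → ∀ n s v,
    serreSum D (nPoint (fun i j => ratio (γ ^ 4) (D.q ^ (-D.b i j) * D.κ ^ (-D.M i j))
      (D.q ^ D.b i j * D.κ ^ (-D.M i j))) ρ.Zp v) i j n s = 0
  serre_Zm : ∀ i j, i ≠ j → ∀ n s v,
    serreSum D (nPoint (fun i j => ratio (γ ^ 4) (γ ^ 4 * D.q ^ (-D.b i j) * D.κ ^ (-D.M i j))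
      (γ ^ 4 * D.q ^ D.b i j * D.κ ^ (-D.M i j))) ρ.Zm v) i j n s = 0

/-- The number `[km] = (q^{km} - q^{-km}) / (q - q⁻¹)`, with `γ = q^{k/2}`. -/
def levelInt (q γ : ℂ) (m : ℤ) : ℂ := (γ ^ (2 * m) - γ ^ (-(2 * m))) / (q - q⁻¹)

/-- Operators `a_{i,m}` in addition to those of the `Z`-algebra. -/
structure HZOps (I V : Type*) [AddCommGroup V] [Module ℂ V] extends ZOps I V where
  a : I → NZ → Module.End ℂ V

/-- The operators define a restricted module over the tensor product of the Heisenberg algebra of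
level `k` with the quantum `Z`-algebra (`q^d` acting diagonally): the two algebras act on the same
space, and their actions commute. -/
structure IsHZModule {I : Type*} [Fintype I] (D : Datum I) (γ ζ : ℂ) (ρ : HZOps I V) : Prop where
  isZModule : IsZModule D γ ζ ρ.toZOps
  a_a : ∀ i j l m, ρ.a i l * ρ.a j m - ρ.a j m * ρ.a i l =
    if (l : ℤ) + m = 0 then
      (qInt D.q (D.b i j * l) / ((l : ℤ) : ℂ) * levelInt D.q γ l * D.κ ^ (-(l : ℤ) * D.M i j)) •
        (1 : Module.End ℂ V)
    else 0
  qd_a : ∀ i l, (ρ.qd : Module.End ℂ V) * ρ.a i l = D.q ^ (l : ℤ) • (ρ.a i l * ρ.qd)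
  a_k : ∀ i j l, ρ.a i l * ρ.k j = ρ.k j * ρ.a i l
  a_Zp : ∀ i j l n, ρ.a i l * ρ.Zp j n = ρ.Zp j n * ρ.a i l
  a_Zm : ∀ i j l n, ρ.a i l * ρ.Zm j n = ρ.Zm j n * ρ.a i l

/-- For `ε = ±1`, the coefficient of `z^{-n}` in `E^+(a_j, z)^ε`, where
`E^+(a_j, z) = exp (∑_{m > 0} (q - q⁻¹) / (q^{km} - q^{-km}) a_{j,m} z^{-m})`. -/
def EPlus {I : Type*} (D : Datum I) (γ : ℂ) (a : I → NZ → Module.End ℂ V) (ε : ℤ) (j : I) (n : ℕ) :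
    Module.End ℂ V :=
  expCoeff (fun m => ((ε : ℂ) / levelInt D.q γ (m + 1)) • a j (pos m)) n

/-- For `ε = ±1`, the coefficient of `z^n` in `E^-(a_j, z)^ε`, where
`E^-(a_j, z) = exp (-∑_{m > 0} (q - q⁻¹) / (q^{km} - q^{-km}) a_{j,-m} z^m)`. -/
def EMinus {I : Type*} (D : Datum I) (γ : ℂ) (a : I → NZ → Module.End ℂ V) (ε : ℤ) (j : I) (n : ℕ) :
    Module.End ℂ V :=
  expCoeff (fun m => (-(ε : ℂ) / levelInt D.q γ (m + 1)) • a j (neg m)) n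

/-- The coefficient of `z^{-n}` in `E^-(a_j, γ^ε z)^ε E^+(a_j, γ^{-ε} z)^ε Z(z) v`. On restricted
modules only finitely many terms of the sum are nonzero. -/
def dressed {I : Type*} (D : Datum I) (γ : ℂ) (a : I → NZ → Module.End ℂ V) (ε : ℤ) (j : I)
    (Z : ℤ → Module.End ℂ V) (n : ℤ) (v : V) : V :=
  ∑ᶠ p : ℕ × ℕ, γ ^ (ε * (p.1 + p.2)) •
    EMinus D γ a ε j p.1 (EPlus D γ a ε j p.2 (Z (n + p.1 - p.2) v))

/-- The module `π` over the quantum toroidal algebra is given by the dressed currents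
`X^{+'}_j(z) = E^-(a_j, q^{-k/2} z)⁻¹ E^+(a_j, q^{k/2} z)⁻¹ ⊗ Z^+_j(z)` and
`X^{-'}_j(z) = E^-(a_j, q^{k/2} z) E^+(a_j, q^{-k/2} z) ⊗ Z^-_j(z)`,
together with `k_j`, `a_{j,m} = [d_j] a^∨_{j,m}`, `q^{c/2} = q^{k/2}` and `q^d`. -/
structure IsDressing {I : Type*} [Fintype I] (D : Datum I) (γ : ℂ) (ρ : HZOps I V)
    (π : Toroidal D →ₐ[ℂ] Module.End ℂ V) : Prop where
  xp : ∀ j n v, π (gen D (Gen.xp j n)) v = dressed D γ ρ.a (-1) j (ρ.Zp j) n v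
  xm : ∀ j n v, π (gen D (Gen.xm j n)) v = dressed D γ ρ.a 1 j (ρ.Zm j) n v
  k : ∀ j, π (gen D (Gen.k j)) = ρ.k j
  a : ∀ j l, qInt D.q (D.d j) • π (gen D (Gen.a j l)) = ρ.a j l
  ch : π (gen D Gen.ch) = γ • 1
  qd : π (gen D Gen.qd) = ρ.qd

end Modules

/-! ## The Fock module -/

section Fock

variable {I : Type*}

/-- The Fock space: polynomials in the variables `(i, n)`, which stand for `a_{i,-(n+1)}`. -/
abbrev Fock (I : Type*) : Type _ := MvPolynomial (I × ℕ) ℂ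

/-- The action of `a_{i,l}` on the Fock space of level `k`: for `l = -n < 0` multiplication by the
variable `a_{i,-n}`; for `l = n > 0` the derivation
`∑_j [b_ij n] [kn] / n κ^{-n m_ij} ∂ / ∂ a_{j,-n}`. -/
def fockA [Fintype I] (D : Datum I) (γ : ℂ) (i : I) (l : NZ) : Module.End ℂ (Fock I) :=
  if (l : ℤ) < 0 then LinearMap.mulLeft ℂ (MvPolynomial.X (i, (l : ℤ).natAbs - 1))
  else ∑ j, (qInt D.q (D.b i j * l) / ((l : ℤ) : ℂ) * levelInt D.q γ l
      * D.κ ^ (-(l : ℤ) * D.M i j)) •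
    (MvPolynomial.pderiv (j, (l : ℤ).natAbs - 1)).toLinearMap

/-- The action of `q^{±d}` on the Fock space: the algebra map sending `a_{i,-n}` to
`q^{∓n} a_{i,-n}`. -/
def fockD (c : ℂ) : Module.End ℂ (Fock I) :=
  (MvPolynomial.aeval fun x : I × ℕ => c ^ (x.2 + 1) • MvPolynomial.X x).toLinearMap

theorem fockD_mul (c c' : ℂ) (h : c * c' = 1) : (fockD c : Module.End ℂ (Fock I)) * fockD c' = 1 := by
  have : (MvPolynomial.aeval fun x : I × ℕ => c ^ (x.2 + 1) • MvPolynomial.X (R := ℂ) x).comp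
      (MvPolynomial.aeval fun x : I × ℕ => c' ^ (x.2 + 1) • MvPolynomial.X (R := ℂ) x)
      = AlgHom.id ℂ (Fock I) := by
    ext x : 1
    simp [smul_smul, ← mul_pow, mul_comm c' c, h]
  exact congrArg AlgHom.toLinearMap this

/-- `q^d` on the Fock space, as a unit. -/
def fockQd (q : ℂˣ) : (Module.End ℂ (Fock I))ˣ where
  val := fockD (q⁻¹ : ℂˣ)
  inv := fockD q
  val_inv := fockD_mul _ _ (by simp)
  inv_val := fockD_mul _ _ (by simp)

variable {W : Type*} [AddCommGroup W] [Module ℂ W]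

/-- The tensor product of two invertible operators. -/
def tensorUnit {F : Type*} [AddCommGroup F] [Module ℂ F] (x : (Module.End ℂ F)ˣ)
    (y : (Module.End ℂ W)ˣ) : (Module.End ℂ (F ⊗[ℂ] W))ˣ where
  val := TensorProduct.map x.val y.val
  inv := TensorProduct.map x.inv y.inv
  val_inv := by rw [← TensorProduct.map_mul]; simp
  inv_val := by rw [← TensorProduct.map_mul]; simp

/-- The operators `a_{i,m} ⊗ 1`, `1 ⊗ Z^±_{i,m}`, `1 ⊗ k_i` and `q^d ⊗ q^d` on the tensor product of
the Fock module with a module over the quantum `Z`-algebra. -/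
def fockTensor [Fintype I] (D : Datum I) (γ : ℂ) (q : ℂˣ) (σ : ZOps I W) : HZOps I (Fock I ⊗[ℂ] W) where
  Zp i n := TensorProduct.map LinearMap.id (σ.Zp i n)
  Zm i n := TensorProduct.map LinearMap.id (σ.Zm i n)
  k i := tensorUnit 1 (σ.k i)
  qd := tensorUnit (fockQd q) σ.qd
  a i l := TensorProduct.map (fockA D γ i l) LinearMap.id

end Fock

end

end QToroidal

/-! On a restricted module every vector is killed by all operators of large enough degree
(`isBdd_of_isRestricted`). Hence every infinite sum of modes that occurs is locally finite, and such
sums can be multiplied, regrouped and compared like finite ones.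

Since the Heisenberg operators commute with the `Z`-currents, a dressed current can be written in
normal order: a lowering exponential, then `Z`, then a raising exponential. Dressing a series in
several variables in this way is a linear operation on graded families. It is inverted by the
opposite exponentials (`dress_dress`), so it is injective.

In a product of dressed currents the raising exponentials have to be moved to the right past the
lowering ones. By the Heisenberg relations this costs a scalar series in `w/z` for each pair
(`IsHeis.exchange`), and the product becomes the dressing of the product of the `Z`-currents
multiplied by all these series (`Dressing.prod_X`). Written as exponentials, the series are
quotients of infinite products in base `q^{2k} = γ^4` (`F_same`, `F_ne`).

Consequently a relation between the dressed currents is the dressing of a relation between the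
`Z`-currents, and injectivity makes the two equivalent. For the quadratic relations the linear
factors shift one parameter of the quotient by `q^{2k}` (`quadratic_iff`, `X_X_iff`). For the
commutator of `X^+` and `X^-` the delta function identifies `z` with a multiple of `w`; one half of
the exponentials then cancels and the other half becomes `Φ^±` (`dr_delta_pos`, `dr_delta_neg`,
`mixed_iff`). For the Serre relations all monomials are first brought to the same variables
(`serre_iff`). The brackets with `a_{i,n}` come from the rule that a Heisenberg operator acts as a
derivation on exponentials. `isHZModule_iff` collects all this into one equivalence.

From a toroidal module the `Z`-currents are recovered by undressing; they commute with the
Heisenberg operators because the two contributions to the bracket cancel (`a_unX`). Both uniqueness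
claims hold because dressing is invertible and the remaining generators are prescribed. The
generation claim holds because the commutators of `X^+_i` with `X^-_i` contain the coefficients of
`Φ^±_i`, from which the `a_{i,n}` are obtained by taking a logarithm recursively
(`IsCurrentModule.a_mem`). For the Fock module it remains to check the Heisenberg relations for
multiplications and derivations, and that the tensor product is again restricted. -/

namespace QToroidal

noncomputable section

/-! ## Locally finite sums -/

section FSum

variable {V ι κ : Type*} [AddCommGroup V]

/-- All but finitely many terms of the family `f` vanish, and its sum is `x`. -/
def FSum (f : ι → V) (x : V) : Prop :=
  ∃ s : Finset ι, (∀ i, i ∉ s → f i = 0) ∧ ∑ i ∈ s, f i = x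

theorem FSum.finsum_eq {f : ι → V} {x : V} (h : FSum f x) : ∑ᶠ i, f i = x := by
  obtain ⟨s, hs, rfl⟩ := h
  exact finsum_eq_sum_of_support_subset f fun i hi => by
    by_contra hc
    exact hi (hs i hc)

theorem FSum.unique {f : ι → V} {x y : V} (h : FSum f x) (h' : FSum f y) : x = y :=
  h.finsum_eq.symm.trans h'.finsum_eq

theorem FSum.of_support {f : ι → V} {s : Finset ι} (h : ∀ i, i ∉ s → f i = 0) :
    FSum f (∑ᶠ i, f i) := by
  have : FSum f (∑ i ∈ s, f i) := ⟨s, h, rfl⟩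
  rwa [this.finsum_eq]

theorem FSum.of_subset {f : ι → V} {x : V} (h : FSum f x) (t : Finset ι) :
    ∃ s : Finset ι, t ⊆ s ∧ (∀ i, i ∉ s → f i = 0) ∧ ∑ i ∈ s, f i = x := by
  classical
  obtain ⟨s, hs, rfl⟩ := h
  refine ⟨s ∪ t, Finset.subset_union_right, fun i hi => hs i fun h => hi (by simp [h]), ?_⟩
  exact (Finset.sum_subset Finset.subset_union_left fun i _ hi => hs i hi).symm

theorem FSum.add {f g : ι → V} {x y : V} (h : FSum f x) (h' : FSum g y) :
    FSum (fun i => f i + g i) (x + y) := by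
  classical
  obtain ⟨s, hs, rfl⟩ := h
  obtain ⟨t, hst, ht, rfl⟩ := h'.of_subset s
  refine ⟨t, fun i hi => ?_, ?_⟩
  · simp only [ht i hi, hs i fun h => hi (hst h), add_zero]
  · rw [Finset.sum_add_distrib, Finset.sum_subset hst fun i _ hi => hs i hi]

theorem FSum.map {W : Type*} [AddCommGroup W] {f : ι → V} {x : V} (φ : V →+ W) (h : FSum f x) :
    FSum (fun i => φ (f i)) (φ x) := by
  obtain ⟨s, hs, rfl⟩ := h
  exact ⟨s, fun i hi => by simp only [hs i hi, map_zero], (map_sum φ _ _).symm⟩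

theorem FSum.zero : FSum (fun _ : ι => (0 : V)) 0 := ⟨∅, by simp, by simp⟩

theorem FSum.equiv {f : ι → V} {x : V} (h : FSum f x) (e : κ ≃ ι) : FSum (fun k => f (e k)) x := by
  obtain ⟨s, hs, rfl⟩ := h
  refine ⟨s.map e.symm.toEmbedding, fun k hk => hs _ fun h => hk ?_, ?_⟩
  · simpa using h
  · simp

-- A Fubini rule: the finite support of `f` meets only finitely many fibres of `g`, so `y` vanishes
-- outside the image of that support, and uniqueness of sums identifies each `y k` with a finite
-- sum.
open scoped Classical in
theorem FSum.fiberwise {f : ι → V} {x : V} (h : FSum f x) (g : ι → κ) {y : κ → V}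
    (hy : ∀ k, FSum (fun i => if g i = k then f i else 0) (y k)) : FSum y x := by
  obtain ⟨s, hs, rfl⟩ := h
  have key : ∀ k, y k = ∑ i ∈ s, if g i = k then f i else 0 := fun k =>
    (hy k).unique ⟨s, fun i hi => by simp [hs i hi], rfl⟩
  refine ⟨s.image g, fun k hk => ?_, ?_⟩
  · rw [key]
    refine Finset.sum_eq_zero fun i hi => if_neg fun h => hk ?_
    exact h ▸ Finset.mem_image_of_mem g hi
  · simp_rw [key]
    rw [Finset.sum_comm]
    refine Finset.sum_congr rfl fun i hi => ?_
    rw [Finset.sum_ite_eq, if_pos (Finset.mem_image_of_mem g hi)]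

theorem FSum.prod {f : ι × κ → V} {x : V} (h : FSum f x) {y : ι → V}
    (hy : ∀ i, FSum (fun k => f (i, k)) (y i)) : FSum y x := by
  classical
  refine h.fiberwise Prod.fst fun i => ?_
  obtain ⟨s, hs, hy⟩ := hy i
  refine ⟨s.map ⟨fun k => (i, k), fun a b h => by simpa using h⟩, fun k hk => ?_, ?_⟩
  · by_cases hi : k.1 = i
    · subst hi
      simp only [if_true]
      exact hs k.2 fun hc => hk (by simpa using ⟨k.2, hc, rfl⟩)
    · exact if_neg hi
  · rw [← hy, Finset.sum_map]
    exact Finset.sum_congr rfl fun k _ => if_pos rfl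

/-- Summation along the finite fibres of `g`, the fibre over `k` being the injective image of a
finite set `t k` under `j k`. -/
theorem FSum.fiber_param {α : Type*} {f : ι → V} {x : V} (h : FSum f x) (g : ι → κ)
    (t : κ → Finset α) (j : κ → α → ι) (hj : ∀ k, Set.InjOn (j k) (t k))
    (hg : ∀ k, ∀ a ∈ t k, g (j k a) = k) (hs : ∀ i, ∃ a ∈ t (g i), j (g i) a = i) :
    FSum (fun k => ∑ a ∈ t k, f (j k a)) x := by
  classical
  refine h.fiberwise g fun k => ⟨(t k).image (j k), fun i hi => if_neg fun hk => hi ?_, ?_⟩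
  · obtain ⟨a, ha, hai⟩ := hs i
    subst hk
    exact Finset.mem_image.mpr ⟨a, ha, hai⟩
  · rw [Finset.sum_image (hj k)]
    exact Finset.sum_congr rfl fun a ha => if_pos (hg k a ha)

end FSum

/-! ### Locally finite families of operators -/

section LSum

variable {V W ι κ : Type*} [AddCommGroup V] [Module ℂ V] [AddCommGroup W] [Module ℂ W]

/-- For every vector, only finitely many members of the family do not annihilate it. -/
def LocFin (A : ι → Module.End ℂ V) : Prop := ∀ v, ∃ s : Finset ι, ∀ i, i ∉ s → A i v = 0

/-- The family is locally finite with sum `S`. -/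
def HasLSum (A : ι → Module.End ℂ V) (S : Module.End ℂ V) : Prop := ∀ v, FSum (fun i => A i v) (S v)

open scoped Classical in
/-- The sum of a locally finite family of operators. -/
def lsum (A : ι → Module.End ℂ V) : Module.End ℂ V :=
  if h : LocFin A then
    { toFun := fun v => ∑ᶠ i, A i v
      map_add' := fun v w => by
        have hv := FSum.of_support (h v).choose_spec
        have hw := FSum.of_support (h w).choose_spec
        have := (hv.add hw).finsum_eq
        simpa using this
      map_smul' := fun c v => by
        have hv := FSum.of_support (h v).choose_spec
        have := (hv.map (c • LinearMap.id (R := ℂ) (M := V)).toAddMonoidHom).finsum_eq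
        simpa using this }
  -- The value 0 outside locally finite families lets `dress`, `word` and `tp` be defined without
  -- hypotheses; the grading supplies local finiteness whenever such a sum is evaluated.
  else 0

theorem LocFin.hasLSum {A : ι → Module.End ℂ V} (h : LocFin A) : HasLSum A (lsum A) := fun v => by
  obtain ⟨s, hs⟩ := h v
  rw [lsum, dif_pos h]
  exact FSum.of_support hs

variable {A B : ι → Module.End ℂ V} {S S' : Module.End ℂ V}

theorem HasLSum.locFin (h : HasLSum A S) : LocFin A := fun v => (h v).imp fun _ hs => hs.1

theorem HasLSum.unique (h : HasLSum A S) (h' : HasLSum A S') : S = S' :=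
  LinearMap.ext fun v => (h v).unique (h' v)

theorem HasLSum.lsum_eq (h : HasLSum A S) : lsum A = S := h.locFin.hasLSum.unique h

theorem HasLSum.finsum_eq (h : HasLSum A S) (v : V) : ∑ᶠ i, A i v = S v := (h v).finsum_eq

theorem HasLSum.congr (h : HasLSum A S) (hB : ∀ i, B i = A i) (hS : S' = S) : HasLSum B S' := by
  subst hS
  rwa [funext hB]

theorem HasLSum.zero : HasLSum (fun _ : ι => (0 : Module.End ℂ V)) 0 := fun _ => FSum.zero

theorem HasLSum.add (h : HasLSum A S) (h' : HasLSum B S') :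
    HasLSum (fun i => A i + B i) (S + S') := fun v => (h v).add (h' v)

theorem HasLSum.mul_left (h : HasLSum A S) (C : Module.End ℂ V) :
    HasLSum (fun i => C * A i) (C * S) := fun v => (h v).map C.toAddMonoidHom

theorem HasLSum.mul_right (h : HasLSum A S) (C : Module.End ℂ V) :
    HasLSum (fun i => A i * C) (S * C) := fun v => h (C v)

theorem HasLSum.smul (h : HasLSum A S) (c : ℂ) : HasLSum (fun i => c • A i) (c • S) := by
  simpa using h.mul_left (c • 1)

theorem HasLSum.neg (h : HasLSum A S) : HasLSum (fun i => -A i) (-S) := by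
  simpa using h.smul (-1)

theorem HasLSum.sub (h : HasLSum A S) (h' : HasLSum B S') :
    HasLSum (fun i => A i - B i) (S - S') := by
  simpa [sub_eq_add_neg] using h.add h'.neg

theorem HasLSum.sum {α : Type*} (t : Finset α) {A : α → ι → Module.End ℂ V}
    {S : α → Module.End ℂ V} (h : ∀ a ∈ t, HasLSum (A a) (S a)) :
    HasLSum (fun i => ∑ a ∈ t, A a i) (∑ a ∈ t, S a) := by
  classical
  induction t using Finset.induction_on with
  | empty => simpa using HasLSum.zero
  | insert a t ha ih =>
    simp_rw [Finset.sum_insert ha]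
    exact (h a (by simp)).add (ih fun b hb => h b (by simp [hb]))

theorem HasLSum.equiv (h : HasLSum A S) (e : κ ≃ ι) : HasLSum (fun k => A (e k)) S :=
  fun v => (h v).equiv e

theorem HasLSum.single [DecidableEq ι] (i₀ : ι) (C : Module.End ℂ V) :
    HasLSum (fun i => if i = i₀ then C else 0) C := fun v =>
  ⟨{i₀}, fun i hi => by simp [show i ≠ i₀ by simpa using hi], by simp⟩

theorem HasLSum.prod {A : ι × κ → Module.End ℂ V} (h : HasLSum A S) {C : ι → Module.End ℂ V}
    (hC : ∀ i, HasLSum (fun k => A (i, k)) (C i)) : HasLSum C S :=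
  fun v => (h v).prod fun i => hC i v

theorem HasLSum.fiber_param {α : Type*} (h : HasLSum A S) (g : ι → κ)
    (t : κ → Finset α) (j : κ → α → ι) (hj : ∀ k, Set.InjOn (j k) (t k))
    (hg : ∀ k, ∀ a ∈ t k, g (j k a) = k) (hs : ∀ i, ∃ a ∈ t (g i), j (g i) a = i) :
    HasLSum (fun k => ∑ a ∈ t k, A (j k a)) S := fun v => by
  simpa [LinearMap.sum_apply] using (h v).fiber_param g t j hj hg hs

/-- The right factor acts first: only finitely many `B k v` are nonzero, and for each of these only
finitely many `i` matter. No uniformity of `A k` in `k` is needed. -/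
theorem LocFin.bind {A : κ → ι → Module.End ℂ V} {B : κ → Module.End ℂ V} (hB : LocFin B)
    (hA : ∀ k, LocFin (A k)) : LocFin fun x : κ × ι => A x.1 x.2 * B x.1 := fun v => by
  classical
  obtain ⟨s, hs⟩ := hB v
  choose t ht using fun k => hA k (B k v)
  refine ⟨s.biUnion fun k => (t k).image fun i => (k, i), fun x hx => ?_⟩
  simp only [Finset.mem_biUnion, Finset.mem_image, not_exists, not_and] at hx
  by_cases h : x.1 ∈ s
  · refine ht x.1 x.2 fun hc => hx _ h _ hc rfl
  · simp [hs _ h]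

/-- For families where a degree bound cuts off the first index independently of the second, although
the second index need not be bounded uniformly. -/
theorem LocFin.of_fst {A : ι × κ → Module.End ℂ V}
    (h : ∀ v, ∃ s : Finset ι, ∀ i, i ∉ s → ∀ k, A (i, k) v = 0)
    (hA : ∀ i, LocFin fun k => A (i, k)) : LocFin A := fun v => by
  classical
  obtain ⟨s, hs⟩ := h v
  choose t ht using fun i => hA i v
  refine ⟨s.biUnion fun k => (t k).image fun i => (k, i), fun x hx => ?_⟩
  simp only [Finset.mem_biUnion, Finset.mem_image, not_exists, not_and] at hx
  by_cases h : x.1 ∈ s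
  · refine ht x.1 x.2 fun hc => hx _ h _ hc rfl
  · exact hs _ h _

theorem LocFin.mul_left (h : LocFin A) (C : ι → Module.End ℂ V) : LocFin fun i => C i * A i :=
  fun v => (h v).imp fun s hs i hi => by simp [hs i hi]

theorem LocFin.equiv (h : LocFin A) (e : κ ≃ ι) : LocFin fun k => A (e k) :=
  (h.hasLSum.equiv e).locFin

/-- The double family is locally finite by `LocFin.bind`, with the indices of the right factor
chosen first. Summing over the left index and then over the right one gives the product of the sums.
-/
theorem HasLSum.mul {B : κ → Module.End ℂ V} (hA : HasLSum A S) (hB : HasLSum B S') :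
    HasLSum (fun x : ι × κ => A x.1 * B x.2) (S * S') := by
  have h : LocFin fun x : κ × ι => A x.2 * B x.1 := hB.locFin.bind fun _ => hA.locFin
  have h1 := h.hasLSum
  have h2 : HasLSum (fun k => S * B k) (lsum fun x : κ × ι => A x.2 * B x.1) :=
    h1.prod fun k => hA.mul_right (B k)
  rw [(hB.mul_left S).unique h2]
  exact h1.equiv (Equiv.prodComm ι κ)

/-- A tensor is a finite sum of pure tensors, so its finite supports can be united. This carries the
identities of a `Z`-module to its tensor product with the Fock module. -/
theorem HasLSum.lTensor {A : ι → Module.End ℂ W} {S : Module.End ℂ W} (h : HasLSum A S) :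
    HasLSum (fun i => TensorProduct.map (LinearMap.id : V →ₗ[ℂ] V) (A i))
      (TensorProduct.map LinearMap.id S) := fun x => by
  induction x using TensorProduct.induction_on with
  | zero => simpa using FSum.zero
  | tmul f w =>
    simpa using (h w).map (TensorProduct.mk ℂ V W f).toAddMonoidHom
  | add x y hx hy => simpa using hx.add hy

end LSum

end

open Finset.HasAntidiagonal

noncomputable section

/-! ## Formal exponentials -/

section Exp

theorem expCoeff_map {B C : Type*} [Ring B] [Algebra ℂ B] [Ring C] [Algebra ℂ C] (φ : B →ₐ[ℂ] C)
    (x : ℕ → B) (n : ℕ) : φ (expCoeff x n) = expCoeff (fun m => φ (x m)) n := by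
  have h : PowerSeries.map (φ : B →+* C) (PowerSeries.X * PowerSeries.mk x)
      = PowerSeries.X * PowerSeries.mk fun m => φ (x m) := by
    rw [map_mul, PowerSeries.map_X]
    congr 1
  simp only [expCoeff, map_sum, map_smul, ← h, ← map_pow, PowerSeries.coeff_map]
  rfl

theorem expCoeff_smul {B : Type*} [Ring B] [Algebra ℂ B] (c : ℂ) (x : ℕ → B) (n : ℕ) :
    expCoeff (fun m => c ^ (m + 1) • x m) n = c ^ n • expCoeff x n := by
  have h : PowerSeries.X * PowerSeries.mk (fun m => c ^ (m + 1) • x m)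
      = PowerSeries.mk fun n => c ^ n • PowerSeries.coeff n (PowerSeries.X * PowerSeries.mk x) := by
    ext n
    cases n <;> simp [PowerSeries.coeff_succ_X_mul]
  have h2 (j n : ℕ) : PowerSeries.coeff n ((PowerSeries.mk fun n =>
      c ^ n • PowerSeries.coeff n (PowerSeries.X * PowerSeries.mk x)) ^ j)
      = c ^ n • PowerSeries.coeff n ((PowerSeries.X * PowerSeries.mk x) ^ j) := by
    induction j generalizing n with
    | zero =>
      rw [pow_zero, pow_zero, PowerSeries.coeff_one]
      split_ifs with h <;> simp [h]
    | succ j ih =>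
      rw [pow_succ, pow_succ, PowerSeries.coeff_mul, PowerSeries.coeff_mul, Finset.smul_sum]
      refine Finset.sum_congr rfl fun p hp => ?_
      rw [ih, PowerSeries.coeff_mk, smul_mul_smul_comm, ← pow_add, mem_antidiagonal.mp hp]
  simp only [expCoeff, h, h2, Finset.smul_sum]
  exact Finset.sum_congr rfl fun j _ => smul_comm _ _ _

-- Commuting elements generate a commutative subalgebra. Identities for exponentials can therefore
-- be proved in a polynomial ring and then mapped into the operators.
open scoped IsMulCommutative in
theorem exists_algHom_of_commute {B ι : Type*} [Ring B] [Algebra ℂ B] (x : ι → B)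
    (h : ∀ i j, x i * x j = x j * x i) :
    ∃ φ : MvPolynomial ι ℂ →ₐ[ℂ] B, ∀ i, φ (MvPolynomial.X i) = x i := by
  have : IsMulCommutative (Algebra.adjoin ℂ (Set.range x)) := Algebra.isMulCommutative_adjoin ℂ (by
    rintro _ ⟨i, rfl⟩ _ ⟨j, rfl⟩
    exact h i j)
  refine ⟨(Algebra.adjoin ℂ (Set.range x)).val.comp (MvPolynomial.aeval fun i =>
    (⟨x i, Algebra.subset_adjoin ⟨i, rfl⟩⟩ : Algebra.adjoin ℂ (Set.range x))), fun i => ?_⟩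
  simp

variable {R : Type*} [CommRing R] [Algebra ℂ R]

/-- The power series `exp (∑_{m ≥ 0} x_m z ^ (m + 1))`. -/
def expS (x : ℕ → R) : PowerSeries R := PowerSeries.mk (expCoeff x)

theorem coeff_X_mul_pow_eq_zero {R : Type*} [CommRing R] (a : PowerSeries R) {n j : ℕ} (h : n < j) :
    PowerSeries.coeff n ((PowerSeries.X * a) ^ j) = 0 := by
  rw [mul_pow]
  rw [PowerSeries.coeff_X_pow_mul', if_neg (by omega)]

/-- The exponent has no constant term, so its higher powers do not reach the coefficient of order
`n`. A common truncation `N` can thus serve several coefficients at once. -/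
theorem expCoeff_eq_sum (x : ℕ → R) {n N : ℕ} (h : n ≤ N) :
    expCoeff x n = ∑ j ∈ Finset.range (N + 1), ((j.factorial : ℂ)⁻¹) •
      PowerSeries.coeff n ((PowerSeries.X * PowerSeries.mk x) ^ j) := by
  rw [expCoeff]
  refine Finset.sum_subset (fun j hj => by simp at hj ⊢; omega) fun j _ hj => ?_
  rw [coeff_X_mul_pow_eq_zero _ (by simpa using hj), smul_zero]

@[simp] theorem expCoeff_zero {B : Type*} [Ring B] [Algebra ℂ B] (x : ℕ → B) : expCoeff x 0 = 1 := by
  simp [expCoeff]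

@[simp] theorem constantCoeff_expS (x : ℕ → R) : PowerSeries.constantCoeff (expS x) = 1 := by
  rw [← PowerSeries.coeff_zero_eq_constantCoeff_apply, expS, PowerSeries.coeff_mk, expCoeff_zero]

/-- Differentiating the truncated exponential sum gives the derivative of the exponent times the sum
truncated one step earlier. Up to a fixed order neither truncation is visible. -/
theorem derivative_expS (x : ℕ → R) : PowerSeries.derivative R (expS x)
    = PowerSeries.derivative R (PowerSeries.X * PowerSeries.mk x) * expS x := by
  set a := PowerSeries.X * PowerSeries.mk x with ha
  have key : ∀ N : ℕ, PowerSeries.derivative R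
        (∑ j ∈ Finset.range (N + 1), ((j.factorial : ℂ)⁻¹) • a ^ j)
      = PowerSeries.derivative R a * ∑ j ∈ Finset.range N, ((j.factorial : ℂ)⁻¹) • a ^ j := by
    intro N
    have hs (c : ℂ) (f : PowerSeries R) :
        PowerSeries.derivative R (c • f) = c • PowerSeries.derivative R f := by
      rw [← algebraMap_smul R c f, Derivation.map_smul, algebraMap_smul]
    rw [Finset.sum_range_succ']
    simp only [map_add, map_sum, hs, Finset.mul_sum, Derivation.leibniz_pow, pow_zero]
    rw [Derivation.map_one_eq_zero, smul_zero, add_zero]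
    refine Finset.sum_congr rfl fun j _ => ?_
    rw [Nat.add_sub_cancel, ← Nat.cast_smul_eq_nsmul ℂ, smul_smul, smul_eq_mul, mul_comm (a ^ j),
      mul_smul_comm]
    congr 1
    rw [Nat.factorial_succ]
    push_cast
    field_simp [Nat.factorial_ne_zero]
  ext n
  have h1 := congrArg (PowerSeries.coeff n) (key (n + 1))
  rw [PowerSeries.coeff_derivative] at h1 ⊢
  rw [PowerSeries.coeff_mul] at h1 ⊢
  rw [expS, PowerSeries.coeff_mk, expCoeff_eq_sum x (le_refl (n + 1))]
  simp only [map_sum, PowerSeries.coeff_smul] at h1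
  refine h1.trans (Finset.sum_congr rfl fun p hp => ?_)
  have hp' : p.2 ≤ n := by have := mem_antidiagonal.mp hp; omega
  rw [PowerSeries.coeff_mk, expCoeff_eq_sum x hp']

/-- Uniqueness for a linear differential equation: the coefficient of order `n + 1` is determined by
the lower ones because `n + 1` is invertible in a `ℂ`-algebra. The functional equation of the
exponential and its logarithm series are deduced from it. -/
theorem eq_of_derivative_eq_mul {f g a : PowerSeries R}
    (hf : PowerSeries.derivative R f = a * f) (hg : PowerSeries.derivative R g = a * g)
    (h0 : PowerSeries.constantCoeff f = PowerSeries.constantCoeff g) : f = g := by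
  ext n
  induction n using Nat.strong_induction_on with
  | _ n ih =>
    cases n with
    | zero => simpa using h0
    | succ n =>
      have h1 := congrArg (PowerSeries.coeff n) hf
      have h2 := congrArg (PowerSeries.coeff n) hg
      rw [PowerSeries.coeff_derivative, PowerSeries.coeff_mul] at h1 h2
      have h3 : PowerSeries.coeff (n + 1) f * ((n : R) + 1)
          = PowerSeries.coeff (n + 1) g * ((n : R) + 1) := by
        rw [h1, h2]
        refine Finset.sum_congr rfl fun p hp => ?_
        rw [ih p.2 (by have := mem_antidiagonal.mp hp; omega)]
      have hu : ((n : R) + 1) * algebraMap ℂ R ((n : ℂ) + 1)⁻¹ = 1 := by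
        have : ((n : R) + 1) = algebraMap ℂ R ((n : ℂ) + 1) := by simp
        rw [this, ← map_mul, mul_inv_cancel₀ (Nat.cast_add_one_ne_zero n), map_one]
      calc _ = PowerSeries.coeff (n + 1) f * ((n : R) + 1) * algebraMap ℂ R ((n : ℂ) + 1)⁻¹ := by
            rw [mul_assoc, hu, mul_one]
        _ = _ := by rw [h3, mul_assoc, hu, mul_one]

theorem expS_add (x y : ℕ → R) : expS (fun m => x m + y m) = expS x * expS y := by
  refine eq_of_derivative_eq_mul (derivative_expS _) ?_ (by simp)
  have : PowerSeries.X * PowerSeries.mk (fun m => x m + y m)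
      = PowerSeries.X * PowerSeries.mk x + PowerSeries.X * PowerSeries.mk y := by
    rw [← mul_add]
    rfl
  rw [Derivation.leibniz, derivative_expS, derivative_expS, this, map_add, smul_eq_mul, smul_eq_mul]
  ring

theorem expS_zero : expS (fun _ => (0 : R)) = 1 := by
  refine eq_of_derivative_eq_mul (derivative_expS _) ?_ (by simp)
  have : PowerSeries.mk (fun _ => (0 : R)) = 0 := by ext; simp
  rw [this]
  simp

theorem expCoeff_add (x y : ℕ → R) (n : ℕ) : expCoeff (fun m => x m + y m) n
    = ∑ p ∈ antidiagonal n, expCoeff x p.1 * expCoeff y p.2 := by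
  simpa [expS, PowerSeries.coeff_mul] using congrArg (PowerSeries.coeff n) (expS_add x y)

theorem expCoeff_zero_fun (n : ℕ) : expCoeff (fun _ => (0 : R)) n = if n = 0 then 1 else 0 := by
  simpa [expS, PowerSeries.coeff_one] using congrArg (PowerSeries.coeff n) (expS_zero (R := R))

theorem expCoeff_add_neg (x y : ℕ → R) (h : ∀ m, x m + y m = 0) (n : ℕ) :
    ∑ p ∈ antidiagonal n, expCoeff x p.1 * expCoeff y p.2 = if n = 0 then 1 else 0 := by
  rw [← expCoeff_add, ← expCoeff_zero_fun]
  simp only [h]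

/-- The recursion `(n + 1) e_{n+1} = ∑ (m + 1) x_m e_{n-m}`. -/
theorem succ_smul_expCoeff (x : ℕ → R) (n : ℕ) : ((n : ℂ) + 1) • expCoeff x (n + 1)
    = ∑ p ∈ antidiagonal n, ((p.1 : ℂ) + 1) • (x p.1 * expCoeff x p.2) := by
  have h := congrArg (PowerSeries.coeff n) (derivative_expS x)
  rw [PowerSeries.coeff_derivative, PowerSeries.coeff_mul] at h
  simp only [PowerSeries.coeff_derivative, PowerSeries.coeff_succ_X_mul, expS,
    PowerSeries.coeff_mk] at h
  rw [Algebra.smul_def, mul_comm]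
  simp only [map_add, map_natCast, map_one]
  rw [h]
  refine Finset.sum_congr rfl fun p _ => ?_
  rw [Algebra.smul_def]
  simp only [map_add, map_natCast, map_one]
  ring

/-- The identity holds in the polynomial ring with the exponents as variables, and is transported
from there. -/
theorem succ_smul_expCoeff_of_commute {B : Type*} [Ring B] [Algebra ℂ B] (x : ℕ → B)
    (hx : ∀ i j, x i * x j = x j * x i) (n : ℕ) : ((n : ℂ) + 1) • expCoeff x (n + 1)
    = ∑ p ∈ antidiagonal n, ((p.1 : ℂ) + 1) • (x p.1 * expCoeff x p.2) := by
  obtain ⟨φ, hφ⟩ := exists_algHom_of_commute x hx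
  have := congrArg φ (succ_smul_expCoeff (fun m => MvPolynomial.X (R := ℂ) m) n)
  simpa only [map_smul, map_sum, map_mul, expCoeff_map, hφ] using this

/-- A derivation with constant values on the exponents acts on the exponential by shifts. -/
theorem commutator_expCoeff {B : Type*} [Ring B] [Algebra ℂ B] (x : ℕ → B)
    (hx : ∀ i j, x i * x j = x j * x i) (y : B) (c : ℂ) (m₀ : ℕ)
    (hy : ∀ m, y * x m = x m * y + if m = m₀ then c • 1 else 0) (n : ℕ) :
    y * expCoeff x n = expCoeff x n * y
      + if m₀ + 1 ≤ n then c • expCoeff x (n - (m₀ + 1)) else 0 := by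
  induction n using Nat.strong_induction_on with
  | _ n ih =>
    cases n with
    | zero => simp
    | succ n =>
      have hn : ((n : ℂ) + 1) ≠ 0 := Nat.cast_add_one_ne_zero n
      have hr := succ_smul_expCoeff_of_commute x hx
      apply smul_right_injective B hn
      -- After multiplication by `n + 1`, the recursion expresses both sides through shorter
      -- exponential coefficients, to which the induction hypothesis applies.
      simp only
      rw [smul_add, ← mul_smul_comm, ← smul_mul_assoc, hr, Finset.mul_sum, Finset.sum_mul]
      have hterm : ∀ p ∈ antidiagonal n, y * (((p.1 : ℂ) + 1) • (x p.1 * expCoeff x p.2))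
          = ((p.1 : ℂ) + 1) • (x p.1 * expCoeff x p.2) * y
            + ((if m₀ + 1 ≤ p.2 then
                c • (((p.1 : ℂ) + 1) • (x p.1 * expCoeff x (p.2 - (m₀ + 1)))) else 0)
              + if p.1 = m₀ then (((m₀ : ℂ) + 1) * c) • expCoeff x p.2 else 0) := by
        intro p hp
        have hp2 : p.2 < n + 1 := by have := mem_antidiagonal.mp hp; omega
        have h1 : y * (x p.1 * expCoeff x p.2) = x p.1 * (y * expCoeff x p.2)
            + if p.1 = m₀ then c • expCoeff x p.2 else 0 := by
          rw [← mul_assoc, hy, add_mul, mul_assoc]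
          split_ifs <;> simp
        rw [mul_smul_comm, h1, ih _ hp2]
        by_cases h2 : p.1 = m₀ <;> by_cases h3 : m₀ + 1 ≤ p.2 <;>
          simp [h2, h3, mul_add, smul_add, smul_smul, mul_assoc, mul_comm c, add_assoc]
      rw [Finset.sum_congr rfl hterm, Finset.sum_add_distrib, Finset.sum_add_distrib]
      congr 1
      have h4 : ∑ p ∈ antidiagonal n,
          (if p.1 = m₀ then (((m₀ : ℂ) + 1) * c) • expCoeff x p.2 else 0)
          = if m₀ ≤ n then (((m₀ : ℂ) + 1) * c) • expCoeff x (n - m₀) else 0 := by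
        rw [Finset.Nat.sum_antidiagonal_eq_sum_range_succ_mk, Finset.sum_ite_eq']
        simp
      rw [h4]
      by_cases h5 : m₀ ≤ n
      · rw [if_pos h5, if_pos (by omega), Nat.add_sub_add_right]
        have h6 : ∑ p ∈ antidiagonal n, (if m₀ + 1 ≤ p.2 then
            c • (((p.1 : ℂ) + 1) • (x p.1 * expCoeff x (p.2 - (m₀ + 1)))) else 0)
            = c • (((n - m₀ : ℕ) : ℂ) • expCoeff x (n - m₀)) := by
          rcases Nat.eq_or_lt_of_le h5 with h7 | h7
          · subst h7
            rw [Nat.sub_self, Nat.cast_zero, zero_smul, smul_zero]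
            refine Finset.sum_eq_zero fun p hp => if_neg ?_
            have := mem_antidiagonal.mp hp
            omega
          · obtain ⟨r, rfl⟩ := Nat.exists_eq_add_of_lt h7
            have h8 : m₀ + r + 1 - m₀ = r + 1 := by omega
            rw [h8]
            push_cast
            rw [hr, Finset.smul_sum, ← Finset.sum_filter]
            symm
            refine Finset.sum_bij' (fun p _ => (p.1, p.2 + (m₀ + 1)))
              (fun p _ => (p.1, p.2 - (m₀ + 1))) ?_ ?_ ?_ ?_ ?_
            · intro p hp
              have := mem_antidiagonal.mp hp
              simp only [Finset.mem_filter, mem_antidiagonal]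
              omega
            · intro p hp
              simp only [Finset.mem_filter, mem_antidiagonal] at hp ⊢
              omega
            · intro p hp
              simp
            · intro p hp
              simp only [Finset.mem_filter, mem_antidiagonal] at hp
              ext <;> simp
              omega
            · intro p hp
              simp
        -- Commuting `y` past the shorter exponentials contributes the weight `n - m₀`, and
        -- commuting it past `x m₀` itself contributes `m₀ + 1`. Together these are the factor `n +
        -- 1` introduced above.
        rw [h6, smul_smul, smul_smul, ← add_smul]
        congr 1
        rw [Nat.cast_sub h5]
        ring
      · rw [if_neg h5, if_neg (by omega), smul_zero, add_zero]
        refine Finset.sum_eq_zero fun p hp => if_neg ?_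
        have := mem_antidiagonal.mp hp
        omega

end Exp

/-! ## The infinite products as exponentials -/

section Poch

/-- As `a` has constant term 1, comparing coefficients shows that `1 - t^(n+1)` times the
coefficient of order `n + 1` depends only on lower coefficients. This factor is nonzero. -/
theorem eq_of_functional_equation {t : ℂ} (ht : ∀ n : ℕ, t ^ (n + 1) ≠ 1) {f g : PowerSeries ℂ}
    {a : PowerSeries ℂ} (ha : PowerSeries.constantCoeff a = 1)
    (hf : f = a * PowerSeries.rescale t f) (hg : g = a * PowerSeries.rescale t g)
    (h0 : PowerSeries.constantCoeff f = PowerSeries.constantCoeff g) : f = g := by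
  ext n
  induction n using Nat.strong_induction_on with
  | _ n ih =>
    cases n with
    | zero => simpa using h0
    | succ n =>
      have h1 := congrArg (PowerSeries.coeff (n + 1)) hf
      have h2 := congrArg (PowerSeries.coeff (n + 1)) hg
      rw [PowerSeries.coeff_mul, Finset.Nat.sum_antidiagonal_succ] at h1 h2
      have h3 : ∑ p ∈ antidiagonal n, PowerSeries.coeff (p.1 + 1) a
            * PowerSeries.coeff p.2 (PowerSeries.rescale t f)
          = ∑ p ∈ antidiagonal n, PowerSeries.coeff (p.1 + 1) a
            * PowerSeries.coeff p.2 (PowerSeries.rescale t g) := by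
        refine Finset.sum_congr rfl fun p hp => ?_
        rw [PowerSeries.coeff_rescale, PowerSeries.coeff_rescale,
          ih p.2 (by have := mem_antidiagonal.mp hp; omega)]
      rw [h3] at h1
      simp only [PowerSeries.coeff_zero_eq_constantCoeff, ha, one_mul,
        PowerSeries.coeff_rescale] at h1 h2
      have h4 : (1 - t ^ (n + 1)) * PowerSeries.coeff (n + 1) f
          = (1 - t ^ (n + 1)) * PowerSeries.coeff (n + 1) g := by
        linear_combination h1 - h2
      exact mul_left_cancel₀ (sub_ne_zero.mpr (ht n).symm) h4

theorem rescale_expS (c : ℂ) (x : ℕ → ℂ) :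
    PowerSeries.rescale c (expS x) = expS fun m => c ^ (m + 1) * x m := by
  ext n
  rw [PowerSeries.coeff_rescale, expS, expS, PowerSeries.coeff_mk, PowerSeries.coeff_mk]
  exact (expCoeff_smul c x n).symm

/-- Both sides have constant term 1, and the logarithmic derivative of each is `-1/(1 - X)`. -/
theorem expS_log : expS (fun m : ℕ => -(1 / ((m : ℂ) + 1))) = 1 - PowerSeries.X := by
  refine eq_of_derivative_eq_mul (derivative_expS _) ?_ (by simp)
  have h : PowerSeries.derivative ℂ
      (PowerSeries.X * PowerSeries.mk fun m : ℕ => -(1 / ((m : ℂ) + 1)))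
      = -(PowerSeries.mk fun _ => 1) := by
    ext n
    rw [PowerSeries.coeff_derivative, PowerSeries.coeff_succ_X_mul, PowerSeries.coeff_mk, map_neg,
      PowerSeries.coeff_mk]
    field_simp [Nat.cast_add_one_ne_zero n]
  have h1 : (PowerSeries.mk fun _ => (1 : ℂ)) * (1 - PowerSeries.X) = 1 :=
    PowerSeries.mk_one_mul_one_sub_eq_one ℂ
  rw [h, neg_mul, h1, map_sub, Derivation.map_one_eq_zero, PowerSeries.derivative_X, zero_sub]

/-- The exponential satisfies the functional equation of `poch t`: passing from `X` to `t X` changes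
the exponent by the logarithm of `1 - X`. -/
theorem poch_eq_expS {t : ℂ} (ht : ∀ n : ℕ, t ^ (n + 1) ≠ 1) :
    poch t = expS fun m => -(1 / (((m : ℂ) + 1) * (1 - t ^ (m + 1)))) := by
  refine eq_of_functional_equation ht (a := 1 - PowerSeries.X) (by simp) (poch_eq t ht) ?_ ?_
  · rw [rescale_expS, ← expS_log, ← expS_add]
    congr 1
    funext m
    have h1 := sub_ne_zero.mpr (ht m).symm
    have h2 : (m : ℂ) + 1 ≠ 0 := Nat.cast_add_one_ne_zero m
    field_simp
    ring
  · rw [constantCoeff_expS, ← PowerSeries.coeff_zero_eq_constantCoeff_apply, constantCoeff_poch]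

theorem rescale_poch {t : ℂ} (ht : ∀ n : ℕ, t ^ (n + 1) ≠ 1) (c : ℂ) :
    PowerSeries.rescale c (poch t)
      = expS fun m => -(c ^ (m + 1) / (((m : ℂ) + 1) * (1 - t ^ (m + 1)))) := by
  rw [poch_eq_expS ht, rescale_expS]
  congr 1
  funext m
  ring

/-- In this form the infinite products can be compared with the scalars produced by the Heisenberg
commutators, whose denominators `[kn]` contain `1 - q^{2kn}` up to a power of `q^k`. -/
theorem ratio_eq_expS {t : ℂ} (ht : ∀ n : ℕ, t ^ (n + 1) ≠ 1) (α β : ℂ) :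
    ratio t α β = expS fun m => (β ^ (m + 1) - α ^ (m + 1)) / (((m : ℂ) + 1) * (1 - t ^ (m + 1))) := by
  rw [ratio, eq_comm, PowerSeries.eq_mul_inv_iff_mul_eq (by rw [rescale_poch ht]; simp),
    rescale_poch ht, rescale_poch ht, ← expS_add]
  congr 1
  funext m
  ring

/-- The linear factor cancels the first factor of the denominator product, whose parameter moves
from `β` to `t β`. -/
theorem one_sub_mul_ratio_right {t : ℂ} (ht : ∀ n : ℕ, t ^ (n + 1) ≠ 1) (α β : ℂ) :
    (1 - PowerSeries.C β * PowerSeries.X) * ratio t α β = ratio t α (t * β) := by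
  have h : (1 - PowerSeries.C β * PowerSeries.X)
      = expS fun m => -(β ^ (m + 1) / ((m : ℂ) + 1)) := by
    have := congrArg (PowerSeries.rescale β) expS_log
    rw [rescale_expS, map_sub, map_one, PowerSeries.rescale_X] at this
    rw [← this]
    congr 1
    funext m
    ring
  rw [ratio_eq_expS ht, ratio_eq_expS ht, h, ← expS_add]
  congr 1
  funext m
  have h1 := sub_ne_zero.mpr (ht m).symm
  have h2 : (m : ℂ) + 1 ≠ 0 := Nat.cast_add_one_ne_zero m
  field_simp
  ring

/-- The linear factor completes the numerator product, whose parameter moves from `t α` back to `α`.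
-/
theorem one_sub_mul_ratio_left {t : ℂ} (ht : ∀ n : ℕ, t ^ (n + 1) ≠ 1) (α β : ℂ) :
    (1 - PowerSeries.C α * PowerSeries.X) * ratio t (t * α) β = ratio t α β := by
  have h : (1 - PowerSeries.C α * PowerSeries.X)
      = expS fun m => -(α ^ (m + 1) / ((m : ℂ) + 1)) := by
    have := congrArg (PowerSeries.rescale α) expS_log
    rw [rescale_expS, map_sub, map_one, PowerSeries.rescale_X] at this
    rw [← this]
    congr 1
    funext m
    ring
  rw [ratio_eq_expS ht, ratio_eq_expS ht, h, ← expS_add]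
  congr 1
  funext m
  have h1 := sub_ne_zero.mpr (ht m).symm
  have h2 : (m : ℂ) + 1 ≠ 0 := Nat.cast_add_one_ne_zero m
  field_simp
  ring

end Poch

end

noncomputable section

/-! ## Graded operators -/

section Graded

variable {V ι : Type*} [AddCommGroup V] [Module ℂ V] {q : ℂ} {T : Module.End ℂ V}

/-- The operator `A` has degree `n` for the grading by `T = q^d`. -/
def IsDeg (q : ℂ) (T : Module.End ℂ V) (n : ℤ) (A : Module.End ℂ V) : Prop :=
  T * A = q ^ n • (A * T)

/-- Every vector is annihilated by all operators of sufficiently large degree. -/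
def IsBdd (q : ℂ) (T : Module.End ℂ V) : Prop :=
  ∀ v, ∃ N : ℤ, ∀ n, N < n → ∀ A, IsDeg q T n A → A v = 0

theorem IsDeg.mul (hq : q ≠ 0) {n m : ℤ} {A B : Module.End ℂ V} (hA : IsDeg q T n A)
    (hB : IsDeg q T m B) : IsDeg q T (n + m) (A * B) := by
  unfold IsDeg at *
  rw [← mul_assoc, hA, smul_mul_assoc, mul_assoc, hB, mul_smul_comm, smul_smul, zpow_add₀ hq,
    mul_assoc]

theorem IsDeg.one : IsDeg q T 0 1 := by simp [IsDeg]

theorem IsDeg.congr {n m : ℤ} {A : Module.End ℂ V} (hA : IsDeg q T n A) (h : n = m) :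
    IsDeg q T m A := h ▸ hA

theorem IsDeg.zero {n : ℤ} : IsDeg q T n 0 := by simp [IsDeg]

theorem IsDeg.smul {n : ℤ} {A : Module.End ℂ V} (hA : IsDeg q T n A) (c : ℂ) :
    IsDeg q T n (c • A) := by
  unfold IsDeg at *
  rw [mul_smul_comm, hA, smul_mul_assoc, smul_comm]

theorem IsDeg.add {n : ℤ} {A B : Module.End ℂ V} (hA : IsDeg q T n A) (hB : IsDeg q T n B) :
    IsDeg q T n (A + B) := by
  unfold IsDeg at *
  rw [mul_add, hA, hB, add_mul, smul_add]

theorem IsDeg.neg {n : ℤ} {A : Module.End ℂ V} (hA : IsDeg q T n A) : IsDeg q T n (-A) := by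
  simpa using hA.smul (-1)

theorem IsDeg.sub {n : ℤ} {A B : Module.End ℂ V} (hA : IsDeg q T n A) (hB : IsDeg q T n B) :
    IsDeg q T n (A - B) := by
  simpa [sub_eq_add_neg] using hA.add hB.neg

theorem IsDeg.sum {n : ℤ} {α : Type*} (s : Finset α) {A : α → Module.End ℂ V}
    (hA : ∀ a ∈ s, IsDeg q T n (A a)) : IsDeg q T n (∑ a ∈ s, A a) := by
  unfold IsDeg at *
  rw [Finset.mul_sum, Finset.sum_mul, Finset.smul_sum]
  exact Finset.sum_congr rfl hA

/-- Both sides of the degree condition are sums of the same locally finite family. -/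
theorem IsDeg.hasLSum {n : ℤ} {A : ι → Module.End ℂ V} {S : Module.End ℂ V} (h : HasLSum A S)
    (hA : ∀ i, IsDeg q T n (A i)) : IsDeg q T n S :=
  (h.mul_left T).unique (((h.mul_right T).smul (q ^ n)).congr hA rfl)

/-- An operator of degree `n` maps the eigenspace for `c` into the one for `c q^n`, which vanishes
for large `n`. Every vector is a finite sum of eigenvectors, so the largest of the bounds works. -/
theorem isBdd_of_isRestricted (h : IsRestricted q T) : IsBdd q T := fun v => by
  have hv : v ∈ ⨆ c : ℂ, Module.End.eigenspace T c := h.1 ▸ Submodule.mem_top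
  induction hv using Submodule.iSup_induction' with
  | mem c v hv =>
    obtain ⟨n₀, hn⟩ := h.2 c
    refine ⟨n₀, fun n hn' A hA => ?_⟩
    obtain ⟨n, rfl⟩ := Int.eq_ofNat_of_zero_le (by omega : 0 ≤ n)
    have : A v ∈ Module.End.eigenspace T (c * q ^ n) := by
      rw [Module.End.mem_eigenspace_iff] at hv ⊢
      have h1 := LinearMap.congr_fun hA v
      simp only [Module.End.mul_apply, LinearMap.smul_apply, hv, map_smul] at h1
      rw [h1, smul_smul, mul_comm]
      simp
    rwa [hn n (by omega), Submodule.mem_bot] at this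
  | zero => exact ⟨0, fun n _ A _ => map_zero A⟩
  | add v w _ _ hv hw =>
    obtain ⟨N, hN⟩ := hv
    obtain ⟨N', hN'⟩ := hw
    refine ⟨max N N', fun n hn A hA => ?_⟩
    rw [map_add, hN n (lt_of_le_of_lt (le_max_left _ _) hn) A hA,
      hN' n (lt_of_le_of_lt (le_max_right _ _) hn) A hA, add_zero]

/-- The main source of local finiteness: if only finitely many indices have degree below any given
bound, all the others annihilate a given vector. -/
theorem locFin_of_isDeg (hT : IsBdd q T) {A : ι → Module.End ℂ V} (d : ι → ℤ)
    (hA : ∀ i, IsDeg q T (d i) (A i)) (hd : ∀ N, {i | d i ≤ N}.Finite) : LocFin A := fun v => by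
  obtain ⟨N, hN⟩ := hT v
  refine ⟨(hd N).toFinset, fun i hi => hN (d i) ?_ _ (hA i)⟩
  simpa using hi

variable {σ : Type*} [Fintype σ]

theorem finite_sum_le (d N : ℤ) : {p : σ → ℕ | d + ∑ i, (p i : ℤ) ≤ N}.Finite := by
  refine (Set.Finite.pi' (t := fun _ : σ => Set.Iic (N - d).toNat)
    fun _ => Set.finite_Iic _).subset fun p hp i => ?_
  have h1 : (p i : ℤ) ≤ ∑ i, (p i : ℤ) :=
    Finset.single_le_sum (f := fun i => (p i : ℤ)) (fun _ _ => by positivity) (Finset.mem_univ i)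
  simp only [Set.mem_ofPred_eq, Set.mem_Iic] at hp ⊢
  omega

theorem finite_sum_le_prod (d N : ℤ) :
    {p : (σ → ℕ) × (σ → ℕ) | d + ∑ i, (p.1 i : ℤ) + ∑ i, (p.2 i : ℤ) ≤ N}.Finite := by
  refine ((finite_sum_le (σ := σ) d N).prod (finite_sum_le (σ := σ) d N)).subset fun p hp => ?_
  have h1 : 0 ≤ ∑ i, (p.1 i : ℤ) := Finset.sum_nonneg fun _ _ => by positivity
  have h2 : 0 ≤ ∑ i, (p.2 i : ℤ) := Finset.sum_nonneg fun _ _ => by positivity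
  simp only [Set.mem_ofPred_eq, Set.mem_prod] at hp ⊢
  omega

end Graded

/-! ## Dressing -/

section Dress

variable {V σ : Type*} [AddCommGroup V] [Module ℂ V] {q : ℂ} {T : Module.End ℂ V} [Fintype σ]

/-- The coefficient of `∏ x_i^{-m_i}` in `e(x) G(x) f(x)` for `e(x) = ∑ e_p x^p`,
`f(x) = ∑ f_p x^{-p}`, `G(x) = ∑ G_m x^{-m}`. -/
def dress (e f : (σ → ℕ) → Module.End ℂ V) (G : (σ → ℤ) → Module.End ℂ V) (m : σ → ℤ) :
    Module.End ℂ V :=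
  lsum fun x : (σ → ℕ) × (σ → ℕ) => e x.1 * G (fun i => m i + x.1 i - x.2 i) * f x.2

/-- The coefficient `G_m` has degree `∑ m_i`. -/
def IsGraded (q : ℂ) (T : Module.End ℂ V) (G : (σ → ℤ) → Module.End ℂ V) : Prop :=
  ∀ m, IsDeg q T (∑ i, m i) (G m)

/-- The coefficient `f_p` has degree `∑ p_i`. -/
def IsRaising (q : ℂ) (T : Module.End ℂ V) (f : (σ → ℕ) → Module.End ℂ V) : Prop :=
  ∀ p, IsDeg q T (∑ i, (p i : ℤ)) (f p)

/-- The coefficient `e_p` has degree `-∑ p_i`. -/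
def IsLowering (q : ℂ) (T : Module.End ℂ V) (e : (σ → ℕ) → Module.End ℂ V) : Prop :=
  ∀ p, IsDeg q T (-∑ i, (p i : ℤ)) (e p)

variable {e f e' f' : (σ → ℕ) → Module.End ℂ V} {G : (σ → ℤ) → Module.End ℂ V}

theorem IsRaising.locFin (hT : IsBdd q T) (hf : IsRaising q T f) : LocFin f :=
  locFin_of_isDeg hT _ hf fun N => by simpa using finite_sum_le (σ := σ) 0 N

/-- Only finitely many raising operators are nonzero on a vector. Once one of them is fixed, the
degree of `G` grows with the lowering index, so only finitely many of those indices survive; the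
operators `e` play no role in this. -/
theorem locFin_dress (hT : IsBdd q T) (hG : IsGraded q T G) (hf : IsRaising q T f) (m : σ → ℤ) :
    LocFin fun x : (σ → ℕ) × (σ → ℕ) => e x.1 * G (fun i => m i + x.1 i - x.2 i) * f x.2 := by
  have h1 (p' : σ → ℕ) : LocFin fun p : σ → ℕ => G fun i => m i + p i - p' i :=
    locFin_of_isDeg hT (fun p => (∑ i, m i - ∑ i, (p' i : ℤ)) + ∑ i, (p i : ℤ))
      (fun p => (hG _).congr (by
        rw [Finset.sum_sub_distrib, Finset.sum_add_distrib]
        ring)) (finite_sum_le _)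
  have h2 : LocFin fun x : (σ → ℕ) × (σ → ℕ) =>
      e x.2 * G (fun i => m i + x.2 i - x.1 i) * f x.1 :=
    (hf.locFin hT).bind (A := fun p' p => e p * G (fun i => m i + p i - p' i)) fun p' =>
      (h1 p').mul_left e
  exact h2.equiv (Equiv.prodComm _ _)

theorem hasLSum_dress (hT : IsBdd q T) (hG : IsGraded q T G) (hf : IsRaising q T f) (m : σ → ℤ) :
    HasLSum (fun x : (σ → ℕ) × (σ → ℕ) => e x.1 * G (fun i => m i + x.1 i - x.2 i) * f x.2)
      (dress e f G m) := (locFin_dress hT hG hf m).hasLSum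

theorem isGraded_dress (hq : q ≠ 0) (hT : IsBdd q T) (he : IsLowering q T e) (hG : IsGraded q T G)
    (hf : IsRaising q T f) : IsGraded q T (dress e f G) := fun m =>
  IsDeg.hasLSum (hasLSum_dress hT hG hf m) fun x =>
    (((he x.1).mul hq (hG _)).mul hq (hf x.2)).congr (by
      rw [Finset.sum_sub_distrib, Finset.sum_add_distrib]
      ring)

-- The twofold dressing is one fourfold sum. Grouped by the total lowering and raising indices, it
-- contains the convolutions of `e'` with `e` on the left of `G` and of `f` with `f'` on the right,
-- and both are the unit.
open scoped Classical in
theorem dress_dress (hq : q ≠ 0) (hT : IsBdd q T) (he : IsLowering q T e) (hf : IsRaising q T f)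
    (hf' : IsRaising q T f') (hG : IsGraded q T G)
    (hee : ∀ u : σ → ℕ, ∑ y ∈ Fintype.piFinset fun i => antidiagonal (u i),
      e' (fun i => (y i).1) * e (fun i => (y i).2) = if u = 0 then 1 else 0)
    (hff : ∀ u : σ → ℕ, ∑ y ∈ Fintype.piFinset fun i => antidiagonal (u i),
      f (fun i => (y i).1) * f' (fun i => (y i).2) = if u = 0 then 1 else 0) :
    dress e' f' (dress e f G) = G := by
  funext m
  let A : ((σ → ℕ) × (σ → ℕ)) × ((σ → ℕ) × (σ → ℕ)) → Module.End ℂ V := fun x =>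
    e' x.1.1 * (e x.2.1 * G (fun i => m i + x.1.1 i - x.1.2 i + x.2.1 i - x.2.2 i) * f x.2.2)
      * f' x.1.2
  have hA : LocFin A := by
    have h0 (k : (σ → ℕ) × (σ → ℕ)) : LocFin fun x : (σ → ℕ) × (σ → ℕ) =>
        G fun i => m i + x.1 i - k.2 i + x.2 i - k.1 i :=
      locFin_of_isDeg hT
        (fun x => (∑ i, m i - ∑ i, (k.1 i : ℤ) - ∑ i, (k.2 i : ℤ)) + ∑ i, (x.1 i : ℤ)
          + ∑ i, (x.2 i : ℤ))
        (fun x => (hG _).congr (by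
          simp only [Finset.sum_sub_distrib, Finset.sum_add_distrib]
          ring)) (finite_sum_le_prod _)
    have h1 : LocFin fun x : (σ → ℕ) × (σ → ℕ) => f x.1 * f' x.2 :=
      ((hf.locFin hT).hasLSum.mul (hf'.locFin hT).hasLSum).locFin
    have h2 : LocFin fun x : ((σ → ℕ) × (σ → ℕ)) × ((σ → ℕ) × (σ → ℕ)) =>
        (e' x.2.1 * e x.2.2) * G (fun i => m i + x.2.1 i - x.1.2 i + x.2.2 i - x.1.1 i)
          * (f x.1.1 * f' x.1.2) :=
      h1.bind (A := fun (k x : (σ → ℕ) × (σ → ℕ)) => (e' x.1 * e x.2) *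
        G (fun i => m i + x.1 i - k.2 i + x.2 i - k.1 i)) fun k =>
        (h0 k).mul_left fun x => e' x.1 * e x.2
    -- Puts the indices of the rightmost operators `f`, `f'` first, as required by `LocFin.bind`.
    let E : ((σ → ℕ) × (σ → ℕ)) × ((σ → ℕ) × (σ → ℕ)) ≃
        ((σ → ℕ) × (σ → ℕ)) × ((σ → ℕ) × (σ → ℕ)) :=
      { toFun := fun x => ((x.2.2, x.1.2), (x.1.1, x.2.1))
        invFun := fun x => ((x.2.1, x.1.2), (x.2.2, x.1.1))
        left_inv := fun _ => rfl
        right_inv := fun _ => rfl }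
    have h3 := h2.equiv E
    have h4 : A = fun k => (e' (E k).2.1 * e (E k).2.2)
        * G (fun i => m i + (E k).2.1 i - (E k).1.2 i + (E k).2.2 i - (E k).1.1 i)
        * (f (E k).1.1 * f' (E k).1.2) := by
      funext k
      simp only [A, E, mul_assoc, Equiv.coe_fn_mk]
    rw [h4]
    exact h3
  have h1 : HasLSum (fun x : (σ → ℕ) × (σ → ℕ) =>
      e' x.1 * dress e f G (fun i => m i + x.1 i - x.2 i) * f' x.2) (lsum A) :=
    hA.hasLSum.prod fun x => ((hasLSum_dress (e := e) hT hG hf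
      fun i => m i + x.1 i - x.2 i).mul_left (e' x.1)).mul_right (f' x.2)
  have h2 := hasLSum_dress (e := e') hT (isGraded_dress hq hT he hG hf) hf' m
  rw [h2.unique h1]
  -- A fibre consists of all splittings of a total lowering index and of a total raising index, that
  -- is, of a product of antidiagonals over the variables. The mode of `G` is constant on it.
  have h3 := hA.hasLSum.fiber_param (κ := (σ → ℕ) × (σ → ℕ)) (α := (σ → ℕ × ℕ) × (σ → ℕ × ℕ))
    (fun x => (fun i => x.1.1 i + x.2.1 i, fun i => x.2.2 i + x.1.2 i))
    (fun k => (Fintype.piFinset fun i => antidiagonal (k.1 i)) ×ˢ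
      (Fintype.piFinset fun i => antidiagonal (k.2 i)))
    (fun _ y => ((fun i => (y.1 i).1, fun i => (y.2 i).2), (fun i => (y.1 i).2, fun i => (y.2 i).1)))
    (fun k y _ y' _ h => by
      simp only [Prod.mk.injEq, funext_iff] at h
      ext i
      · exact h.1.1 i
      · exact h.2.1 i
      · exact h.2.2 i
      · exact h.1.2 i)
    (fun k y hy => by
      simp only [Finset.mem_product, Fintype.mem_piFinset, mem_antidiagonal] at hy
      ext i
      · exact hy.1 i
      · exact hy.2 i)
    (fun x => ⟨(fun i => (x.1.1 i, x.2.1 i), fun i => (x.2.2 i, x.1.2 i)), by simp, rfl⟩)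
  refine h3.unique ((HasLSum.single (0 : (σ → ℕ) × (σ → ℕ)) (G m)).congr (fun k => ?_) rfl)
  have h4 : ∀ y ∈ (Fintype.piFinset fun i => antidiagonal (k.1 i)) ×ˢ
      (Fintype.piFinset fun i => antidiagonal (k.2 i)),
      A ((fun i => (y.1 i).1, fun i => (y.2 i).2), (fun i => (y.1 i).2, fun i => (y.2 i).1))
      = e' (fun i => (y.1 i).1) * e (fun i => (y.1 i).2) * G (fun i => m i + k.1 i - k.2 i)
        * (f (fun i => (y.2 i).1) * f' (fun i => (y.2 i).2)) := by
    intro y hy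
    simp only [Finset.mem_product, Fintype.mem_piFinset, mem_antidiagonal] at hy
    have : (fun i => m i + ((y.1 i).1 : ℤ) - ((y.2 i).2 : ℤ) + ((y.1 i).2 : ℤ) - ((y.2 i).1 : ℤ))
        = fun i => m i + k.1 i - k.2 i := by
      funext i
      rw [← hy.1 i, ← hy.2 i]
      push_cast
      ring
    simp only [A, this, mul_assoc]
  rw [Finset.sum_congr rfl h4, Finset.sum_product]
  simp_rw [← Finset.mul_sum]
  rw [hff]
  simp_rw [← Finset.sum_mul]
  rw [hee]
  by_cases h5 : k.1 = 0 <;> by_cases h6 : k.2 = 0 <;> simp [h5, h6, Prod.ext_iff]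

theorem dress_sum (hT : IsBdd q T) (hf : IsRaising q T f) {α : Type*} (s : Finset α) (c : α → ℂ)
    (G : α → (σ → ℤ) → Module.End ℂ V) (hG : ∀ a, IsGraded q T (G a)) (m : σ → ℤ) :
    dress e f (fun m => ∑ a ∈ s, c a • G a m) m = ∑ a ∈ s, c a • dress e f (G a) m :=
  ((HasLSum.sum s fun a _ => (hasLSum_dress (e := e) hT (hG a) hf m).smul (c a)).congr
    (fun x => by simp [Finset.mul_sum, Finset.sum_mul]) rfl).lsum_eq

theorem dress_smul (hT : IsBdd q T) (hf : IsRaising q T f) (c : ℂ) (hG : IsGraded q T G)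
    (m : σ → ℤ) : dress e f (fun m => c • G m) m = c • dress e f G m := by
  simpa using dress_sum (e := e) hT hf {()} (fun _ => c) (fun _ => G) (fun _ => hG) m

/-- Lowering operators commute among themselves, and so do raising ones, so that a dressing does not
see the order of the variables. This allows monomials with permuted factors to be compared. -/
theorem dress_reindex {σ' : Type*} [Fintype σ'] (hT : IsBdd q T) (τ : σ' ≃ σ)
    (hf : IsRaising q T f) {e' f' : (σ' → ℕ) → Module.End ℂ V} (he' : ∀ p : σ → ℕ, e' (p ∘ τ) = e p)
    (hf' : ∀ p : σ → ℕ, f' (p ∘ τ) = f p) {G' : (σ' → ℤ) → Module.End ℂ V}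
    (hG' : IsGraded q T G') (m : σ → ℤ) :
    dress e' f' G' (m ∘ τ) = dress e f (fun m => G' (m ∘ τ)) m := by
  have hG : IsGraded q T fun m : σ → ℤ => G' (m ∘ τ) := fun m =>
    (hG' _).congr (Equiv.sum_comp τ m)
  have h := (hasLSum_dress (e := e) hT hG hf m).equiv
    ((Equiv.arrowCongr τ (Equiv.refl ℕ)).prodCongr (Equiv.arrowCongr τ (Equiv.refl ℕ)))
  refine (h.congr (fun x => ?_) rfl).lsum_eq
  simp only [← he', ← hf']
  congr <;> funext i <;> simp [Equiv.arrowCongr]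

end Dress

end

noncomputable section

/-! ## Words in currents -/

section Words

variable {V J : Type*} [AddCommGroup V] [Module ℂ V] {q : ℂ} {T : Module.End ℂ V}

/-- The coefficient of `∏ x_p^{-m_p}` in
`(∏_{p < p'} F_{c_p, c_{p'}}(x_{p'} / x_p)) Z_{c_0}(x_0) Z_{c_1}(x_1) ⋯`, computed from the right to
the left. -/
def word (F : J → J → PowerSeries ℂ) (Z : J → ℤ → Module.End ℂ V) :
    (L : ℕ) → (Fin L → J) → (Fin L → ℤ) → Module.End ℂ V
  | 0, _, _ => 1
  | L + 1, c, m => lsum fun e : Fin L → ℕ =>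
      (∏ i, PowerSeries.coeff (e i) (F (c 0) (c i.succ))) •
        (Z (c 0) (m 0 - ∑ i, (e i : ℤ)) *
          word F Z L (fun i => c i.succ) fun i => m i.succ + e i)

variable {F : J → J → PowerSeries ℂ} {Z : J → ℤ → Module.End ℂ V}

/-- The two statements need each other in the induction: local finiteness of the tail makes the sum
defining the longer word meaningful, so that its degree can be read off, and the degree then gives
local finiteness. -/
theorem isGraded_word_and_locFin (hq : q ≠ 0) (hT : IsBdd q T) (hZ : ∀ c n, IsDeg q T n (Z c n))
    (L : ℕ) (c : Fin L → J) : IsGraded q T (word F Z L c) ∧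
      ∀ m : Fin L → ℤ, LocFin fun e : Fin L → ℕ => word F Z L c fun i => m i + e i := by
  induction L with
  | zero => exact ⟨fun m => by simpa [word] using IsDeg.one, fun m v =>
      ⟨Finset.univ, fun i hi => absurd (Finset.mem_univ i) hi⟩⟩
  | succ L ih =>
    have h1 : IsGraded q T (word F Z (L + 1) c) := fun m => by
      have h2 : LocFin fun e : Fin L → ℕ =>
          (∏ i, PowerSeries.coeff (e i) (F (c 0) (c i.succ))) •
          (Z (c 0) (m 0 - ∑ i, (e i : ℤ)) *
            word F Z L (fun i => c i.succ) fun i => m i.succ + e i) := by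
        simp_rw [← smul_mul_assoc]
        exact ((ih fun i => c i.succ).2 fun i : Fin L => m i.succ).mul_left _
      refine IsDeg.hasLSum h2.hasLSum fun e => IsDeg.smul ?_ _
      refine ((hZ _ _).mul hq ((ih fun i => c i.succ).1 _)).congr ?_
      rw [Fin.sum_univ_succ, Finset.sum_add_distrib]
      ring
    refine ⟨h1, fun m => ?_⟩
    exact locFin_of_isDeg hT (fun e => ∑ i, m i + ∑ i, (e i : ℤ)) (fun e => (h1 _).congr
      Finset.sum_add_distrib) (finite_sum_le _)

theorem isGraded_word (hq : q ≠ 0) (hT : IsBdd q T) (hZ : ∀ c n, IsDeg q T n (Z c n))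
    {L : ℕ} (c : Fin L → J) : IsGraded q T (word F Z L c) :=
  (isGraded_word_and_locFin hq hT hZ L c).1

theorem locFin_word (hq : q ≠ 0) (hT : IsBdd q T) (hZ : ∀ c n, IsDeg q T n (Z c n))
    {L : ℕ} (c : Fin L → J) (m : Fin L → ℤ) :
    LocFin fun e : Fin L → ℕ => word F Z L c fun i => m i + e i :=
  (isGraded_word_and_locFin hq hT hZ L c).2 m

theorem hasLSum_word (hq : q ≠ 0) (hT : IsBdd q T) (hZ : ∀ c n, IsDeg q T n (Z c n))
    {L : ℕ} (c : Fin (L + 1) → J) (m : Fin (L + 1) → ℤ) :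
    HasLSum (fun e : Fin L → ℕ => (∏ i, PowerSeries.coeff (e i) (F (c 0) (c i.succ))) •
      (Z (c 0) (m 0 - ∑ i, (e i : ℤ)) * word F Z L (fun i => c i.succ) fun i => m i.succ + e i))
      (word F Z (L + 1) c m) := by
  refine LocFin.hasLSum ?_
  simp_rw [← smul_mul_assoc]
  exact (locFin_word hq hT hZ (fun i => c i.succ) fun i => m i.succ).mul_left _

theorem commute_word (hq : q ≠ 0) (hT : IsBdd q T) (hZ : ∀ c n, IsDeg q T n (Z c n))
    {A : Module.End ℂ V} (hA : ∀ c n, A * Z c n = Z c n * A) {L : ℕ} (c : Fin L → J)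
    (m : Fin L → ℤ) : A * word F Z L c m = word F Z L c m * A := by
  induction L with
  | zero => simp [word]
  | succ L ih =>
    have h := hasLSum_word (F := F) hq hT hZ c m
    refine (h.mul_left A).unique ((h.mul_right A).congr (fun e => ?_) rfl)
    rw [mul_smul_comm, smul_mul_assoc, ← mul_assoc, hA, mul_assoc, ih, mul_assoc]

/-- The pairs `p < p'` in `{0, …, L}`: those with `p = 0` and the others. -/
def pairsEquiv (L : ℕ) : Fin L ⊕ {x : Fin L × Fin L // x.1 < x.2} ≃
    {x : Fin (L + 1) × Fin (L + 1) // x.1 < x.2} :=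
  Equiv.ofBijective (Sum.elim (fun i => ⟨(0, i.succ), Fin.succ_pos i⟩)
    fun x => ⟨(x.1.1.succ, x.1.2.succ), Fin.succ_lt_succ_iff.mpr x.2⟩) (by
  constructor
  · rintro (i | ⟨⟨i, j⟩, h⟩) (i' | ⟨⟨i', j'⟩, h'⟩) he
    · simpa using he
    · simp [Fin.ext_iff] at he
    · simp [Fin.ext_iff] at he
    · simpa using he
  · rintro ⟨⟨i, j⟩, h⟩
    obtain ⟨j, rfl⟩ := Fin.exists_succ_eq.mpr (show j ≠ 0 by rintro rfl; exact absurd h (by simp))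
    rcases Fin.eq_zero_or_eq_succ i with rfl | ⟨i, rfl⟩
    · exact ⟨Sum.inl j, rfl⟩
    · exact ⟨Sum.inr ⟨(i, j), Fin.succ_lt_succ_iff.mp h⟩, rfl⟩)

/-- By induction on the length: the exponents of the pairs containing the first position form the
outer sum in `word`, the others belong to the tail, and `pairsEquiv` joins the two index sets. -/
theorem hasLSum_nPoint (hq : q ≠ 0) (hT : IsBdd q T) (hZ : ∀ c n, IsDeg q T n (Z c n))
    {L : ℕ} (c : Fin L → J) (m : Fin L → ℤ) :
    HasLSum (fun e : {x : Fin L × Fin L // x.1 < x.2} → ℕ =>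
      (∏ x, PowerSeries.coeff (e x) (F (c x.1.1) (c x.1.2))) •
      (List.ofFn fun p => Z (c p) (m p + (∑ x, if x.1.2 = p then (e x : ℤ) else 0)
        - (∑ x, if x.1.1 = p then (e x : ℤ) else 0))).prod) (word F Z L c m) := by
  induction L with
  | zero => exact fun v => ⟨Finset.univ, fun i hi => absurd (Finset.mem_univ i) hi, by simp [word]⟩
  | succ L ih =>
    let A : (Fin L → ℕ) × ({x : Fin L × Fin L // x.1 < x.2} → ℕ) → Module.End ℂ V := fun y =>
      (∏ i, PowerSeries.coeff (y.1 i) (F (c 0) (c i.succ))) •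
      (Z (c 0) (m 0 - ∑ i, (y.1 i : ℤ)) *
      ((∏ x, PowerSeries.coeff (y.2 x) (F (c x.1.1.succ) (c x.1.2.succ))) •
      (List.ofFn fun p : Fin L => Z (c p.succ) ((m p.succ + y.1 p)
        + (∑ x, if x.1.2 = p then (y.2 x : ℤ) else 0)
        - (∑ x, if x.1.1 = p then (y.2 x : ℤ) else 0))).prod))
    -- Each exponent inside the tail is added to one mode and subtracted from another, so it drops
    -- out of the total degree. The bound on the outer exponents is therefore uniform in the inner
    -- ones.
    have hdeg : ∀ y : (Fin L → ℕ) × ({x : Fin L × Fin L // x.1 < x.2} → ℕ),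
        IsDeg q T (∑ i : Fin L, m i.succ + ∑ i, (y.1 i : ℤ))
        (List.ofFn fun p : Fin L => Z (c p.succ) ((m p.succ + y.1 p)
        + (∑ x, if x.1.2 = p then (y.2 x : ℤ) else 0)
        - (∑ x, if x.1.1 = p then (y.2 x : ℤ) else 0))).prod := by
      intro y
      have h1 : ∀ (K : ℕ) (a : Fin K → J) (n : Fin K → ℤ),
          IsDeg q T (∑ i, n i) (List.ofFn fun p => Z (a p) (n p)).prod := by
        intro K
        induction K with
        | zero => intro a n; simpa using IsDeg.one
        | succ K ih =>
          intro a n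
          rw [List.ofFn_succ, List.prod_cons, Fin.sum_univ_succ]
          exact (hZ _ _).mul hq (ih (fun i => a i.succ) fun i => n i.succ)
      refine (h1 _ (fun p => c p.succ) _).congr ?_
      rw [Finset.sum_sub_distrib, Finset.sum_add_distrib, Finset.sum_add_distrib,
        Finset.sum_comm, Finset.sum_comm (f := fun p x => if x.1.1 = p then (y.2 x : ℤ) else 0)]
      simp
    have hA : LocFin A := by
      refine LocFin.of_fst (fun v => ?_) fun e => ?_
      · obtain ⟨N, hN⟩ := hT v
        refine ⟨(finite_sum_le (σ := Fin L) (∑ i : Fin L, m i.succ) N).toFinset, fun e he x => ?_⟩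
        have := hN _ (by simpa using he) _ (hdeg (e, x))
        simp only [A, LinearMap.smul_apply, Module.End.mul_apply]
        rw [this, smul_zero, map_zero, smul_zero]
      · exact (((ih (fun i => c i.succ) fun i => m i.succ + e i).mul_left
          (Z (c 0) (m 0 - ∑ i, (e i : ℤ)))).smul
          (∏ i, PowerSeries.coeff (e i) (F (c 0) (c i.succ)))).locFin
    have h1 : HasLSum A (word F Z (L + 1) c m) := by
      have := hA.hasLSum.prod fun e =>
        ((ih (fun i => c i.succ) fun i => m i.succ + e i).mul_left
          (Z (c 0) (m 0 - ∑ i, (e i : ℤ)))).smul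
          (∏ i, PowerSeries.coeff (e i) (F (c 0) (c i.succ)))
      rw [(hasLSum_word hq hT hZ c m).unique this]
      exact hA.hasLSum
    have h2 := h1.equiv ((Equiv.arrowCongr (pairsEquiv L).symm (Equiv.refl ℕ)).trans
      (Equiv.sumArrowEquivProdArrow _ _ ℕ))
    refine h2.congr (fun e => ?_) rfl
    have hl (i : Fin L) : pairsEquiv L (Sum.inl i) = ⟨(0, i.succ), Fin.succ_pos i⟩ := rfl
    have hr (x : {x : Fin L × Fin L // x.1 < x.2}) : pairsEquiv L (Sum.inr x)
        = ⟨(x.1.1.succ, x.1.2.succ), Fin.succ_lt_succ_iff.mpr x.2⟩ := rfl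
    simp only [A, ← (pairsEquiv L).sum_comp, ← (pairsEquiv L).prod_comp, Fintype.sum_sum_type,
      Fintype.prod_sum_type, hl, hr, List.ofFn_succ, List.prod_cons, mul_smul_comm, smul_smul]
    simp [Equiv.sumArrowEquivProdArrow, Equiv.arrowCongr, Fin.succ_ne_zero, hl, hr, add_assoc,
      Fin.succ_inj, (Fin.succ_ne_zero _).symm]

theorem nPoint_eq_word (hq : q ≠ 0) (hT : IsBdd q T) (hZ : ∀ c n, IsDeg q T n (Z c n))
    {L : ℕ} (c : Fin L → J) (m : Fin L → ℤ) (v : V) : nPoint F Z v c m = word F Z L c m v :=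
  (hasLSum_nPoint hq hT hZ c m).finsum_eq v

end Words

/-! ## Dressing of words -/

/-- Lowering and raising operators, obtained from elements `em c n`, `ep c n` of a commutative
algebra, with their exchange relations. -/
structure Dressing (V J R : Type*) [AddCommGroup V] [Module ℂ V] [CommRing R] [Algebra ℂ R] where
  q : ℂ
  T : Module.End ℂ V
  lower : R →ₐ[ℂ] Module.End ℂ V
  raise : R →ₐ[ℂ] Module.End ℂ V
  em : J → ℕ → R
  ep : J → ℕ → R
  emInv : J → ℕ → R
  epInv : J → ℕ → R
  F : J → J → PowerSeries ℂ
  q_ne : q ≠ 0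
  bdd : IsBdd q T
  deg_em : ∀ c (n : ℕ), IsDeg q T (-(n : ℤ)) (lower (em c n))
  deg_emInv : ∀ c (n : ℕ), IsDeg q T (-(n : ℤ)) (lower (emInv c n))
  deg_ep : ∀ c (n : ℕ), IsDeg q T n (raise (ep c n))
  deg_epInv : ∀ c (n : ℕ), IsDeg q T n (raise (epInv c n))
  em_inv : ∀ c n, ∑ p ∈ antidiagonal n, em c p.1 * emInv c p.2 = if n = 0 then 1 else 0
  ep_inv : ∀ c n, ∑ p ∈ antidiagonal n, ep c p.1 * epInv c p.2 = if n = 0 then 1 else 0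
  exchange : ∀ {L : ℕ} (c₀ : J) (n : ℕ) (c : Fin L → J) (p : Fin L → ℕ),
    raise (ep c₀ n) * lower (∏ i, em (c i) (p i))
      = ∑ e ∈ Fintype.piFinset (fun i => Finset.range (p i + 1)) with ∑ i, e i ≤ n,
        (∏ i, PowerSeries.coeff (e i) (F c₀ (c i))) •
          (lower (∏ i, em (c i) (p i - e i)) * raise (ep c₀ (n - ∑ i, e i)))

namespace Dressing

variable {V J R σ : Type*} [AddCommGroup V] [Module ℂ V] [CommRing R] [Algebra ℂ R] [Fintype σ]
  (D : Dressing V J R)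

theorem isDeg_prod {φ : R →ₐ[ℂ] Module.End ℂ V} {x : σ → R} {d : σ → ℤ}
    (h : ∀ i, IsDeg D.q D.T (d i) (φ (x i))) : IsDeg D.q D.T (∑ i, d i) (φ (∏ i, x i)) := by
  classical
  refine Finset.induction_on (Finset.univ : Finset σ) ?_ fun a s ha ih => ?_
  · simpa using IsDeg.one
  · rw [Finset.prod_insert ha, Finset.sum_insert ha, map_mul]
    exact (h a).mul D.q_ne ih

/-- The lowering operators of a family of colours. -/
def eM (c : σ → J) (p : σ → ℕ) : Module.End ℂ V := D.lower (∏ i, D.em (c i) (p i))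

/-- The raising operators of a family of colours. -/
def eP (c : σ → J) (p : σ → ℕ) : Module.End ℂ V := D.raise (∏ i, D.ep (c i) (p i))

/-- The inverse lowering operators of a family of colours. -/
def eMInv (c : σ → J) (p : σ → ℕ) : Module.End ℂ V := D.lower (∏ i, D.emInv (c i) (p i))

/-- The inverse raising operators of a family of colours. -/
def ePInv (c : σ → J) (p : σ → ℕ) : Module.End ℂ V := D.raise (∏ i, D.epInv (c i) (p i))

theorem isLowering_eM (c : σ → J) : IsLowering D.q D.T (D.eM c) := fun p =>
  (D.isDeg_prod fun i => D.deg_em (c i) (p i)).congr (by rw [Finset.sum_neg_distrib])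

theorem isLowering_eMInv (c : σ → J) : IsLowering D.q D.T (D.eMInv c) := fun p =>
  (D.isDeg_prod fun i => D.deg_emInv (c i) (p i)).congr (by rw [Finset.sum_neg_distrib])

theorem isRaising_eP (c : σ → J) : IsRaising D.q D.T (D.eP c) := fun p =>
  D.isDeg_prod fun i => D.deg_ep (c i) (p i)

theorem isRaising_ePInv (c : σ → J) : IsRaising D.q D.T (D.ePInv c) := fun p =>
  D.isDeg_prod fun i => D.deg_epInv (c i) (p i)

/-- The dressing of a function of several variables with colours `c`. -/
def dr (c : σ → J) (G : (σ → ℤ) → Module.End ℂ V) : (σ → ℤ) → Module.End ℂ V :=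
  dress (D.eM c) (D.eP c) G

/-- The inverse of the dressing. -/
def undr (c : σ → J) (G : (σ → ℤ) → Module.End ℂ V) : (σ → ℤ) → Module.End ℂ V :=
  dress (D.eMInv c) (D.ePInv c) G

-- The convolution in several variables is a product of convolutions in one variable, because `φ` is
-- multiplicative on a commutative algebra.
open scoped Classical in
theorem sum_piFinset_antidiagonal (φ : R →ₐ[ℂ] Module.End ℂ V) {x y : J → ℕ → R}
    (h : ∀ c n, ∑ p ∈ antidiagonal n, x c p.1 * y c p.2 = if n = 0 then 1 else 0) (c : σ → J)
    (u : σ → ℕ) : ∑ z ∈ Fintype.piFinset fun i => antidiagonal (u i),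
      φ (∏ i, x (c i) (z i).1) * φ (∏ i, y (c i) (z i).2) = if u = 0 then 1 else 0 := by
  simp_rw [← map_mul, ← Finset.prod_mul_distrib]
  rw [← map_sum, ← Finset.prod_univ_sum (fun i => antidiagonal (u i))
    (fun i z => x (c i) z.1 * y (c i) z.2)]
  simp_rw [h]
  rw [Finset.prod_ite_zero]
  simp only [Finset.mem_univ, true_imp_iff, Finset.prod_const_one, funext_iff, Pi.zero_apply]
  split_ifs <;> simp

theorem sum_antidiagonal_swap {J R : Type*} [CommRing R] {x y : J → ℕ → R}
    (h : ∀ c n, ∑ p ∈ antidiagonal n, x c p.1 * y c p.2 = if n = 0 then 1 else 0) (c : J) (n : ℕ) :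
    ∑ p ∈ antidiagonal n, y c p.1 * x c p.2 = if n = 0 then 1 else 0 := by
  rw [← h c n, ← Finset.Nat.sum_antidiagonal_swap]
  exact Finset.sum_congr rfl fun p _ => mul_comm _ _

variable {D}

theorem undr_dr {c : σ → J} {G : (σ → ℤ) → Module.End ℂ V} (hG : IsGraded D.q D.T G) :
    D.undr c (D.dr c G) = G := by
  classical
  refine dress_dress D.q_ne D.bdd (D.isLowering_eM c) (D.isRaising_eP c) (D.isRaising_ePInv c) hG
    (fun u => ?_) fun u => ?_
  · exact sum_piFinset_antidiagonal D.lower (sum_antidiagonal_swap D.em_inv) c u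
  · exact sum_piFinset_antidiagonal D.raise D.ep_inv c u

theorem dr_undr {c : σ → J} {G : (σ → ℤ) → Module.End ℂ V} (hG : IsGraded D.q D.T G) :
    D.dr c (D.undr c G) = G := by
  classical
  refine dress_dress D.q_ne D.bdd (D.isLowering_eMInv c) (D.isRaising_ePInv c) (D.isRaising_eP c) hG
    (fun u => ?_) fun u => ?_
  · exact sum_piFinset_antidiagonal D.lower D.em_inv c u
  · exact sum_piFinset_antidiagonal D.raise (sum_antidiagonal_swap D.ep_inv) c u

/-- The step that allows relations between dressed currents to be pulled back to the bare ones. -/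
theorem dr_injective {c : σ → J} {G G' : (σ → ℤ) → Module.End ℂ V} (hG : IsGraded D.q D.T G)
    (hG' : IsGraded D.q D.T G') (h : D.dr c G = D.dr c G') : G = G' := by
  rw [← undr_dr (c := c) hG, h, undr_dr hG']

theorem isGraded_dr {c : σ → J} {G : (σ → ℤ) → Module.End ℂ V} (hG : IsGraded D.q D.T G) :
    IsGraded D.q D.T (D.dr c G) :=
  isGraded_dress D.q_ne D.bdd (D.isLowering_eM c) hG (D.isRaising_eP c)

theorem isGraded_undr {c : σ → J} {G : (σ → ℤ) → Module.End ℂ V} (hG : IsGraded D.q D.T G) :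
    IsGraded D.q D.T (D.undr c G) :=
  isGraded_dress D.q_ne D.bdd (D.isLowering_eMInv c) hG (D.isRaising_ePInv c)

theorem hasLSum_dr {c : σ → J} {G : (σ → ℤ) → Module.End ℂ V} (hG : IsGraded D.q D.T G)
    (m : σ → ℤ) : HasLSum (fun x : (σ → ℕ) × (σ → ℕ) =>
      D.eM c x.1 * G (fun i => m i + x.1 i - x.2 i) * D.eP c x.2) (D.dr c G m) :=
  hasLSum_dress D.bdd hG (D.isRaising_eP c) m

theorem dr_reindex {σ' : Type*} [Fintype σ'] (τ : σ' ≃ σ) (c : σ → J)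
    {G : (σ' → ℤ) → Module.End ℂ V} (hG : IsGraded D.q D.T G) (m : σ → ℤ) :
    D.dr (c ∘ τ) G (m ∘ τ) = D.dr c (fun m => G (m ∘ τ)) m :=
  dress_reindex D.bdd τ (D.isRaising_eP c)
    (fun p => congrArg D.lower (Equiv.prod_comp τ fun i => D.em (c i) (p i)))
    (fun p => congrArg D.raise (Equiv.prod_comp τ fun i => D.ep (c i) (p i))) hG m

variable (D)

/-- The dressed currents. -/
def X (Z : J → ℤ → Module.End ℂ V) (c : J) (n : ℤ) : Module.End ℂ V :=
  D.dr (fun _ : Fin 1 => c) (fun m => Z c (m 0)) fun _ => n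

/-- The currents with the dressing removed. -/
def unX (X : J → ℤ → Module.End ℂ V) (c : J) (n : ℤ) : Module.End ℂ V :=
  D.undr (fun _ : Fin 1 => c) (fun m => X c (m 0)) fun _ => n

variable {D} {Z : J → ℤ → Module.End ℂ V}

theorem isGraded_single (hZ : ∀ c n, IsDeg D.q D.T n (Z c n)) (c : J) :
    IsGraded D.q D.T fun m : Fin 1 → ℤ => Z c (m 0) := fun m => by simpa using hZ c (m 0)

theorem isDeg_X (hZ : ∀ c n, IsDeg D.q D.T n (Z c n)) (c : J) (n : ℤ) :
    IsDeg D.q D.T n (D.X Z c n) :=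
  (isGraded_dr (isGraded_single hZ c) _).congr (by simp)

theorem isDeg_unX (hZ : ∀ c n, IsDeg D.q D.T n (Z c n)) (c : J) (n : ℤ) :
    IsDeg D.q D.T n (D.unX Z c n) :=
  (isGraded_undr (isGraded_single hZ c) _).congr (by simp)

theorem unX_X (hZ : ∀ c n, IsDeg D.q D.T n (Z c n)) : D.unX (D.X Z) = Z := by
  funext c n
  have h : (fun m : Fin 1 → ℤ => D.X Z c (m 0))
      = D.dr (fun _ : Fin 1 => c) fun m => Z c (m 0) := by
    funext m
    exact congrArg (D.dr (fun _ : Fin 1 => c) fun m => Z c (m 0)) (funext fun i : Fin 1 => by rw [Subsingleton.elim i 0])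
  rw [unX, h, undr_dr (isGraded_single hZ c)]

theorem X_unX (hZ : ∀ c n, IsDeg D.q D.T n (Z c n)) : D.X (D.unX Z) = Z := by
  funext c n
  have h : (fun m : Fin 1 → ℤ => D.unX Z c (m 0))
      = D.undr (fun _ : Fin 1 => c) fun m => Z c (m 0) := by
    funext m
    exact congrArg (D.undr (fun _ : Fin 1 => c) fun m => Z c (m 0)) (funext fun i : Fin 1 => by rw [Subsingleton.elim i 0])
  rw [X, h, dr_undr (isGraded_single hZ c)]

theorem hasLSum_X (hZ : ∀ c n, IsDeg D.q D.T n (Z c n)) (c : J) (n : ℤ) :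
    HasLSum (fun x : ℕ × ℕ => D.lower (D.em c x.1) * Z c (n + x.1 - x.2) * D.raise (D.ep c x.2))
      (D.X Z c n) := by
  refine ((hasLSum_dr (isGraded_single hZ c) fun _ => n).equiv
    ((Equiv.funUnique (Fin 1) ℕ).symm.prodCongr (Equiv.funUnique (Fin 1) ℕ).symm)).congr
    (fun x => ?_) rfl
  simp [eM, eP]

theorem hasLSum_unX (hZ : ∀ c n, IsDeg D.q D.T n (Z c n)) (c : J) (n : ℤ) :
    HasLSum (fun x : ℕ × ℕ => D.lower (D.emInv c x.1) * Z c (n + x.1 - x.2)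
      * D.raise (D.epInv c x.2)) (D.unX Z c n) := by
  refine ((hasLSum_dress (e := D.eMInv fun _ : Fin 1 => c) D.bdd (isGraded_single hZ c)
    (D.isRaising_ePInv _) fun _ => n).equiv
    ((Equiv.funUnique (Fin 1) ℕ).symm.prodCongr (Equiv.funUnique (Fin 1) ℕ).symm)).congr
    (fun x => ?_) rfl
  simp [eMInv, ePInv]

/-- By induction on the length: the raising exponential of the first current is moved past the
lowering exponentials of all the others. The scalars from `exchange` are the coefficients of `F` for
the pairs containing the first position, which is what `word` inserts at this stage. -/
theorem prod_X (hZ : ∀ c n, IsDeg D.q D.T n (Z c n))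
    (hl : ∀ r c n, D.lower r * Z c n = Z c n * D.lower r)
    (hr : ∀ r c n, D.raise r * Z c n = Z c n * D.raise r) {L : ℕ} (c : Fin L → J) (m : Fin L → ℤ) :
    (List.ofFn fun i => D.X Z (c i) (m i)).prod = D.dr c (word D.F Z L c) m := by
  classical
  induction L with
  | zero =>
    refine (HasLSum.unique (A := fun _ : (Fin 0 → ℕ) × (Fin 0 → ℕ) => (1 : Module.End ℂ V)) ?_
      ((hasLSum_dr (isGraded_word D.q_ne D.bdd hZ c) m).congr (fun x => ?_) rfl))
    · exact fun v => ⟨Finset.univ, fun i hi => absurd (Finset.mem_univ i) hi, by simp⟩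
    · simp [eM, eP, word]
  | succ L ih =>
    rw [List.ofFn_succ, List.prod_cons, ih]
    have hW := isGraded_word (F := D.F) D.q_ne D.bdd hZ fun i => c i.succ
    have h1 := (hasLSum_X hZ (c 0) (m 0)).mul
      (hasLSum_dr (c := fun i => c i.succ) hW fun i => m i.succ)
    -- A common refinement of both sides, indexed by the final lowering and raising indices and by
    -- the exponents taken from the exchange factors.
    let B : ((Fin (L + 1) → ℕ) × (Fin (L + 1) → ℕ)) × (Fin L → ℕ) → Module.End ℂ V := fun y =>
      D.eM c y.1.1 * ((∏ i, PowerSeries.coeff (y.2 i) (D.F (c 0) (c i.succ))) •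
        (Z (c 0) (m 0 + y.1.1 0 - y.1.2 0 - ∑ i, (y.2 i : ℤ)) * word D.F Z L (fun i => c i.succ)
          fun i => m i.succ + y.1.1 i.succ - y.1.2 i.succ + y.2 i)) * D.eP c y.1.2
    have hB : LocFin B := by
      have h2 (P' : Fin (L + 1) → ℕ) : LocFin fun y : (Fin (L + 1) → ℕ) × (Fin L → ℕ) =>
          D.eM c y.1 * ((∏ i, PowerSeries.coeff (y.2 i) (D.F (c 0) (c i.succ))) •
          (Z (c 0) (m 0 + y.1 0 - P' 0 - ∑ i, (y.2 i : ℤ)) * word D.F Z L (fun i => c i.succ)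
          fun i => m i.succ + y.1 i.succ - P' i.succ + y.2 i)) := by
        refine LocFin.of_fst (fun v => ?_) fun P => ?_
        · obtain ⟨N, hN⟩ := D.bdd v
          refine ⟨(finite_sum_le (σ := Fin (L + 1)) (∑ i, m i - ∑ i, (P' i : ℤ)) N).toFinset,
            fun P hP e => ?_⟩
          have := hN (∑ i, m i - ∑ i, (P' i : ℤ) + ∑ i, (P i : ℤ)) (by simpa using hP)
            (Z (c 0) (m 0 + P 0 - P' 0 - ∑ i, (e i : ℤ)) * word D.F Z L (fun i => c i.succ)
              fun i => m i.succ + P i.succ - P' i.succ + e i)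
            (((hZ _ _).mul D.q_ne (hW _)).congr (by
              simp only [Fin.sum_univ_succ, Finset.sum_add_distrib, Finset.sum_sub_distrib]
              ring))
          rw [Module.End.mul_apply, LinearMap.smul_apply, this, smul_zero, map_zero]
        · simp_rw [← smul_mul_assoc, ← mul_assoc]
          exact (locFin_word D.q_ne D.bdd hZ _ fun i => m i.succ + P i.succ - P' i.succ).mul_left _
      have h3 := (((D.isRaising_eP c).locFin D.bdd).bind h2)
      exact h3.equiv (((Equiv.prodComm _ _).prodCongr (Equiv.refl _)).trans (Equiv.prodAssoc _ _ _))
    have h2 : HasLSum B (D.dr c (word D.F Z (L + 1) c) m) := by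
      have h3 := hB.hasLSum.prod fun x : (Fin (L + 1) → ℕ) × (Fin (L + 1) → ℕ) =>
        ((hasLSum_word D.q_ne D.bdd hZ c fun i => m i + x.1 i - x.2 i).mul_left
          (D.eM c x.1)).mul_right (D.eP c x.2)
      rw [(hasLSum_dr (isGraded_word D.q_ne D.bdd hZ c) m).unique h3]
      exact hB.hasLSum
    -- An exchange with exponents `e` lowers the indices of the tail by `e i` and the first raising
    -- index by their sum. The original indices are recovered by adding these amounts, and the two
    -- bounds on `e` describe a fibre.
    have h3 := h2.fiber_param (κ := (ℕ × ℕ) × ((Fin L → ℕ) × (Fin L → ℕ))) (α := Fin L → ℕ)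
      (fun y => ((y.1.1 0, y.1.2 0 + ∑ i, y.2 i),
        (fun i => y.1.1 i.succ + y.2 i, fun i => y.1.2 i.succ)))
      (fun k => {e ∈ Fintype.piFinset (fun i => Finset.range (k.2.1 i + 1)) | ∑ i, e i ≤ k.1.2})
      (fun k e => ((Fin.cons k.1.1 fun i => k.2.1 i - e i, Fin.cons (k.1.2 - ∑ i, e i) k.2.2), e))
      (fun k e _ e' _ h => (Prod.mk.inj h).2)
      (fun k e he => by
        simp only [Finset.mem_filter, Fintype.mem_piFinset, Finset.mem_range] at he
        ext i
        · rfl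
        · simpa using Nat.sub_add_cancel he.2
        · have := he.1 i
          simp
          omega
        · rfl)
      (fun y => ⟨y.2, by simp, by
        ext i
        · refine Fin.cases ?_ (fun i => ?_) i <;> simp
        · refine Fin.cases ?_ (fun i => ?_) i <;> simp
        · rfl⟩)
    refine h1.unique (h3.congr (fun k => ?_) rfl)
    have h4 : ∀ A, (∀ c n, A * Z c n = Z c n * A) → ∀ m', A * word D.F Z L (fun i => c i.succ) m'
        = word D.F Z L (fun i => c i.succ) m' * A := fun A hA m' =>
      commute_word D.q_ne D.bdd hZ hA _ m'
    have h5 := D.exchange (c 0) k.1.2 (fun i => c i.succ) k.2.1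
    have h6 : D.lower (D.em (c 0) k.1.1) * Z (c 0) (m 0 + k.1.1 - k.1.2)
          * D.raise (D.ep (c 0) k.1.2) * (D.eM (fun i => c i.succ) k.2.1
          * word D.F Z L (fun i => c i.succ) (fun i => m i.succ + k.2.1 i - k.2.2 i)
          * D.eP (fun i => c i.succ) k.2.2)
        = D.lower (D.em (c 0) k.1.1) * Z (c 0) (m 0 + k.1.1 - k.1.2)
          * (D.raise (D.ep (c 0) k.1.2) * D.lower (∏ i, D.em (c i.succ) (k.2.1 i)))
          * word D.F Z L (fun i => c i.succ) (fun i => m i.succ + k.2.1 i - k.2.2 i)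
          * D.eP (fun i => c i.succ) k.2.2 := by
      simp only [eM, mul_assoc]
    rw [h6, h5, Finset.mul_sum, Finset.sum_mul, Finset.sum_mul]
    refine Finset.sum_congr rfl fun e he => ?_
    simp only [Finset.mem_filter, Fintype.mem_piFinset, Finset.mem_range] at he
    have h7 : m 0 + (k.1.1 : ℤ) - ((k.1.2 - ∑ i, e i : ℕ) : ℤ) - ∑ i, (e i : ℤ)
        = m 0 + k.1.1 - k.1.2 := by
      rw [Nat.cast_sub he.2]
      push_cast
      ring
    have h8 : (fun i => m i.succ + ((k.2.1 i - e i : ℕ) : ℤ) - (k.2.2 i : ℤ) + (e i : ℤ))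
        = fun i => m i.succ + (k.2.1 i : ℤ) - k.2.2 i := by
      funext i
      rw [Nat.cast_sub (by have := he.1 i; omega)]
      ring
    simp only [B, eM, eP, Fin.prod_univ_succ, Fin.cons_zero, Fin.cons_succ, h7, h8, map_mul,
      mul_smul_comm, smul_mul_assoc]
    congr 1
    simp only [mul_assoc]
    -- After the exchange, the lowering operators still have to pass the first current, and the
    -- raising operator has to pass the tail word. Both commute.
    rw [← mul_assoc (Z _ _) (D.lower _), ← hl, mul_assoc, ← mul_assoc (D.raise _) (word _ _ _ _ _),
      h4 _ (hr _), mul_assoc]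

end Dressing

end

noncomputable section

/-! ## The Heisenberg dressing -/

/-- The scaling rule with a scalar from the ring itself; below it is applied to the power series
variable. -/
theorem expCoeff_pow_mul {R : Type*} [CommRing R] [Algebra ℂ R] (c : R) (x : ℕ → R) (n : ℕ) :
    expCoeff (fun m => c ^ (m + 1) * x m) n = c ^ n * expCoeff x n := by
  have h : PowerSeries.X * PowerSeries.mk (fun m => c ^ (m + 1) * x m)
      = PowerSeries.rescale c (PowerSeries.X * PowerSeries.mk x) := by
    ext n
    rw [PowerSeries.coeff_rescale]
    cases n <;> simp [PowerSeries.coeff_succ_X_mul]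
  simp only [expCoeff, h, ← map_pow, PowerSeries.coeff_rescale, Finset.mul_sum, mul_smul_comm]

theorem isDeg_expCoeff {V : Type*} [AddCommGroup V] [Module ℂ V] {q : ℂ} {T : Module.End ℂ V}
    (hq : q ≠ 0) {x : ℕ → Module.End ℂ V} (s : ℤ) (hx : ∀ m : ℕ, IsDeg q T (s * (m + 1)) (x m))
    (n : ℕ) : IsDeg q T (s * n) (expCoeff x n) := by
  have h1 : ∀ n : ℕ, IsDeg q T (s * n) (PowerSeries.coeff n (PowerSeries.X * PowerSeries.mk x)) := by
    intro n
    cases n with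
    | zero => simpa using IsDeg.zero
    | succ n => simpa [PowerSeries.coeff_succ_X_mul] using hx n
  have h2 : ∀ j n : ℕ, IsDeg q T (s * n)
      (PowerSeries.coeff n ((PowerSeries.X * PowerSeries.mk x) ^ j)) := by
    intro j
    induction j with
    | zero =>
      intro n
      rw [pow_zero, PowerSeries.coeff_one]
      split_ifs with h
      · exact IsDeg.one.congr (by simp [h])
      · exact IsDeg.zero
    | succ j ih =>
      intro n
      rw [pow_succ, PowerSeries.coeff_mul]
      refine IsDeg.sum _ fun p hp => ((ih p.1).mul hq (h1 p.2)).congr ?_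
      rw [← mem_antidiagonal.mp hp]
      push_cast
      ring
  exact IsDeg.sum _ fun j _ => (h2 j n).smul _

/-- The numerical conditions on the data. -/
structure Datum.IsGood {I : Type*} (D : Datum I) (γ : ℂ) : Prop where
  q_ne : D.q ≠ 0
  q_pow_ne : ∀ n : ℕ, D.q ^ (n + 1) ≠ 1
  κ_ne : D.κ ≠ 0
  γ_ne : γ ≠ 0
  γ_pow_ne : ∀ n : ℕ, (γ ^ 4) ^ (n + 1) ≠ 1
  d_pos : ∀ i, 0 < D.d i
  b_symm : ∀ i j, D.b i j = D.b j i
  M_antisymm : ∀ i j, D.M i j = -D.M j i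

namespace Datum

variable {I : Type*} {D : Datum I} {γ : ℂ}

theorem IsGood.sub_inv_ne {x : ℂ} (hx : x ≠ 0) (h : x ^ 2 ≠ 1) : x - x⁻¹ ≠ 0 := fun hc => h (by
  field_simp at hc
  linear_combination hc)

theorem IsGood.q_sub_ne (h : D.IsGood γ) : D.q - D.q⁻¹ ≠ 0 := sub_inv_ne h.q_ne (h.q_pow_ne 1)

theorem IsGood.qi_ne (h : D.IsGood γ) (i : I) : D.qi i ≠ 0 := pow_ne_zero _ h.q_ne

theorem IsGood.qi_sub_ne (h : D.IsGood γ) (i : I) : D.qi i - (D.qi i)⁻¹ ≠ 0 :=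
  sub_inv_ne (h.qi_ne i) (by
    obtain ⟨n, hn⟩ := Nat.exists_eq_succ_of_ne_zero (h.d_pos i).ne'
    rw [qi, ← pow_mul, hn]
    exact h.q_pow_ne ((n + 1) * 2 - 1))

/-- The numerator `x - x⁻¹` with `x = γ^(2(m+1))` vanishes only if `x^2 = (γ^4)^(m+1)` is 1. -/
theorem IsGood.levelInt_ne (h : D.IsGood γ) (m : ℕ) : levelInt D.q γ ((m : ℤ) + 1) ≠ 0 := by
  refine div_ne_zero ?_ h.q_sub_ne
  have h1 := sub_inv_ne (x := γ ^ (2 * ((m : ℤ) + 1))) (zpow_ne_zero _ h.γ_ne) (by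
    have := h.γ_pow_ne m
    rw [← pow_mul] at this
    rw [← zpow_natCast, ← zpow_mul]
    convert this using 1
    rw [← zpow_natCast]
    congr 1
    push_cast
    ring)
  rwa [← zpow_neg] at h1

/-- The structure constant `[b_ij n] / n [kn] κ^{-n m_ij}` of the Heisenberg algebra. -/
def w (D : Datum I) (γ : ℂ) (i j : I) (l : ℤ) : ℂ :=
  qInt D.q (D.b i j * l) / (l : ℂ) * levelInt D.q γ l * D.κ ^ (-l * D.M i j)

/-- Consistency of the Heisenberg bracket under exchange of its arguments: `b` is symmetric, `M` is
antisymmetric, and of the three factors odd in `l` the two quantum integers and the denominator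
leave one sign. -/
theorem IsGood.w_neg (h : D.IsGood γ) (i j : I) (l : ℤ) : D.w γ j i (-l) = -D.w γ i j l := by
  have h1 : qInt D.q (D.b j i * -l) = -qInt D.q (D.b i j * l) := by
    rw [h.b_symm j i, qInt, qInt, mul_neg, neg_neg]
    ring
  have h2 : levelInt D.q γ (-l) = -levelInt D.q γ l := by
    rw [levelInt, levelInt, mul_neg, neg_neg]
    ring
  rw [w, w, h1, h2, h.M_antisymm j i]
  push_cast
  ring_nf

end Datum

/-- The sign in the dressing of `X^+` (for `true`) and `X^-` (for `false`). -/
def sg : Bool → ℤ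
  | true => -1
  | false => 1

variable {I : Type*}

/-- The exponents of the lowering operators. -/
def cm (D : Datum I) (γ : ℂ) (s : Bool) (m : ℕ) : ℂ :=
  γ ^ (sg s * ((m : ℤ) + 1)) * (-(sg s : ℂ) / levelInt D.q γ (m + 1))

/-- The exponents of the raising operators. -/
def cp (D : Datum I) (γ : ℂ) (s : Bool) (m : ℕ) : ℂ :=
  γ ^ (sg s * ((m : ℤ) + 1)) * ((sg s : ℂ) / levelInt D.q γ (m + 1))

/-- The translation of the polynomials in the `a_{j,-n}` that describes their exchange with the
raising operators of exponents `c m • a_{i,m+1}`. -/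
def translation (D : Datum I) (γ : ℂ) (c : ℕ → ℂ) (i : I) :
    MvPolynomial (I × ℕ) ℂ →ₐ[ℂ] PowerSeries (MvPolynomial (I × ℕ) ℂ) :=
  MvPolynomial.aeval fun x : I × ℕ => PowerSeries.C (MvPolynomial.X x)
    + (c x.2 * D.w γ i x.1 (x.2 + 1)) • PowerSeries.X ^ (x.2 + 1)

/-- The translated exponent is the sum of the old one and a scalar series, so its exponential is a
product. The scalar exponential is the exchange factor. -/
theorem translation_expCoeff (D : Datum I) (γ : ℂ) (c c' : ℕ → ℂ) (i j : I)
    (n : ℕ) : translation D γ c i (expCoeff (fun m => c' m • MvPolynomial.X (j, m)) n)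
      = ∑ e ∈ Finset.range (n + 1), (PowerSeries.X ^ e * PowerSeries.C
          (PowerSeries.coeff e (expS fun m => c' m * c m * D.w γ i j (m + 1)) •
            expCoeff (fun m => c' m • MvPolynomial.X (R := ℂ) (j, m)) (n - e))) := by
  have h1 : ∀ m, translation D γ c i (c' m • MvPolynomial.X (j, m))
      = PowerSeries.X ^ (m + 1) * algebraMap ℂ _ (c' m * c m * D.w γ i j (m + 1))
        + PowerSeries.C (c' m • MvPolynomial.X (j, m)) := by
    intro m
    rw [map_smul, translation, MvPolynomial.aeval_X, smul_add, add_comm, smul_smul,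
      Algebra.smul_def, mul_comm, mul_assoc]
    congr 1
    ext1 k
    simp [PowerSeries.coeff_C]
  have h2 : ∀ k, expCoeff (fun m => PowerSeries.C (c' m • MvPolynomial.X (R := ℂ) (j, m))) k
      = PowerSeries.C (expCoeff (fun m => c' m • MvPolynomial.X (R := ℂ) (j, m)) k) := by
    intro k
    have := expCoeff_map (Algebra.algHom ℂ (MvPolynomial (I × ℕ) ℂ)
      (PowerSeries (MvPolynomial (I × ℕ) ℂ))) (fun m => c' m • MvPolynomial.X (R := ℂ) (j, m)) k
    exact this.symm
  rw [expCoeff_map]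
  simp only [h1]
  rw [expCoeff_add, Finset.Nat.sum_antidiagonal_eq_sum_range_succ_mk]
  refine Finset.sum_congr rfl fun e _ => ?_
  rw [expCoeff_pow_mul, h2, mul_assoc]
  congr 1
  have h3 := expCoeff_map (Algebra.ofId ℂ (PowerSeries (MvPolynomial (I × ℕ) ℂ)))
    (fun m => c' m * c m * D.w γ i j (m + 1)) e
  simp only [Algebra.ofId_apply] at h3
  rw [← h3, ← Algebra.smul_def, expS, PowerSeries.coeff_mk]
  ext1 k
  simp [PowerSeries.coeff_C]

/-- The exchange factor `F_{cc'}` as a quotient of infinite products. -/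
theorem F_exponent {D : Datum I} {γ : ℂ} (hg : D.IsGood γ) (i j : I) (s s' : Bool) (m : ℕ) :
    cm D γ s' m * cp D γ s m * D.w γ i j (m + 1)
      = (sg s * sg s' : ℂ) * (γ ^ (sg s + sg s' + 2)) ^ (m + 1)
        * (((D.q ^ D.b i j * D.κ ^ (-D.M i j)) ^ (m + 1)
          - (D.q ^ (-D.b i j) * D.κ ^ (-D.M i j)) ^ (m + 1))
          / (((m : ℂ) + 1) * (1 - (γ ^ 4) ^ (m + 1)))) := by
  have hl := hg.levelInt_ne m
  have h1 : (m : ℂ) + 1 ≠ 0 := Nat.cast_add_one_ne_zero m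
  have h2 : 1 - (γ ^ 4) ^ (m + 1) ≠ 0 := sub_ne_zero.mpr (hg.γ_pow_ne m).symm
  -- Of the factors `[kn]`, two stand in the denominators of `cm` and `cp` and one in the numerator
  -- of `w`. The one left over becomes the denominator `1 - γ^(4n)` of the logarithm of an infinite
  -- product, at the price of a power of `γ^2`.
  have h3 : (D.q - D.q⁻¹) * levelInt D.q γ (m + 1) * (γ ^ 2) ^ (m + 1)
      = -(1 - (γ ^ 4) ^ (m + 1)) := by
    rw [levelInt, mul_div_cancel₀ _ hg.q_sub_ne, sub_mul, ← pow_mul, ← pow_mul,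
      ← zpow_natCast γ (2 * (m + 1)), ← zpow_natCast γ (4 * (m + 1)), ← zpow_add₀ hg.γ_ne,
      ← zpow_add₀ hg.γ_ne]
    push_cast
    ring_nf
    rw [zpow_zero]
    ring
  have h4 : (D.q - D.q⁻¹) * qInt D.q (D.b i j * (m + 1))
      = (D.q ^ D.b i j) ^ (m + 1) - (D.q ^ (-D.b i j)) ^ (m + 1) := by
    rw [qInt, mul_div_cancel₀ _ hg.q_sub_ne, ← zpow_natCast, ← zpow_natCast, ← zpow_mul, ← zpow_mul]
    push_cast
    ring_nf
  have h5 : D.κ ^ (-((m : ℤ) + 1) * D.M i j) = (D.κ ^ (-D.M i j)) ^ (m + 1) := by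
    rw [← zpow_natCast, ← zpow_mul]
    push_cast
    ring_nf
  have h6 : γ ^ (sg s' * ((m : ℤ) + 1)) * γ ^ (sg s * ((m : ℤ) + 1)) * (γ ^ 2) ^ (m + 1)
      = (γ ^ (sg s + sg s' + 2)) ^ (m + 1) := by
    rw [← zpow_natCast, ← zpow_natCast, ← zpow_natCast, ← zpow_mul, ← zpow_mul,
      ← zpow_add₀ hg.γ_ne, ← zpow_add₀ hg.γ_ne]
    push_cast
    ring_nf
  rw [← h6, mul_pow, mul_pow, ← sub_mul, ← h4, ← h5]
  have h7 : (1 - (γ ^ 4) ^ (m + 1))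
      = -((D.q - D.q⁻¹) * levelInt D.q γ (m + 1) * (γ ^ 2) ^ (m + 1)) := by rw [h3, neg_neg]
  rw [h7] at h2 ⊢
  have h8 := hg.q_sub_ne
  have h9 : (γ ^ 2) ^ (m + 1) ≠ 0 := pow_ne_zero _ (pow_ne_zero _ hg.γ_ne)
  simp only [cm, cp, Datum.w]
  push_cast
  generalize D.q - D.q⁻¹ = x at *
  generalize levelInt D.q γ (m + 1) = y at *
  generalize (γ ^ 2) ^ (m + 1) = z at *
  field_simp

variable {V : Type*} [AddCommGroup V] [Module ℂ V]

/-- The operators `a_{i,l}` satisfy the relations of the Heisenberg algebra and are graded by `T`. -/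
structure IsHeis (D : Datum I) (γ : ℂ) (T : Module.End ℂ V) (a : I → NZ → Module.End ℂ V) :
    Prop where
  good : D.IsGood γ
  bdd : IsBdd D.q T
  a_a : ∀ i j l m, a i l * a j m - a j m * a i l
    = if (l : ℤ) + m = 0 then D.w γ i j l • (1 : Module.End ℂ V) else 0
  deg : ∀ i (l : NZ), IsDeg D.q T (l : ℤ) (a i l)

namespace IsHeis

variable {D : Datum I} {γ : ℂ} {T : Module.End ℂ V} {a : I → NZ → Module.End ℂ V}
  (h : IsHeis D γ T a)

include h

theorem comm_neg (i j : I) (m m' : ℕ) : a i (neg m) * a j (neg m') = a j (neg m') * a i (neg m) := by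
  have := h.a_a i j (neg m) (neg m')
  rwa [if_neg (by simp [neg]; omega), sub_eq_zero] at this

theorem comm_pos (i j : I) (m m' : ℕ) : a i (pos m) * a j (pos m') = a j (pos m') * a i (pos m) := by
  have := h.a_a i j (pos m) (pos m')
  rwa [if_neg (by simp [pos]; omega), sub_eq_zero] at this

theorem exists_lower : ∃ φ : MvPolynomial (I × ℕ) ℂ →ₐ[ℂ] Module.End ℂ V,
    ∀ x, φ (MvPolynomial.X x) = a x.1 (neg x.2) :=
  exists_algHom_of_commute _ fun x y => h.comm_neg x.1 y.1 x.2 y.2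

theorem exists_raise : ∃ φ : MvPolynomial (I × ℕ) ℂ →ₐ[ℂ] Module.End ℂ V,
    ∀ x, φ (MvPolynomial.X x) = a x.1 (pos x.2) :=
  exists_algHom_of_commute _ fun x y => h.comm_pos x.1 y.1 x.2 y.2

/-- The action of polynomials in the `a_{i,-n}`. -/
def lower : MvPolynomial (I × ℕ) ℂ →ₐ[ℂ] Module.End ℂ V := h.exists_lower.choose

/-- The action of polynomials in the `a_{i,n}`. -/
def raise : MvPolynomial (I × ℕ) ℂ →ₐ[ℂ] Module.End ℂ V := h.exists_raise.choose

theorem lower_X (x : I × ℕ) : h.lower (MvPolynomial.X x) = a x.1 (neg x.2) :=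
  h.exists_lower.choose_spec x

theorem raise_X (x : I × ℕ) : h.raise (MvPolynomial.X x) = a x.1 (pos x.2) :=
  h.exists_raise.choose_spec x

theorem lower_expCoeff (c : ℕ → ℂ) (i : I) (n : ℕ) :
    h.lower (expCoeff (fun m => c m • MvPolynomial.X (i, m)) n)
      = expCoeff (fun m => c m • a i (neg m)) n := by
  rw [expCoeff_map]
  simp only [map_smul, lower_X]

theorem raise_expCoeff (c : ℕ → ℂ) (i : I) (n : ℕ) :
    h.raise (expCoeff (fun m => c m • MvPolynomial.X (i, m)) n)
      = expCoeff (fun m => c m • a i (pos m)) n := by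
  rw [expCoeff_map]
  simp only [map_smul, raise_X]

/-- The commutator with each exponent is a scalar, nonzero only for the opposite mode; hence
`commutator_expCoeff` applies. -/
theorem a_pos_mul_expNeg (c : ℕ → ℂ) (i j : I) (m n : ℕ) :
    a i (pos m) * expCoeff (fun m => c m • a j (neg m)) n
      = expCoeff (fun m => c m • a j (neg m)) n * a i (pos m) + if m + 1 ≤ n then
        (c m * D.w γ i j (m + 1)) • expCoeff (fun m => c m • a j (neg m)) (n - (m + 1)) else 0 := by
  refine commutator_expCoeff _ (fun m m' => ?_) _ _ m (fun m' => ?_) n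
  · rw [smul_mul_smul_comm, smul_mul_smul_comm, h.comm_neg, mul_comm]
  · have h1 := h.a_a i j (pos m) (neg m')
    rw [mul_smul_comm, smul_mul_assoc, eq_add_of_sub_eq' h1, smul_add]
    congr 1
    by_cases h2 : m' = m
    · subst h2
      rw [if_pos (by simp [pos, neg]), if_pos rfl, smul_smul]
      rfl
    · rw [if_neg (by simp [pos, neg]; omega), if_neg h2, smul_zero]

theorem a_neg_mul_expPos (c : ℕ → ℂ) (i j : I) (m n : ℕ) :
    a i (neg m) * expCoeff (fun m => c m • a j (pos m)) n
      = expCoeff (fun m => c m • a j (pos m)) n * a i (neg m) + if m + 1 ≤ n then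
        (c m * D.w γ i j (-(m + 1))) • expCoeff (fun m => c m • a j (pos m)) (n - (m + 1))
          else 0 := by
  refine commutator_expCoeff _ (fun m m' => ?_) _ _ m (fun m' => ?_) n
  · rw [smul_mul_smul_comm, smul_mul_smul_comm, h.comm_pos, mul_comm]
  · have h1 := h.a_a i j (neg m) (pos m')
    rw [mul_smul_comm, smul_mul_assoc, eq_add_of_sub_eq' h1, smul_add]
    congr 1
    by_cases h2 : m' = m
    · subst h2
      rw [if_pos (by simp [pos, neg]), if_pos rfl, smul_smul]
      rfl
    · rw [if_neg (by simp [pos, neg]; omega), if_neg h2, smul_zero]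

theorem a_neg_mul_expNeg (c : ℕ → ℂ) (i j : I) (m n : ℕ) :
    a i (neg m) * expCoeff (fun m => c m • a j (neg m)) n
      = expCoeff (fun m => c m • a j (neg m)) n * a i (neg m) := by
  rw [← h.lower_expCoeff, ← h.lower_X (i, m), ← map_mul, ← map_mul, mul_comm]

theorem a_pos_mul_expPos (c : ℕ → ℂ) (i j : I) (m n : ℕ) :
    a i (pos m) * expCoeff (fun m => c m • a j (pos m)) n
      = expCoeff (fun m => c m • a j (pos m)) n * a i (pos m) := by
  rw [← h.raise_expCoeff, ← h.raise_X (i, m), ← map_mul, ← map_mul, mul_comm]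

/-- Conjugation by the raising exponential is an algebra homomorphism on the lowering operators, so
it is enough to know it on the variables. There it adds a scalar, namely the commutator with the
exponential. -/
theorem raise_mul_lower (c : ℕ → ℂ) (i : I) (f : MvPolynomial (I × ℕ) ℂ) :
    PowerSeries.mk (fun n => h.raise (expCoeff (fun m => c m • MvPolynomial.X (i, m)) n))
        * PowerSeries.C (h.lower f)
      = PowerSeries.map (h.lower : MvPolynomial (I × ℕ) ℂ →+* Module.End ℂ V)
          (translation D γ c i f)
        * PowerSeries.mk fun n => h.raise (expCoeff (fun m => c m • MvPolynomial.X (i, m)) n) := by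
  induction f using MvPolynomial.induction_on with
  | C r =>
    have h1 : h.lower (MvPolynomial.C r) = algebraMap ℂ _ r := by
      rw [← MvPolynomial.algebraMap_eq, AlgHom.commutes]
    ext1 n
    rw [translation, MvPolynomial.aeval_C, PowerSeries.algebraMap_apply, PowerSeries.map_C,
      PowerSeries.coeff_mul_C, PowerSeries.coeff_C_mul, MvPolynomial.algebraMap_eq]
    change _ * h.lower (MvPolynomial.C r) = h.lower (MvPolynomial.C r) * _
    rw [h1, Algebra.commutes]
  | add f g hf hg => rw [map_add, map_add, mul_add, hf, hg, map_add, map_add, add_mul]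
  | mul_X f x hf =>
    rw [map_mul, map_mul, ← mul_assoc, hf, map_mul, map_mul, mul_assoc, mul_assoc]
    congr 1
    ext1 n
    have h2 : PowerSeries.map (h.lower : MvPolynomial (I × ℕ) ℂ →+* Module.End ℂ V)
        (translation D γ c i (MvPolynomial.X x))
        = PowerSeries.C (a x.1 (neg x.2))
          + PowerSeries.X ^ (x.2 + 1) * PowerSeries.C ((c x.2 * D.w γ i x.1 (x.2 + 1)) • (1 : Module.End ℂ V)) := by
      rw [translation, MvPolynomial.aeval_X, map_add, PowerSeries.map_C, ← h.lower_X x]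
      congr 1
      ext1 k
      rw [PowerSeries.coeff_map, PowerSeries.coeff_smul, PowerSeries.coeff_mul_C,
        PowerSeries.coeff_X_pow, PowerSeries.coeff_X_pow]
      change h.lower (_ • _) = _
      split_ifs <;> simp
    rw [h2, add_mul, map_add, PowerSeries.coeff_mul_C, PowerSeries.coeff_C_mul, mul_assoc,
      PowerSeries.coeff_X_pow_mul', PowerSeries.coeff_C_mul, PowerSeries.coeff_mk,
      PowerSeries.coeff_mk, h.lower_X, h.raise_expCoeff, h.raise_expCoeff, h.a_neg_mul_expPos]
    -- The commutator is available with the lowering operator as first argument; moving that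
    -- operator to the left uses the opposite order and thus the opposite sign.
    have h3 := h.good.w_neg i x.1 (x.2 + 1)
    rw [h3, smul_mul_assoc, one_mul, add_assoc]
    split_ifs <;> simp

-- The coefficient of order `n` of `raise_mul_lower` for a product of exponential coefficients. The
-- translation is multiplicative, so every factor loses its own `e r` and the raising exponential
-- loses the total.
open Classical in
theorem exchange (c : ℕ → ℂ) (i : I) (n : ℕ) {L : ℕ} (c' : Fin L → ℕ → ℂ) (j : Fin L → I)
    (p : Fin L → ℕ) :
    h.raise (expCoeff (fun m => c m • MvPolynomial.X (i, m)) n)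
        * h.lower (∏ r, expCoeff (fun m => c' r m • MvPolynomial.X (j r, m)) (p r))
      = ∑ e ∈ Fintype.piFinset (fun r => Finset.range (p r + 1)) with ∑ r, e r ≤ n,
        (∏ r, PowerSeries.coeff (e r) (expS fun m => c' r m * c m * D.w γ i (j r) (m + 1))) •
          (h.lower (∏ r, expCoeff (fun m => c' r m • MvPolynomial.X (j r, m)) (p r - e r))
            * h.raise (expCoeff (fun m => c m • MvPolynomial.X (i, m)) (n - ∑ r, e r))) := by
  have h1 := congrArg (PowerSeries.coeff n) (h.raise_mul_lower c i
    (∏ r, expCoeff (fun m => c' r m • MvPolynomial.X (j r, m)) (p r)))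
  rw [PowerSeries.coeff_mul_C, PowerSeries.coeff_mk] at h1
  rw [h1, map_prod (translation D γ c i)]
  simp only [translation_expCoeff]
  rw [Finset.prod_univ_sum, map_sum, Finset.sum_mul, map_sum, Finset.sum_filter]
  refine Finset.sum_congr rfl fun e _ => ?_
  rw [Finset.prod_mul_distrib, Finset.prod_pow_eq_pow_sum, ← map_prod,
    map_mul (PowerSeries.map (h.lower : MvPolynomial (I × ℕ) ℂ →+* Module.End ℂ V)), map_pow,
    PowerSeries.map_X, PowerSeries.map_C, mul_assoc, PowerSeries.coeff_X_pow_mul',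
    PowerSeries.coeff_C_mul, PowerSeries.coeff_mk]
  split_ifs
  · rw [Finset.prod_smul, ← smul_mul_assoc, ← map_smul]
    rfl
  · rfl

/-- The dressing by the Heisenberg operators; the colour `(i, true)` belongs to `X^+_i`, and
`(i, false)` to `X^-_i`. -/
def dressing : Dressing V (I × Bool) (MvPolynomial (I × ℕ) ℂ) where
  q := D.q
  T := T
  lower := h.lower
  raise := h.raise
  em c := expCoeff fun m => cm D γ c.2 m • MvPolynomial.X (c.1, m)
  ep c := expCoeff fun m => cp D γ c.2 m • MvPolynomial.X (c.1, m)
  emInv c := expCoeff fun m => (-cm D γ c.2 m) • MvPolynomial.X (c.1, m)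
  epInv c := expCoeff fun m => (-cp D γ c.2 m) • MvPolynomial.X (c.1, m)
  F c c' := expS fun m => cm D γ c'.2 m * cp D γ c.2 m * D.w γ c.1 c'.1 (m + 1)
  q_ne := h.good.q_ne
  bdd := h.bdd
  deg_em c n := by
    rw [h.lower_expCoeff]
    exact (isDeg_expCoeff h.good.q_ne (-1) (fun m => ((h.deg _ _).congr
      (by simp [neg])).smul _) n).congr (by simp)
  deg_emInv c n := by
    rw [h.lower_expCoeff]
    exact (isDeg_expCoeff h.good.q_ne (-1) (fun m => ((h.deg _ _).congr
      (by simp [neg])).smul _) n).congr (by simp)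
  deg_ep c n := by
    rw [h.raise_expCoeff]
    exact (isDeg_expCoeff h.good.q_ne 1 (fun m => ((h.deg _ _).congr
      (by simp [pos])).smul _) n).congr (by simp)
  deg_epInv c n := by
    rw [h.raise_expCoeff]
    exact (isDeg_expCoeff h.good.q_ne 1 (fun m => ((h.deg _ _).congr
      (by simp [pos])).smul _) n).congr (by simp)
  em_inv c n := expCoeff_add_neg _ _ (fun m => by rw [neg_smul, add_neg_cancel]) n
  ep_inv c n := expCoeff_add_neg _ _ (fun m => by rw [neg_smul, add_neg_cancel]) n
  exchange c₀ n c p := by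
    convert h.exchange (cp D γ c₀.2) c₀.1 n (fun r => cm D γ (c r).2) (fun r => (c r).1) p

/-- The power of `γ` is 0 for `X^+` and 4 for `X^-`; this is why the Serre factor for `Z^-` is the
one for `Z^+` evaluated at `q^{2k} x`. -/
theorem F_same (i j : I) (s : Bool) : h.dressing.F (i, s) (j, s)
    = ratio (γ ^ 4) (γ ^ (2 * sg s + 2) * (D.q ^ (-D.b i j) * D.κ ^ (-D.M i j)))
      (γ ^ (2 * sg s + 2) * (D.q ^ D.b i j * D.κ ^ (-D.M i j))) := by
  rw [ratio_eq_expS h.good.γ_pow_ne]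
  refine congrArg expS (funext fun m => (F_exponent h.good i j s s m).trans ?_)
  have : (sg s * sg s : ℂ) = 1 := by cases s <;> simp [sg]
  rw [this, ← two_mul, mul_pow (γ ^ _), mul_pow (γ ^ _)]
  ring

/-- Opposite signs invert the quotient, and the powers of `γ` combine to `γ^2 = q^k`. -/
theorem F_ne (i j : I) (s : Bool) : h.dressing.F (i, s) (j, !s)
    = ratio (γ ^ 4) (γ ^ 2 * (D.q ^ D.b i j * D.κ ^ (-D.M i j)))
      (γ ^ 2 * (D.q ^ (-D.b i j) * D.κ ^ (-D.M i j))) := by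
  rw [ratio_eq_expS h.good.γ_pow_ne]
  refine congrArg expS (funext fun m => (F_exponent h.good i j s (!s) m).trans ?_)
  have h1 : ((sg s : ℤ) * (sg (!s) : ℤ) : ℂ) = -1 := by cases s <;> simp [sg]
  have h2 : γ ^ (sg s + sg (!s) + 2) = γ ^ 2 := by
    have : sg s + sg (!s) + 2 = (2 : ℕ) := by cases s <;> simp [sg]
    rw [this, zpow_natCast]
  rw [h1, h2, mul_pow (γ ^ _), mul_pow (γ ^ _)]
  ring

end IsHeis

end

noncomputable section

/-! ## Two-point functions -/

section TwoPoint

variable {V ι κ : Type*} [AddCommGroup V] [Module ℂ V] {q : ℂ} {T : Module.End ℂ V}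

theorem HasLSum.embed {A : ι → Module.End ℂ V} {S : Module.End ℂ V} (h : HasLSum A S)
    {B : κ → Module.End ℂ V} (j : ι ↪ κ) (hj : ∀ i, B (j i) = A i)
    (h0 : ∀ k, (∀ i, j i ≠ k) → B k = 0) : HasLSum B S := fun v => by
  obtain ⟨s, hs, hS⟩ := h v
  refine ⟨s.map j, fun k hk => ?_, ?_⟩
  · by_cases h1 : ∃ i, j i = k
    · obtain ⟨i, rfl⟩ := h1
      change B (j i) v = 0
      rw [hj]
      exact hs i fun hi => hk (Finset.mem_map_of_mem j hi)
    · change B k v = 0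
      rw [h0 k (by simpa using h1), LinearMap.zero_apply]
  · rw [Finset.sum_map, ← hS]
    simp only [hj]

theorem HasLSum.of_single {A : ι → Module.End ℂ V} (i₀ : ι) (h : ∀ i, i ≠ i₀ → A i = 0) :
    HasLSum A (A i₀) := fun v =>
  ⟨{i₀}, fun i hi => by simp [h i (by simpa using hi)], by simp⟩

/-- The coefficient of `z^{-r} w^{-s}` in `f(w/z) A(z) B(w)`. -/
def tp (f : PowerSeries ℂ) (A B : ℤ → Module.End ℂ V) (r s : ℤ) : Module.End ℂ V :=
  lsum fun n : ℕ => PowerSeries.coeff n f • (A (r - n) * B (s + n))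

variable {A B : ℤ → Module.End ℂ V}

theorem hasLSum_tp (hT : IsBdd q T) (hB : ∀ n, IsDeg q T n (B n))
    (f : PowerSeries ℂ) (r s : ℤ) :
    HasLSum (fun n : ℕ => PowerSeries.coeff n f • (A (r - n) * B (s + n))) (tp f A B r s) := by
  have h1 : LocFin fun n : ℕ => B (s + n) := locFin_of_isDeg hT _ (fun n => hB (s + n)) fun N =>
    (Set.finite_Iic (N - s).toNat).subset fun n hn => by
      simp only [Set.mem_ofPred_eq, Set.mem_Iic] at hn ⊢
      omega
  refine LocFin.hasLSum ?_
  simp_rw [← smul_mul_assoc]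
  exact h1.mul_left fun n : ℕ => PowerSeries.coeff n f • A (r - n)

theorem isDeg_tp (hq : q ≠ 0) (hT : IsBdd q T) (hA : ∀ n, IsDeg q T n (A n))
    (hB : ∀ n, IsDeg q T n (B n)) (f : PowerSeries ℂ) (r s : ℤ) :
    IsDeg q T (r + s) (tp f A B r s) :=
  IsDeg.hasLSum (hasLSum_tp hT hB f r s) fun n =>
    (((hA _).mul hq (hB _)).congr (by ring)).smul _

theorem twoPoint_eq_tp (hT : IsBdd q T) (hB : ∀ n, IsDeg q T n (B n)) (f : PowerSeries ℂ)
    (r s : ℤ) (v : V) : twoPoint f A B r s v = tp f A B r s v :=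
  (hasLSum_tp hT hB f r s).finsum_eq v

/-- Multiplication of `f` by `w/z` moves one unit from the first mode to the second. -/
theorem tp_one_sub_mul (hT : IsBdd q T) (hB : ∀ n, IsDeg q T n (B n)) (β : ℂ) (f : PowerSeries ℂ)
    (r s : ℤ) : tp ((1 - PowerSeries.C β * PowerSeries.X) * f) A B r s
      = tp f A B r s - β • tp f A B (r - 1) (s + 1) := by
  have h1 : HasLSum (fun n : ℕ => PowerSeries.coeff n (PowerSeries.X * f) •
      (A (r - n) * B (s + n))) (tp f A B (r - 1) (s + 1)) := by
    refine (hasLSum_tp hT hB f (r - 1) (s + 1)).embed ⟨Nat.succ, Nat.succ_injective⟩ (fun n => ?_)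
      fun k hk => ?_
    · simp only [Function.Embedding.coeFn_mk, PowerSeries.coeff_succ_X_mul]
      congr 3 <;> · push_cast; ring
    · cases k with
      | zero => simp
      | succ k => exact absurd rfl (hk k)
  refine ((hasLSum_tp hT hB f r s).sub (h1.smul β)).congr (fun n => ?_) rfl |>.lsum_eq
  rw [sub_mul, one_mul, mul_assoc, map_sub, PowerSeries.coeff_C_mul, sub_smul, smul_smul]

theorem word_two {J : Type*} {F : J → J → PowerSeries ℂ} {Z : J → ℤ → Module.End ℂ V}
    (hT : IsBdd q T) (hZ : ∀ c n, IsDeg q T n (Z c n)) (c : Fin 2 → J) (m : Fin 2 → ℤ) :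
    word F Z 2 c m = tp (F (c 0) (c 1)) (Z (c 0)) (Z (c 1)) (m 0) (m 1) := by
  have h1 : ∀ (c : Fin 1 → J) (m : Fin 1 → ℤ), word F Z 1 c m = Z (c 0) (m 0) := by
    intro c m
    refine HasLSum.lsum_eq ((HasLSum.of_single (default : Fin 0 → ℕ) fun i hi =>
      absurd (Subsingleton.elim _ _) hi).congr (fun _ => rfl) ?_)
    simp [word]
  refine HasLSum.lsum_eq (((hasLSum_tp hT (hZ (c 1)) (F (c 0) (c 1)) (m 0) (m 1)).equiv
    (Equiv.funUnique (Fin 1) ℕ)).congr (fun e => ?_) rfl)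
  rw [h1]
  simp

end TwoPoint

section WordComp

variable {V : Type*} [AddCommGroup V] [Module ℂ V]

/-- In a Serre relation all currents carry the same sign, so the words use only part of the colours.
-/
theorem word_comp {J J' : Type*} (φ : J' → J) (F : J → J → PowerSeries ℂ)
    (Z : J → ℤ → Module.End ℂ V) {L : ℕ} (c : Fin L → J') (m : Fin L → ℤ) :
    word F Z L (fun p => φ (c p)) m
      = word (fun i j => F (φ i) (φ j)) (fun i => Z (φ i)) L c m := by
  induction L with
  | zero => rfl
  | succ L ih =>
    rw [word, word]
    congr 1
    funext e
    rw [ih fun i => c i.succ]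

end WordComp

/-! ### Quadratic relations between dressed currents -/

namespace Dressing

variable {V J R σ : Type*} [AddCommGroup V] [Module ℂ V] [CommRing R] [Algebra ℂ R] [Fintype σ]
  {D : Dressing V J R} {Z : J → ℤ → Module.End ℂ V}

theorem dr_shift (c : σ → J) (G : (σ → ℤ) → Module.End ℂ V) (δ m : σ → ℤ) :
    D.dr c (fun m => G fun i => m i + δ i) m = D.dr c G fun i => m i + δ i := by
  refine congrArg lsum (funext fun x => ?_)
  beta_reduce
  congr 3
  funext i
  ring

theorem dr_sum {c : σ → J} {α : Type*} (s : Finset α) (b : α → ℂ)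
    (G : α → (σ → ℤ) → Module.End ℂ V) (hG : ∀ a, IsGraded D.q D.T (G a)) (m : σ → ℤ) :
    D.dr c (fun m => ∑ a ∈ s, b a • G a m) m = ∑ a ∈ s, b a • D.dr c (G a) m :=
  dress_sum D.bdd (D.isRaising_eP c) s b G hG m

theorem dr_smul {c : σ → J} (b : ℂ) {G : (σ → ℤ) → Module.End ℂ V} (hG : IsGraded D.q D.T G)
    (m : σ → ℤ) : D.dr c (fun m => b • G m) m = b • D.dr c G m :=
  dress_smul D.bdd (D.isRaising_eP c) b hG m

theorem dr_sub {c : σ → J} {G G' : (σ → ℤ) → Module.End ℂ V} (hG : IsGraded D.q D.T G)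
    (hG' : IsGraded D.q D.T G') (m : σ → ℤ) :
    D.dr c (fun m => G m - G' m) m = D.dr c G m - D.dr c G' m :=
  (((hasLSum_dr hG m).sub (hasLSum_dr hG' m)).congr (fun x => by rw [mul_sub, sub_mul]) rfl).lsum_eq

theorem dr_eq_iff {c : σ → J} {G G' : (σ → ℤ) → Module.End ℂ V} (hG : IsGraded D.q D.T G)
    (hG' : IsGraded D.q D.T G') : (∀ m, D.dr c G m = D.dr c G' m) ↔ ∀ m, G m = G' m := by
  rw [← funext_iff, ← funext_iff]
  exact ⟨dr_injective hG hG', fun h => by rw [h]⟩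

theorem isGraded_tp (hZ : ∀ c n, IsDeg D.q D.T n (Z c n)) (f : PowerSeries ℂ) (c c' : J) :
    IsGraded D.q D.T fun m : Fin 2 → ℤ => tp f (Z c) (Z c') (m 0) (m 1) := fun m =>
  (isDeg_tp D.q_ne D.bdd (hZ c) (hZ c') f _ _).congr (Fin.sum_univ_two m).symm

theorem isGraded_tp_swap (hZ : ∀ c n, IsDeg D.q D.T n (Z c n)) (f : PowerSeries ℂ) (c c' : J) :
    IsGraded D.q D.T fun m : Fin 2 → ℤ => tp f (Z c) (Z c') (m 1) (m 0) := fun m =>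
  (isDeg_tp D.q_ne D.bdd (hZ c) (hZ c') f _ _).congr (by rw [Fin.sum_univ_two, add_comm])

variable (hZ : ∀ c n, IsDeg D.q D.T n (Z c n))
    (hl : ∀ r c n, D.lower r * Z c n = Z c n * D.lower r)
    (hr : ∀ r c n, D.raise r * Z c n = Z c n * D.raise r)

include hZ hl hr

theorem X_mul_X (c c' : J) (m : Fin 2 → ℤ) : D.X Z c (m 0) * D.X Z c' (m 1)
    = D.dr ![c, c'] (fun m => tp (D.F c c') (Z c) (Z c') (m 0) (m 1)) m := by
  have h1 := prod_X hZ hl hr ![c, c'] m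
  have h2 : word D.F Z 2 ![c, c'] = fun m => tp (D.F c c') (Z c) (Z c') (m 0) (m 1) :=
    funext fun m => word_two D.bdd hZ _ _
  rw [← h2, ← h1]
  simp

/-- Injectivity of dressing compares series dressed with one and the same family of colours. The
product in the reverse order is therefore rewritten in the variables of the first order. -/
theorem X_mul_X_swap (c c' : J) (m : Fin 2 → ℤ) : D.X Z c' (m 1) * D.X Z c (m 0)
    = D.dr ![c, c'] (fun m => tp (D.F c' c) (Z c') (Z c) (m 1) (m 0)) m := by
  have h1 := X_mul_X hZ hl hr c' c ![m 1, m 0]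
  have h2 := dr_reindex (Equiv.swap (0 : Fin 2) 1) ![c, c']
    (isGraded_tp hZ (D.F c' c) c' c) m
  have h3 : ![c, c'] ∘ Equiv.swap (0 : Fin 2) 1 = ![c', c] := by
    funext i
    fin_cases i <;> simp
  have h4 : m ∘ Equiv.swap (0 : Fin 2) 1 = ![m 1, m 0] := by
    funext i
    fin_cases i <;> simp
  rw [h3, h4] at h2
  exact (h1.trans h2).trans (by simp)

-- The shift `δ` has total 0, so the shifted families have the same degrees and dressing commutes
-- with the shift.
omit hZ hl hr in
theorem dr_quadratic_iff {c : Fin 2 → J} {G G' : (Fin 2 → ℤ) → Module.End ℂ V}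
    (hG : IsGraded D.q D.T G) (hG' : IsGraded D.q D.T G') (x y : ℂ) (δ : Fin 2 → ℤ)
    (hδ : ∑ i, δ i = 0) :
    (∀ m, x • D.dr c G m - y • D.dr c G (fun i => m i + δ i)
      = (x * y) • D.dr c G' m - D.dr c G' fun i => m i + δ i) ↔
    ∀ m, x • G m - y • G (fun i => m i + δ i) = (x * y) • G' m - G' fun i => m i + δ i := by
  have h1 (m : Fin 2 → ℤ) : ∑ i, (m i + δ i) = ∑ i, m i := by
    rw [Finset.sum_add_distrib, hδ, add_zero]
  have hGδ : IsGraded D.q D.T fun m => G fun i => m i + δ i := fun m => (hG _).congr (h1 m)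
  have hGδ' : IsGraded D.q D.T fun m => G' fun i => m i + δ i := fun m => (hG' _).congr (h1 m)
  rw [← dr_eq_iff (c := c) (D := D)
    (G := fun m => x • G m - y • G fun i => m i + δ i)
    (G' := fun m => (x * y) • G' m - G' fun i => m i + δ i)
    (fun m => ((hG m).smul x).sub ((hGδ m).smul y))
    (fun m => ((hG' m).smul _).sub (hGδ' m))]
  refine forall_congr' fun m => ?_
  rw [dr_sub (G := fun m => x • G m) (fun m => (hG m).smul x) (fun m => (hGδ m).smul y),
    dr_smul _ hG, dr_smul _ hGδ, dr_shift,
    dr_sub (G := fun m => (x * y) • G' m) (fun m => (hG' m).smul _) hGδ', dr_smul _ hG', dr_shift]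

/-- The quadratic relation between two dressed currents is equivalent to a relation between the
two-point functions of the bare currents. -/
theorem quadratic_iff (c c' : J) {x : ℂ} (y : ℂ) (hx : x ≠ 0) :
    (∀ r s, x • (D.X Z c (r + 1) * D.X Z c' s) - y • (D.X Z c r * D.X Z c' (s + 1))
      = (x * y) • (D.X Z c' s * D.X Z c (r + 1)) - D.X Z c' (s + 1) * D.X Z c r) ↔
    ∀ r s, tp ((1 - PowerSeries.C (x⁻¹ * y) * PowerSeries.X) * D.F c c') (Z c) (Z c') (r + 1) s
      = -x⁻¹ • tp ((1 - PowerSeries.C (x * y) * PowerSeries.X) * D.F c' c) (Z c') (Z c)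
        (s + 1) r := by
  -- The leading mode `r + 1` is taken as `m 0`; the other term of the relation is then the shift of
  -- `m` by `(-1, 1)`.
  have hpair (P : ℤ → ℤ → Prop) : (∀ r s, P r s) ↔ ∀ m : Fin 2 → ℤ, P (m 0 - 1) (m 1) :=
    ⟨fun h m => h _ _, fun h r s => by simpa using h ![r + 1, s]⟩
  have hm (m : Fin 2 → ℤ) : (m 0 - 1 = m 0 + ![(-1 : ℤ), 1] 0) ∧ m 1 + 1 = m 1 + ![(-1 : ℤ), 1] 1 :=
    ⟨by simp [sub_eq_add_neg], by simp⟩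
  rw [hpair fun r s => x • (D.X Z c (r + 1) * D.X Z c' s) - y • (D.X Z c r * D.X Z c' (s + 1))
      = (x * y) • (D.X Z c' s * D.X Z c (r + 1)) - D.X Z c' (s + 1) * D.X Z c r]
  rw [hpair fun r s =>
    tp ((1 - PowerSeries.C (x⁻¹ * y) * PowerSeries.X) * D.F c c') (Z c) (Z c') (r + 1) s
      = -x⁻¹ • tp ((1 - PowerSeries.C (x * y) * PowerSeries.X) * D.F c' c) (Z c') (Z c) (s + 1) r]
  have h1 : (∀ m : Fin 2 → ℤ, x • (D.X Z c (m 0 - 1 + 1) * D.X Z c' (m 1))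
        - y • (D.X Z c (m 0 - 1) * D.X Z c' (m 1 + 1))
      = (x * y) • (D.X Z c' (m 1) * D.X Z c (m 0 - 1 + 1))
        - D.X Z c' (m 1 + 1) * D.X Z c (m 0 - 1)) ↔ _ :=
    Iff.trans (forall_congr' fun m => by
      rw [sub_add_cancel, (hm m).1, (hm m).2, X_mul_X hZ hl hr c c' m,
        X_mul_X hZ hl hr c c' fun i => m i + ![(-1 : ℤ), 1] i,
        X_mul_X_swap hZ hl hr c c' m, X_mul_X_swap hZ hl hr c c' fun i => m i + ![(-1 : ℤ), 1] i])
      (dr_quadratic_iff (isGraded_tp hZ (D.F c c') c c') (isGraded_tp_swap hZ (D.F c' c) c' c) x y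
        ![-1, 1] (by simp [Fin.sum_univ_two]))
  refine h1.trans (forall_congr' fun m => ?_)
  beta_reduce
  rw [tp_one_sub_mul D.bdd (hZ c'), tp_one_sub_mul D.bdd (hZ c), sub_add_cancel, ← (hm m).1,
    ← (hm m).2, add_sub_cancel_right]
  generalize tp (D.F c c') (Z c) (Z c') (m 0) (m 1) = A₁
  generalize tp (D.F c c') (Z c) (Z c') (m 0 - 1) (m 1 + 1) = A₂
  generalize tp (D.F c' c) (Z c') (Z c) (m 1) (m 0) = A₃
  generalize tp (D.F c' c) (Z c') (Z c) (m 1 + 1) (m 0 - 1) = A₄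
  -- The relation of the currents is `x` times the relation of the two-point functions.
  rw [← (smul_right_injective (Module.End ℂ V) hx).eq_iff (a := A₁ - (x⁻¹ * y) • A₂)]
  simp only [smul_sub, smul_smul, neg_mul, neg_smul, smul_neg, mul_inv_cancel_left₀ hx,
    mul_inv_cancel₀ hx, one_smul]
  rw [sub_neg_eq_add, neg_add_eq_sub]

end Dressing

end

noncomputable section

/-! ## The Serre relations and the delta function relation -/

/-- The bijection between the positions in a word of the Serre expression and its variables. -/
def serreEquiv {a : ℕ} (σ : Equiv.Perm (Fin a)) (r : Fin (a + 1)) : Fin (a + 1) ≃ Option (Fin a) :=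
  (finSuccEquiv' r).trans (Equiv.optionCongr σ)

theorem insertNth_eq_serreEquiv {α : Type*} {a : ℕ} (σ : Equiv.Perm (Fin a)) (r : Fin (a + 1))
    (x : α) (f : Fin a → α) :
    (Fin.insertNth r x fun p => f (σ p) : Fin (a + 1) → α)
      = fun p => (serreEquiv σ r p).elim x f := by
  funext p
  refine Fin.succAboveCases r ?_ (fun p => ?_) p <;> simp [serreEquiv]

namespace Dressing

variable {V J R : Type*} [AddCommGroup V] [Module ℂ V] [CommRing R] [Algebra ℂ R]
  {D : Dressing V J R} {Z : J → ℤ → Module.End ℂ V}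

/-- The monomials differ in the order of their factors. Indexing the variables by `Option (Fin a)`,
with `none` for the factor of colour `j`, makes all of them dressings with the same colours; the
whole Serre sum is then one dressing, and injectivity applies. -/
theorem serre_iff (hZ : ∀ c n, IsDeg D.q D.T n (Z c n))
    (hl : ∀ r c n, D.lower r * Z c n = Z c n * D.lower r)
    (hr : ∀ r c n, D.raise r * Z c n = Z c n * D.raise r)
    {I : Type*} (Dt : Datum I) (φ : I → J) (i j : I) :
    (∀ n t, serreSum Dt (fun c m => (List.ofFn fun p => D.X Z (φ (c p)) (m p)).prod) i j n t = 0) ↔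
    ∀ n t, serreSum Dt (fun {L} c m => word (fun i j => D.F (φ i) (φ j)) (fun i => Z (φ i)) L c m)
      i j n t = 0 := by
  set a := Dt.serreOrder i j
  let col : Option (Fin a) → J := fun o => φ (o.elim j fun _ => i)
  let S := Equiv.Perm (Fin a) × Fin (a + 1)
  let b : S → ℂ := fun x => (-1) ^ (x.2 : ℕ) * qBinom (Dt.qi i) a x.2
  let G : S → (Option (Fin a) → ℤ) → Module.End ℂ V := fun x m =>
    word D.F Z (a + 1) (col ∘ serreEquiv x.1 x.2) (m ∘ serreEquiv x.1 x.2)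
  have hG (x : S) : IsGraded D.q D.T (G x) := fun m =>
    (isGraded_word D.q_ne D.bdd hZ _ _).congr (Equiv.sum_comp (serreEquiv x.1 x.2) m)
  have e1 (n : Fin a → ℤ) (t : ℤ) :
      serreSum Dt (fun c m => (List.ofFn fun p => D.X Z (φ (c p)) (m p)).prod) i j n t
      = D.dr col (fun m => ∑ x, b x • G x m) fun o => o.elim t n := by
    rw [dr_sum _ _ _ hG, serreSum, ← Fintype.sum_prod_type']
    refine Finset.sum_congr rfl fun x _ => ?_
    change b x • _ = _
    congr 1
    rw [insertNth_eq_serreEquiv x.1 x.2 t n, insertNth_eq_serreEquiv x.1 x.2 j fun _ => i]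
    have h1 := prod_X hZ hl hr (col ∘ serreEquiv x.1 x.2)
      ((fun o => Option.elim o t n) ∘ serreEquiv x.1 x.2)
    exact h1.trans (dr_reindex (serreEquiv x.1 x.2) col
      (isGraded_word D.q_ne D.bdd hZ (col ∘ serreEquiv x.1 x.2)) _)
  have e2 (n : Fin a → ℤ) (t : ℤ) :
      serreSum Dt (fun {L} c m => word (fun i j => D.F (φ i) (φ j)) (fun i => Z (φ i)) L c m) i j n t
      = ∑ x, b x • G x fun o => o.elim t n := by
    rw [serreSum, ← Fintype.sum_prod_type']
    refine Finset.sum_congr rfl fun x _ => ?_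
    change b x • _ = _
    congr 1
    rw [insertNth_eq_serreEquiv x.1 x.2 t n, insertNth_eq_serreEquiv x.1 x.2 j fun _ => i]
    exact (word_comp φ D.F Z _ _).symm
  have e3 (P : (Option (Fin a) → ℤ) → Prop) :
      (∀ (n : Fin a → ℤ) (t : ℤ), P fun o => o.elim t n) ↔ ∀ m, P m := by
    refine ⟨fun h m => ?_, fun h n t => h _⟩
    have := h (fun p => m (some p)) (m none)
    convert this using 1
    funext o
    cases o <;> rfl
  simp only [e1, e2]
  rw [e3 fun m => D.dr col (fun m => ∑ x, b x • G x m) m = 0, e3 fun m => ∑ x, b x • G x m = 0]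
  have h0 : ∀ m, D.dr col (fun _ => 0) m = 0 := fun m => by
    have := dr_smul (c := col) (D := D) (G := fun _ => 0) 0 (fun _ => IsDeg.zero) m
    simpa using this
  rw [← dr_eq_iff (c := col) (D := D) (fun m => IsDeg.sum _ fun x _ => (hG x m).smul _)
    (G' := fun _ => 0) fun _ => IsDeg.zero]
  exact forall_congr' fun m => by rw [h0]

/-- The family to be dressed is `K δ(η w/z)`, supported at `z = η w`. Substituting this value turns
the exponentials in two variables into exponentials in one: lowering coefficients of the first
colour are multiplied by powers of `η`, raising ones by powers of `η⁻¹`. -/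
theorem hasLSum_dr_delta (c c' : J) {η : ℂ} (hη : η ≠ 0) {K : Module.End ℂ V}
    (hK : IsDeg D.q D.T 0 K) (m : Fin 2 → ℤ) :
    HasLSum (fun k : ℕ × ℕ => if m 0 + m 1 + k.1 - k.2 = 0 then η ^ m 0 •
      (D.lower (∑ x ∈ antidiagonal k.1, (η ^ x.1 • D.em c x.1) * D.em c' x.2) * K *
        D.raise (∑ x ∈ antidiagonal k.2, (η⁻¹ ^ x.1 • D.ep c x.1) * D.ep c' x.2)) else 0)
      (D.dr ![c, c'] (fun m => if m 0 + m 1 = 0 then η ^ m 0 • K else 0) m) := by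
  have hG : IsGraded D.q D.T fun m : Fin 2 → ℤ => if m 0 + m 1 = 0 then η ^ m 0 • K else 0 := by
    intro m
    beta_reduce
    split_ifs with h
    · exact (hK.smul _).congr (by rw [Fin.sum_univ_two, h])
    · exact IsDeg.zero
  have h1 := (hasLSum_dr (c := ![c, c']) hG m).fiber_param (κ := ℕ × ℕ)
    (fun x => (x.1 0 + x.1 1, x.2 0 + x.2 1))
    (fun k => antidiagonal k.1 ×ˢ antidiagonal k.2)
    (fun _ y => (![y.1.1, y.1.2], ![y.2.1, y.2.2]))
    (fun k y _ y' _ h => by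
      simp only [Prod.mk.injEq] at h
      have h1 := congrFun h.1
      have h2 := congrFun h.2
      ext
      · exact h1 0
      · exact h1 1
      · exact h2 0
      · exact h2 1)
    (fun k y hy => by
      simp only [Finset.mem_product, mem_antidiagonal] at hy
      ext
      · exact hy.1
      · exact hy.2)
    (fun x => ⟨((x.1 0, x.1 1), (x.2 0, x.2 1)), by simp, by
      ext i
      · fin_cases i <;> rfl
      · fin_cases i <;> rfl⟩)
  refine h1.congr (fun k => ?_) rfl
  split_ifs with hk
  · rw [map_sum, map_sum, Finset.sum_mul, Finset.sum_mul_sum, ← Finset.sum_product',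
      Finset.smul_sum]
    refine Finset.sum_congr rfl fun y hy => ?_
    simp only [Finset.mem_product, mem_antidiagonal] at hy
    have h2 : m 0 + ((y.1.1 : ℕ) : ℤ) - (y.2.1 : ℕ) + (m 1 + (y.1.2 : ℕ) - (y.2.2 : ℕ)) = 0 := by
      rw [← hk, ← hy.1, ← hy.2]
      push_cast
      ring
    simp only [eM, eP, Fin.prod_univ_two, Matrix.cons_val_zero, Matrix.cons_val_one, map_mul,
      map_smul, h2, if_true, smul_mul_assoc, mul_smul_comm, smul_smul]
    congr 1
    rw [zpow_sub₀ hη, zpow_add₀ hη, zpow_natCast, zpow_natCast, inv_pow]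
    field_simp
  · symm
    refine Finset.sum_eq_zero fun y hy => ?_
    simp only [Finset.mem_product, mem_antidiagonal] at hy
    have h2 : ¬ m 0 + ((y.1.1 : ℕ) : ℤ) - (y.2.1 : ℕ) + (m 1 + (y.1.2 : ℕ) - (y.2.2 : ℕ)) = 0 := by
      intro hc
      apply hk
      rw [← hc, ← hy.1, ← hy.2]
      push_cast
      ring
    simp only [Matrix.cons_val_zero, Matrix.cons_val_one, h2, if_false, mul_zero, zero_mul]

end Dressing

theorem sum_antidiagonal_smul_expCoeff {R : Type*} [CommRing R] [Algebra ℂ R]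
    (η : ℂ) (c c' : ℕ → ℂ) (x : ℕ → R) (n : ℕ) :
    ∑ p ∈ antidiagonal n, (η ^ p.1 • expCoeff (fun m => c m • x m) p.1)
        * expCoeff (fun m => c' m • x m) p.2
      = expCoeff (fun m => (η ^ (m + 1) * c m + c' m) • x m) n := by
  simp_rw [add_smul, mul_smul]
  rw [expCoeff_add]
  refine Finset.sum_congr rfl fun p _ => ?_
  rw [expCoeff_smul η (fun m => c m • x m)]

theorem expCoeff_zero_smul {R : Type*} [CommRing R] [Algebra ℂ R]
    {c : ℕ → ℂ} (hc : ∀ m, c m = 0) (x : ℕ → R) (n : ℕ) :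
    expCoeff (fun m => c m • x m) n = if n = 0 then 1 else 0 := by
  simp_rw [hc, zero_smul]
  exact expCoeff_zero_fun n

namespace IsHeis

variable {I V : Type*} [AddCommGroup V] [Module ℂ V] {D : Datum I} {γ : ℂ} {T : Module.End ℂ V}
  {a : I → NZ → Module.End ℂ V} (h : IsHeis D γ T a)

include h

theorem lower_commute {A : Module.End ℂ V} (hA : ∀ i l, a i l * A = A * a i l)
    (r : MvPolynomial (I × ℕ) ℂ) : h.lower r * A = A * h.lower r := by
  induction r using MvPolynomial.induction_on with
  | C r =>
    rw [← MvPolynomial.algebraMap_eq, AlgHom.commutes, Algebra.commutes]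
  | add f g hf hg => rw [map_add, add_mul, hf, hg, mul_add]
  | mul_X f x hf => rw [map_mul, mul_assoc, h.lower_X, hA, ← mul_assoc, hf, mul_assoc]

theorem raise_commute {A : Module.End ℂ V} (hA : ∀ i l, a i l * A = A * a i l)
    (r : MvPolynomial (I × ℕ) ℂ) : h.raise r * A = A * h.raise r := by
  induction r using MvPolynomial.induction_on with
  | C r =>
    rw [← MvPolynomial.algebraMap_eq, AlgHom.commutes, Algebra.commutes]
  | add f g hf hg => rw [map_add, add_mul, hf, hg, mul_add]
  | mul_X f x hf => rw [map_mul, mul_assoc, h.raise_X, hA, ← mul_assoc, hf, mul_assoc]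

/-- The coefficient of the delta function `δ(q^k w/z)`. -/
theorem dr_delta_pos (i : I) {K : Module.End ℂ V} (hK : IsDeg D.q T 0 K) 
    (m : Fin 2 → ℤ) : h.dressing.dr ![(i, true), (i, false)]
        (fun m => if m 0 + m 1 = 0 then (γ ^ 2) ^ m 0 • K else 0) m
      = if m 0 + m 1 < 0 then 0 else γ ^ (m 0 - m 1) •
        (K * expCoeff (fun p => (D.q - D.q⁻¹) • a i (pos p)) (m 0 + m 1).natAbs) := by
  have hη : γ ^ 2 ≠ 0 := pow_ne_zero _ h.good.γ_ne
  have h1 := Dressing.hasLSum_dr_delta (D := h.dressing) (i, true) (i, false) hη hK m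
  -- At `z = q^k w` the lowering exponents of `X^+` and `X^-` are opposite, so only the term of
  -- order 0 remains.
  have hA (n : ℕ) : h.lower (∑ x ∈ antidiagonal n, ((γ ^ 2) ^ x.1 •
      h.dressing.em (i, true) x.1) * h.dressing.em (i, false) x.2) = if n = 0 then 1 else 0 := by
    have := sum_antidiagonal_smul_expCoeff (γ ^ 2) (cm D γ true) (cm D γ false)
      (fun m => MvPolynomial.X (R := ℂ) (i, m)) n
    change h.lower (∑ p ∈ antidiagonal n, _) = _
    refine (congrArg h.lower this).trans ?_
    rw [expCoeff_zero_smul]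
    · split_ifs <;> simp
    · intro m
      have h2 : (γ ^ 2) ^ (m + 1) * γ ^ (-((m : ℤ) + 1)) = γ ^ ((m : ℤ) + 1) := by
        rw [← zpow_natCast, ← zpow_natCast, ← zpow_mul, ← zpow_add₀ h.good.γ_ne]
        push_cast
        ring_nf
      simp only [cm, sg, neg_one_mul, one_mul, ← mul_assoc, h2]
      push_cast
      ring
  -- The raising exponents add up; the difference of powers of `γ` is the numerator of `[kn]`, which
  -- cancels the denominator and leaves `q - q⁻¹`, the exponent of `Φ^+`.
  have hB (n : ℕ) : h.raise (∑ x ∈ antidiagonal n, ((γ ^ 2)⁻¹ ^ x.1 •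
      h.dressing.ep (i, true) x.1) * h.dressing.ep (i, false) x.2)
      = γ⁻¹ ^ n • expCoeff (fun p => (D.q - D.q⁻¹) • a i (pos p)) n := by
    have := sum_antidiagonal_smul_expCoeff (γ ^ 2)⁻¹ (cp D γ true) (cp D γ false)
      (fun m => MvPolynomial.X (R := ℂ) (i, m)) n
    refine (congrArg h.raise this).trans ?_
    rw [h.raise_expCoeff, ← expCoeff_smul]
    congr 1
    funext m
    rw [smul_smul]
    congr 1
    have h3 := h.good.levelInt_ne m
    have h4 : (D.q - D.q⁻¹) * levelInt D.q γ (m + 1)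
        = γ ^ (2 * ((m : ℤ) + 1)) - γ ^ (-(2 * ((m : ℤ) + 1))) := by
      rw [levelInt, mul_div_cancel₀ _ h.good.q_sub_ne]
    have h5 : γ⁻¹ ^ (m + 1) * (D.q - D.q⁻¹) * levelInt D.q γ (m + 1)
        = γ ^ ((m : ℤ) + 1) - (γ ^ 2)⁻¹ ^ (m + 1) * γ ^ (-((m : ℤ) + 1)) := by
      rw [mul_assoc, h4, mul_sub, ← zpow_natCast, ← zpow_natCast, inv_zpow', inv_zpow',
        ← zpow_natCast γ 2, ← zpow_mul, ← zpow_add₀ h.good.γ_ne, ← zpow_add₀ h.good.γ_ne,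
        ← zpow_add₀ h.good.γ_ne]
      push_cast
      ring_nf
    simp only [cp, sg, neg_one_mul, one_mul]
    push_cast
    rw [mul_div_assoc', mul_div_assoc', mul_div_assoc', ← add_div, div_eq_iff h3, h5]
    ring
  change HasLSum (fun k : ℕ × ℕ => if m 0 + m 1 + k.1 - k.2 = 0 then (γ ^ 2) ^ m 0 •
      (h.lower _ * K * h.raise _) else 0) _ at h1
  simp only [hA, hB] at h1
  split_ifs with hm
  · refine h1.unique (HasLSum.zero.congr (fun k => ?_) rfl)
    by_cases hk : k.1 = 0
    · rw [if_neg (by omega)]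
    · simp [hk]
  · obtain ⟨n, hn⟩ := Int.eq_ofNat_of_zero_le (not_lt.mp hm)
    refine h1.unique ((HasLSum.of_single ((0, n) : ℕ × ℕ) fun k hk => ?_).congr (fun _ => rfl) ?_)
    · by_cases hk1 : k.1 = 0
      · rw [if_neg fun hc => hk (Prod.ext hk1 (by simp; omega))]
      · simp [hk1]
    · simp only [hn, Int.natAbs_natCast, Nat.cast_zero, add_zero, sub_self, if_true, one_mul,
        mul_smul_comm, smul_smul]
      congr 1
      rw [← zpow_natCast γ 2, ← zpow_mul, ← zpow_natCast γ⁻¹ n, inv_zpow', ← hn,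
        ← zpow_add₀ h.good.γ_ne]
      push_cast
      ring_nf

/-- The coefficient of the delta function `δ(q^{-k} w/z)`. -/
theorem dr_delta_neg (i : I) {K : Module.End ℂ V} (hK : IsDeg D.q T 0 K)
    (hKa : ∀ j l, a j l * K = K * a j l) (m : Fin 2 → ℤ) :
    h.dressing.dr ![(i, true), (i, false)]
        (fun m => if m 0 + m 1 = 0 then ((γ ^ 2)⁻¹) ^ m 0 • K else 0) m
      = if 0 < m 0 + m 1 then 0 else γ ^ (m 1 - m 0) •
        (K * expCoeff (fun p => (-(D.q - D.q⁻¹)) • a i (neg p)) (m 0 + m 1).natAbs) := by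
  have hη : (γ ^ 2)⁻¹ ≠ 0 := inv_ne_zero (pow_ne_zero _ h.good.γ_ne)
  have h1 := Dressing.hasLSum_dr_delta (D := h.dressing) (i, true) (i, false) hη hK m
  -- At `z = q^{-k} w` the roles are exchanged: the raising exponentials cancel, and the lowering
  -- ones give `Φ^-`.
  have hA (n : ℕ) : h.raise (∑ x ∈ antidiagonal n, ((γ ^ 2)⁻¹⁻¹ ^ x.1 •
      h.dressing.ep (i, true) x.1) * h.dressing.ep (i, false) x.2) = if n = 0 then 1 else 0 := by
    have := sum_antidiagonal_smul_expCoeff (γ ^ 2)⁻¹⁻¹ (cp D γ true) (cp D γ false)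
      (fun m => MvPolynomial.X (R := ℂ) (i, m)) n
    refine (congrArg h.raise this).trans ?_
    rw [expCoeff_zero_smul]
    · split_ifs <;> simp
    · intro m
      have h2 : (γ ^ 2) ^ (m + 1) * γ ^ (-((m : ℤ) + 1)) = γ ^ ((m : ℤ) + 1) := by
        rw [← zpow_natCast, ← zpow_natCast, ← zpow_mul, ← zpow_add₀ h.good.γ_ne]
        push_cast
        ring_nf
      simp only [cp, sg, neg_one_mul, one_mul, ← mul_assoc, h2, inv_inv]
      push_cast
      ring
  have hB (n : ℕ) : h.lower (∑ x ∈ antidiagonal n, ((γ ^ 2)⁻¹ ^ x.1 •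
      h.dressing.em (i, true) x.1) * h.dressing.em (i, false) x.2)
      = γ⁻¹ ^ n • expCoeff (fun p => (-(D.q - D.q⁻¹)) • a i (neg p)) n := by
    have := sum_antidiagonal_smul_expCoeff (γ ^ 2)⁻¹ (cm D γ true) (cm D γ false)
      (fun m => MvPolynomial.X (R := ℂ) (i, m)) n
    refine (congrArg h.lower this).trans ?_
    rw [h.lower_expCoeff, ← expCoeff_smul]
    congr 1
    funext m
    rw [smul_smul]
    congr 1
    have h3 := h.good.levelInt_ne m
    have h4 : (D.q - D.q⁻¹) * levelInt D.q γ (m + 1)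
        = γ ^ (2 * ((m : ℤ) + 1)) - γ ^ (-(2 * ((m : ℤ) + 1))) := by
      rw [levelInt, mul_div_cancel₀ _ h.good.q_sub_ne]
    have h5 : γ⁻¹ ^ (m + 1) * (D.q - D.q⁻¹) * levelInt D.q γ (m + 1)
        = γ ^ ((m : ℤ) + 1) - (γ ^ 2)⁻¹ ^ (m + 1) * γ ^ (-((m : ℤ) + 1)) := by
      rw [mul_assoc, h4, mul_sub, ← zpow_natCast, ← zpow_natCast, inv_zpow', inv_zpow',
        ← zpow_natCast γ 2, ← zpow_mul, ← zpow_add₀ h.good.γ_ne, ← zpow_add₀ h.good.γ_ne,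
        ← zpow_add₀ h.good.γ_ne]
      push_cast
      ring_nf
    simp only [cm, sg, neg_one_mul, one_mul]
    push_cast
    rw [mul_div_assoc', mul_div_assoc', mul_div_assoc', ← add_div, div_eq_iff h3, mul_neg _ (D.q - D.q⁻¹), neg_mul, h5]
    ring
  change HasLSum (fun k : ℕ × ℕ => if m 0 + m 1 + k.1 - k.2 = 0 then ((γ ^ 2)⁻¹) ^ m 0 •
      (h.lower _ * K * h.raise _) else 0) _ at h1
  simp only [hA, hB] at h1
  split_ifs with hm
  · refine h1.unique (HasLSum.zero.congr (fun k => ?_) rfl)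
    by_cases hk : k.2 = 0
    · rw [if_neg (by omega)]
    · simp [hk]
  · obtain ⟨n, hn⟩ := Int.eq_ofNat_of_zero_le (neg_nonneg.mpr (not_lt.mp hm))
    have hn' : m 0 + m 1 = -(n : ℤ) := by rw [← hn, neg_neg]
    refine h1.unique ((HasLSum.of_single ((n, 0) : ℕ × ℕ) fun k hk => ?_).congr (fun _ => rfl) ?_)
    · by_cases hk1 : k.2 = 0
      · rw [if_neg fun hc => hk (Prod.ext (by simp; omega) hk1)]
      · simp [hk1]
    -- The surviving exponential stands to the left of `K`, so here `K` has to commute with the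
    -- Heisenberg operators.
    · have h6 : expCoeff (fun p => (-(D.q - D.q⁻¹)) • a i (neg p)) n * K
          = K * expCoeff (fun p => (-(D.q - D.q⁻¹)) • a i (neg p)) n := by
        rw [← h.lower_expCoeff, h.lower_commute hKa]
      simp only [hn', Int.natAbs_neg, Int.natAbs_natCast, Nat.cast_zero, neg_add_cancel, sub_zero,
        if_true, mul_one, smul_mul_assoc, smul_smul, h6]
      congr 1
      have h7 : (n : ℤ) = -(m 0 + m 1) := hn.symm
      rw [← zpow_natCast γ 2, inv_zpow', ← zpow_mul, ← zpow_natCast γ⁻¹ n, inv_zpow', h7,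
        ← zpow_add₀ h.good.γ_ne]
      push_cast
      ring_nf

end IsHeis

end

noncomputable section

/-! ## Relations between dressed currents -/

namespace IsHeis

variable {I V : Type*} [AddCommGroup V] [Module ℂ V] {D : Datum I} {γ : ℂ} {T : Module.End ℂ V}
  {a : I → NZ → Module.End ℂ V} (h : IsHeis D γ T a)

include h

/-- The operator `a_{i,m+1}` acts as a derivation on the lowering exponential, has a given bracket
with `Z` and commutes with the raising exponential. The term from the lowering exponential is the
same sum with its first index shifted. The parameter `z` is 0 for dressing; for undressing it
cancels the scalar from the exponential. -/
theorem a_pos_commutator {c c' : ℕ → ℂ} {j : I} {Z S : ℤ → Module.End ℂ V}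
    (hS : ∀ n, HasLSum (fun x : ℕ × ℕ => expCoeff (fun m => c m • a j (neg m)) x.1
      * Z (n + x.1 - x.2) * expCoeff (fun m => c' m • a j (pos m)) x.2) (S n))
    (i : I) (m : ℕ) {z : ℂ}
    (hz : ∀ n, a i (pos m) * Z n = Z n * a i (pos m) + z • Z (n + (m + 1))) (n : ℤ) :
    a i (pos m) * S n
      = S n * a i (pos m) + (c m * D.w γ i j (m + 1) + z) • S (n + (m + 1)) := by
  have h1 : HasLSum (fun x : ℕ × ℕ => if m + 1 ≤ x.1 then
      expCoeff (fun m => c m • a j (neg m)) (x.1 - (m + 1))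
      * Z (n + x.1 - x.2) * expCoeff (fun m => c' m • a j (pos m)) x.2 else 0)
      (S (n + (m + 1))) := by
    refine (hS (n + (m + 1))).embed
      ⟨fun x => (x.1 + (m + 1), x.2), fun x y hxy => by simpa [Prod.ext_iff] using hxy⟩ (fun x => ?_)
      fun x hx => if_neg fun hc => hx (x.1 - (m + 1), x.2) (Prod.ext (Nat.sub_add_cancel hc) rfl)
    change (if m + 1 ≤ x.1 + (m + 1) then
      expCoeff (fun m => c m • a j (neg m)) (x.1 + (m + 1) - (m + 1))
      * Z (n + (x.1 + (m + 1) : ℕ) - x.2) * expCoeff (fun m => c' m • a j (pos m)) x.2 else 0) = _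
    rw [if_pos (Nat.le_add_left _ _), Nat.add_sub_cancel]
    congr 3
    push_cast
    ring
  rw [add_smul]
  refine ((hS n).mul_left _).unique (((((hS n).mul_right _).add
    ((h1.smul (c m * D.w γ i j (m + 1))).add ((hS (n + (m + 1))).smul z)))).congr (fun x => ?_) rfl)
  rw [← mul_assoc, ← mul_assoc, h.a_pos_mul_expNeg, add_mul, add_mul, mul_assoc _ (a i (pos m)), hz,
    mul_assoc _ _ (a i (pos m)), ← h.a_pos_mul_expPos, mul_add, add_mul]
  have h2 : n + (x.1 : ℤ) - x.2 + (m + 1) = n + (m + 1) + x.1 - x.2 := by ring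
  rw [h2]
  split_ifs <;> simp only [zero_mul, smul_zero, smul_mul_assoc, mul_smul_comm, mul_assoc] <;> abel

theorem a_neg_commutator {c c' : ℕ → ℂ} {j : I} {Z S : ℤ → Module.End ℂ V}
    (hS : ∀ n, HasLSum (fun x : ℕ × ℕ => expCoeff (fun m => c m • a j (neg m)) x.1
      * Z (n + x.1 - x.2) * expCoeff (fun m => c' m • a j (pos m)) x.2) (S n))
    (i : I) (m : ℕ) {z : ℂ}
    (hz : ∀ n, a i (neg m) * Z n = Z n * a i (neg m) + z • Z (n - (m + 1))) (n : ℤ) :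
    a i (neg m) * S n
      = S n * a i (neg m) + (c' m * D.w γ i j (-(m + 1)) + z) • S (n - (m + 1)) := by
  have h1 : HasLSum (fun x : ℕ × ℕ => if m + 1 ≤ x.2 then
      expCoeff (fun m => c m • a j (neg m)) x.1
      * Z (n + x.1 - x.2) * expCoeff (fun m => c' m • a j (pos m)) (x.2 - (m + 1)) else 0)
      (S (n - (m + 1))) := by
    refine (hS (n - (m + 1))).embed
      ⟨fun x => (x.1, x.2 + (m + 1)), fun x y hxy => by simpa [Prod.ext_iff] using hxy⟩ (fun x => ?_)
      fun x hx => if_neg fun hc => hx (x.1, x.2 - (m + 1)) (Prod.ext rfl (Nat.sub_add_cancel hc))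
    change (if m + 1 ≤ x.2 + (m + 1) then
      expCoeff (fun m => c m • a j (neg m)) x.1
      * Z (n + x.1 - (x.2 + (m + 1) : ℕ)) * expCoeff (fun m => c' m • a j (pos m))
        (x.2 + (m + 1) - (m + 1)) else 0) = _
    rw [if_pos (Nat.le_add_left _ _), Nat.add_sub_cancel]
    congr 3
    push_cast
    ring
  rw [add_smul]
  refine ((hS n).mul_left _).unique (((((hS n).mul_right _).add
    ((h1.smul (c' m * D.w γ i j (-(m + 1)))).add ((hS (n - (m + 1))).smul z)))).congr
      (fun x => ?_) rfl)
  have h2 : n + (x.1 : ℤ) - x.2 - (m + 1) = n - (m + 1) + x.1 - x.2 := by ring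
  rw [← mul_assoc, ← mul_assoc, h.a_neg_mul_expNeg, mul_assoc _ (a i (neg m)), hz, mul_add, add_mul,
    h2, ← mul_assoc _ _ (a i (neg m)), mul_assoc _ (a i (neg m)), h.a_neg_mul_expPos, mul_add]
  split_ifs <;> simp only [mul_zero, smul_zero, smul_mul_assoc, mul_smul_comm, mul_assoc] <;> abel

section

variable {Z : I × Bool → ℤ → Module.End ℂ V} (hZ : ∀ c n, IsDeg D.q T n (Z c n))

include hZ

theorem hasLSum_X (c : I × Bool) (n : ℤ) : HasLSum (fun x : ℕ × ℕ =>
    expCoeff (fun m => cm D γ c.2 m • a c.1 (neg m)) x.1 * Z c (n + x.1 - x.2)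
      * expCoeff (fun m => cp D γ c.2 m • a c.1 (pos m)) x.2) (h.dressing.X Z c n) := by
  refine (Dressing.hasLSum_X (D := h.dressing) hZ c n).congr (fun x => ?_) rfl
  rw [← h.lower_expCoeff, ← h.raise_expCoeff]
  rfl

theorem hasLSum_unX (c : I × Bool) (n : ℤ) : HasLSum (fun x : ℕ × ℕ =>
    expCoeff (fun m => (-cm D γ c.2 m) • a c.1 (neg m)) x.1 * Z c (n + x.1 - x.2)
      * expCoeff (fun m => (-cp D γ c.2 m) • a c.1 (pos m)) x.2) (h.dressing.unX Z c n) := by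
  refine (Dressing.hasLSum_unX (D := h.dressing) hZ c n).congr (fun x => ?_) rfl
  rw [← h.lower_expCoeff, ← h.raise_expCoeff]
  rfl

/-- With `K = k_i` as grading operator, the conjugation relations of `k_i` are degree conditions.
The Heisenberg operators have degree 0, so dressing does not change the degree. -/
theorem isDeg_X_of_commute {K : Module.End ℂ V} (hK : ∀ i l, a i l * K = K * a i l)
    {c : I × Bool} {d : ℤ} (hd : ∀ n, IsDeg D.q K d (Z c n)) (n : ℤ) :
    IsDeg D.q K d (h.dressing.X Z c n) := by
  refine IsDeg.hasLSum (Dressing.hasLSum_X (D := h.dressing) hZ c n) fun x => ?_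
  have h0 : ∀ A, A * K = K * A → IsDeg D.q K 0 A := fun A hA => by rw [IsDeg, zpow_zero, one_smul, hA]
  exact (((h0 _ (h.lower_commute hK _)).mul h.good.q_ne (hd _)).mul h.good.q_ne
    (h0 _ (h.raise_commute hK _))).congr (by ring)

theorem isDeg_unX_of_commute {K : Module.End ℂ V} (hK : ∀ i l, a i l * K = K * a i l)
    {c : I × Bool} {d : ℤ} (hd : ∀ n, IsDeg D.q K d (Z c n)) (n : ℤ) :
    IsDeg D.q K d (h.dressing.unX Z c n) := by
  refine IsDeg.hasLSum (Dressing.hasLSum_unX (D := h.dressing) hZ c n) fun x => ?_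
  have h0 : ∀ A, A * K = K * A → IsDeg D.q K 0 A := fun A hA => by rw [IsDeg, zpow_zero, one_smul, hA]
  exact (((h0 _ (h.lower_commute hK _)).mul h.good.q_ne (hd _)).mul h.good.q_ne
    (h0 _ (h.raise_commute hK _))).congr (by ring)

/-- The dressing turns a family that commutes with the Heisenberg algebra into one with the
commutators of the toroidal algebra, and conversely. -/
theorem a_unX (hp : ∀ i m c n, a i (pos m) * Z c n
      = Z c n * a i (pos m) + (cm D γ c.2 m * D.w γ i c.1 (m + 1)) • Z c (n + (m + 1)))
    (hm : ∀ i m c n, a i (neg m) * Z c n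
      = Z c n * a i (neg m) + (cp D γ c.2 m * D.w γ i c.1 (-(m + 1))) • Z c (n - (m + 1)))
    (i : I) (l : NZ) (c : I × Bool) (n : ℤ) :
    a i l * h.dressing.unX Z c n = h.dressing.unX Z c n * a i l := by
  obtain ⟨l, hl⟩ := l
  rcases lt_or_gt_of_ne hl with h1 | h1
  · have h2 : (⟨l, hl⟩ : NZ) = neg (-l - 1).toNat := Subtype.ext (by simp [neg]; omega)
    have h3 := h.a_neg_commutator (h.hasLSum_unX hZ c) i (-l - 1).toNat
      (fun n => hm i (-l - 1).toNat c n) n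
    rw [h2, h3, neg_mul, neg_add_cancel, zero_smul, add_zero]
  · have h2 : (⟨l, hl⟩ : NZ) = pos (l - 1).toNat := Subtype.ext (by simp [pos]; omega)
    have h3 := h.a_pos_commutator (h.hasLSum_unX hZ c) i (l - 1).toNat
      (fun n => hp i (l - 1).toNat c n) n
    rw [h2, h3, neg_mul, neg_add_cancel, zero_smul, add_zero]

variable (ha : ∀ i l c n, a i l * Z c n = Z c n * a i l)

include ha

theorem a_pos_X (i : I) (m : ℕ) (c : I × Bool) (n : ℤ) :
    a i (pos m) * h.dressing.X Z c n = h.dressing.X Z c n * a i (pos m)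
      + (cm D γ c.2 m * D.w γ i c.1 (m + 1)) • h.dressing.X Z c (n + (m + 1)) := by
  rw [h.a_pos_commutator (h.hasLSum_X hZ c) i m (z := 0) fun n => by rw [ha, zero_smul, add_zero],
    add_zero]

theorem a_neg_X (i : I) (m : ℕ) (c : I × Bool) (n : ℤ) :
    a i (neg m) * h.dressing.X Z c n = h.dressing.X Z c n * a i (neg m)
      + (cp D γ c.2 m * D.w γ i c.1 (-(m + 1))) • h.dressing.X Z c (n - (m + 1)) := by
  rw [h.a_neg_commutator (h.hasLSum_X hZ c) i m (z := 0) fun n => by rw [ha, zero_smul, add_zero],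
    add_zero]

omit hZ in
theorem lower_Z (r : MvPolynomial (I × ℕ) ℂ) (c : I × Bool) (n : ℤ) :
    h.lower r * Z c n = Z c n * h.lower r := h.lower_commute (fun i l => ha i l c n) r

omit hZ in
theorem raise_Z (r : MvPolynomial (I × ℕ) ℂ) (c : I × Bool) (n : ℤ) :
    h.raise r * Z c n = Z c n * h.raise r := h.raise_commute (fun i l => ha i l c n) r

/-- The exchange factors of `X^+` and `X^-` differ, but so do the linear factors of their quadratic
relations. For `X^+` the factor shifts the denominator, for `X^-` the numerator, and the result is
the same quotient. Thus `Z^+` and `Z^-` obey the same relation. -/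
theorem X_X_iff (i j : I) (s : Bool) :
    (∀ r t, D.κ ^ D.M i j • (h.dressing.X Z (i, s) (r + 1) * h.dressing.X Z (j, s) t)
        - D.q ^ (-sg s * D.b i j) • (h.dressing.X Z (i, s) r * h.dressing.X Z (j, s) (t + 1))
      = (D.κ ^ D.M i j * D.q ^ (-sg s * D.b i j)) •
          (h.dressing.X Z (j, s) t * h.dressing.X Z (i, s) (r + 1))
        - h.dressing.X Z (j, s) (t + 1) * h.dressing.X Z (i, s) r) ↔
    ∀ r t, tp (ratio (γ ^ 4) (D.q ^ (-D.b i j) * D.κ ^ (-D.M i j))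
        (γ ^ 4 * D.q ^ D.b i j * D.κ ^ (-D.M i j))) (Z (i, s)) (Z (j, s)) (r + 1) t
      = -(D.κ ^ (-D.M i j)) • tp (ratio (γ ^ 4) (D.q ^ (-D.b i j) * D.κ ^ D.M i j)
        (γ ^ 4 * D.q ^ D.b i j * D.κ ^ D.M i j)) (Z (j, s)) (Z (i, s)) (t + 1) r := by
  rw [Dressing.quadratic_iff (D := h.dressing) hZ (h.lower_Z ha) (h.raise_Z ha) (i, s) (j, s)
    _ (zpow_ne_zero _ h.good.κ_ne), h.F_same, h.F_same, h.good.b_symm j i, h.good.M_antisymm j i,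
    neg_neg, ← zpow_neg]
  have key (y : ℂ) : (1 - PowerSeries.C (y * D.q ^ (-sg s * D.b i j)) * PowerSeries.X)
      * ratio (γ ^ 4) (γ ^ (2 * sg s + 2) * (D.q ^ (-D.b i j) * y))
        (γ ^ (2 * sg s + 2) * (D.q ^ D.b i j * y))
      = ratio (γ ^ 4) (D.q ^ (-D.b i j) * y) (γ ^ 4 * D.q ^ D.b i j * y) := by
    cases s with
    | true =>
      have : 2 * sg true + 2 = 0 := rfl
      rw [this, zpow_zero, one_mul, one_mul, mul_assoc (γ ^ 4),
        ← one_sub_mul_ratio_right h.good.γ_pow_ne]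
      simp [sg, mul_comm]
    | false =>
      have : 2 * sg false + 2 = (4 : ℕ) := rfl
      rw [this, zpow_natCast, mul_assoc (γ ^ 4) (D.q ^ D.b i j),
        ← one_sub_mul_ratio_left h.good.γ_pow_ne (D.q ^ (-D.b i j) * y)]
      simp [sg, mul_comm]
  rw [key, key]

/-- Dressing the `Z`-relation turns its left side into the commutator of the currents by `X_mul_X`
and `X_mul_X_swap`, and the two delta functions into the two halves of the right side by
`dr_delta_pos` and `dr_delta_neg`. -/
theorem mixed_iff [DecidableEq I] (i j : I) {K K' : Module.End ℂ V} (hK : IsDeg D.q T 0 K)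
    (hK' : IsDeg D.q T 0 K') (hKa : ∀ j l, a j l * K' = K' * a j l) :
    (∀ r t, h.dressing.X Z (i, true) r * h.dressing.X Z (j, false) t
        - h.dressing.X Z (j, false) t * h.dressing.X Z (i, true) r
      = if i = j then (D.qi i - (D.qi i)⁻¹)⁻¹ •
        ((if r + t < 0 then 0 else γ ^ (r - t) •
          (K * expCoeff (fun p => (D.q - D.q⁻¹) • a i (pos p)) (r + t).natAbs))
        - if 0 < r + t then 0 else γ ^ (t - r) •
          (K' * expCoeff (fun p => (-(D.q - D.q⁻¹)) • a i (neg p)) (r + t).natAbs)) else 0) ↔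
    ∀ r t, tp (ratio (γ ^ 4) (γ ^ 2 * D.q ^ D.b i j * D.κ ^ (-D.M i j))
        (γ ^ 2 * D.q ^ (-D.b i j) * D.κ ^ (-D.M i j))) (Z (i, true)) (Z (j, false)) r t
      - tp (ratio (γ ^ 4) (γ ^ 2 * D.q ^ D.b i j * D.κ ^ D.M i j)
        (γ ^ 2 * D.q ^ (-D.b i j) * D.κ ^ D.M i j)) (Z (j, false)) (Z (i, true)) t r
      = if i = j ∧ r + t = 0 then (D.qi i - (D.qi i)⁻¹)⁻¹ •
        ((γ ^ 2) ^ r • K - (γ ^ 2) ^ (-r) • K') else 0 := by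
  have hpair (P : ℤ → ℤ → Prop) : (∀ r t, P r t) ↔ ∀ m : Fin 2 → ℤ, P (m 0) (m 1) :=
    ⟨fun h m => h _ _, fun h r s => by simpa using h ![r, s]⟩
  have hF := h.F_ne j i false
  rw [h.good.b_symm j i, h.good.M_antisymm j i, neg_neg, ← mul_assoc, ← mul_assoc] at hF
  have hF' := h.F_ne i j true
  rw [← mul_assoc, ← mul_assoc] at hF'
  rw [Bool.not_false] at hF
  rw [Bool.not_true] at hF'
  rw [← hF, ← hF', hpair]
  rw [hpair fun r t => tp (h.dressing.F (i, true) (j, false)) _ _ r t - _ = _]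
  have hG1 := Dressing.isGraded_tp (D := h.dressing) hZ (h.dressing.F (i, true) (j, false))
    (i, true) (j, false)
  have hG2 := Dressing.isGraded_tp_swap (D := h.dressing) hZ (h.dressing.F (j, false) (i, true))
    (j, false) (i, true)
  have hd (x : ℂ) {K : Module.End ℂ V} (hK : IsDeg D.q T 0 K) : IsGraded D.q T
      fun m : Fin 2 → ℤ => if m 0 + m 1 = 0 then x ^ m 0 • K else 0 := fun m => by
    beta_reduce
    split_ifs with h1
    · exact (hK.smul _).congr (by rw [Fin.sum_univ_two, h1])
    · exact IsDeg.zero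
  have hΔ : ∀ m : Fin 2 → ℤ, (if i = j ∧ m 0 + m 1 = 0 then (D.qi i - (D.qi i)⁻¹)⁻¹ •
        ((γ ^ 2) ^ m 0 • K - (γ ^ 2) ^ (-m 0) • K') else 0)
      = (if i = j then (D.qi i - (D.qi i)⁻¹)⁻¹ else 0) •
        ((if m 0 + m 1 = 0 then (γ ^ 2) ^ m 0 • K else 0)
        - if m 0 + m 1 = 0 then ((γ ^ 2)⁻¹) ^ m 0 • K' else 0) := by
    intro m
    by_cases h1 : i = j <;> by_cases h2 : m 0 + m 1 = 0 <;> simp [h1, h2]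
  simp only [hΔ]
  have hGd : IsGraded D.q T fun m : Fin 2 → ℤ => (if m 0 + m 1 = 0 then (γ ^ 2) ^ m 0 • K else 0)
      - if m 0 + m 1 = 0 then ((γ ^ 2)⁻¹) ^ m 0 • K' else 0 := fun m =>
    (hd (γ ^ 2) hK m).sub (hd (γ ^ 2)⁻¹ hK' m)
  have h1 := Dressing.dr_eq_iff (D := h.dressing) (c := ![(i, true), (j, false)])
    (fun m => (hG1 m).sub (hG2 m))
    (fun m => (hGd m).smul (if i = j then (D.qi i - (D.qi i)⁻¹)⁻¹ else 0))
  refine Iff.trans (forall_congr' fun m => ?_) h1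
  rw [Dressing.dr_sub hG1 hG2, Dressing.dr_smul (D := h.dressing) _ hGd,
    ← Dressing.X_mul_X (D := h.dressing) hZ (h.lower_Z ha) (h.raise_Z ha),
    ← Dressing.X_mul_X_swap (D := h.dressing) hZ (h.lower_Z ha) (h.raise_Z ha)]
  by_cases hij : i = j
  · subst hij
    rw [Dressing.dr_sub (D := h.dressing) (hd _ hK) (hd _ hK'), h.dr_delta_pos i hK, h.dr_delta_neg i hK' hKa,
      if_pos rfl, if_pos rfl]
  · rw [if_neg hij, if_neg hij, zero_smul]

end

end IsHeis

end

noncomputable section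

/-! ## From the `Z`-algebra to toroidal currents and back -/

variable {I V : Type*} [AddCommGroup V] [Module ℂ V]

/-- The operators `Z^+_{i,n}` (colour `(i, true)`) and `Z^-_{i,n}` (colour `(i, false)`). -/
def ZOps.col (ρ : ZOps I V) (c : I × Bool) : ℤ → Module.End ℂ V :=
  match c.2 with
  | true => ρ.Zp c.1
  | false => ρ.Zm c.1

open scoped Classical in
/-- The relations of the quantum toroidal algebra at level `(k, l)`, with `a_{i,n} = [d_i] a^∨_{i,n}`
in place of `a^∨_{i,n}` and the currents `X^±_i` of colours `(i, true)` and `(i, false)`. -/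
structure IsCurrentModule [Fintype I] (D : Datum I) (γ ζ : ℂ) (k : I → (Module.End ℂ V)ˣ)
    (qd : (Module.End ℂ V)ˣ) (a : I → NZ → Module.End ℂ V) (X : I × Bool → ℤ → Module.End ℂ V) :
    Prop where
  heis : IsHeis D γ (qd : Module.End ℂ V) a
  restricted : IsRestricted D.q (qd : Module.End ℂ V)
  k_k : ∀ i j, k i * k j = k j * k i
  qd_k : ∀ i, qd * k i = k i * qd
  level_k : (Finset.univ.toList.map fun i => (k i : Module.End ℂ V) ^ D.lab i).prod = ζ • 1
  a_k : ∀ i j l, a i l * k j = k j * a i l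
  deg : ∀ c n, IsDeg D.q (qd : Module.End ℂ V) n (X c n)
  k_X : ∀ i j s n, IsDeg D.q (k i : Module.End ℂ V) (-sg s * D.b i j) (X (j, s) n)
  a_pos_X : ∀ i m c n, a i (pos m) * X c n
    = X c n * a i (pos m) + (cm D γ c.2 m * D.w γ i c.1 (m + 1)) • X c (n + (m + 1))
  a_neg_X : ∀ i m c n, a i (neg m) * X c n
    = X c n * a i (neg m) + (cp D γ c.2 m * D.w γ i c.1 (-(m + 1))) • X c (n - (m + 1))
  X_X : ∀ i j s r t, D.κ ^ D.M i j • (X (i, s) (r + 1) * X (j, s) t)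
      - D.q ^ (-sg s * D.b i j) • (X (i, s) r * X (j, s) (t + 1))
    = (D.κ ^ D.M i j * D.q ^ (-sg s * D.b i j)) • (X (j, s) t * X (i, s) (r + 1))
      - X (j, s) (t + 1) * X (i, s) r
  mixed : ∀ i j r t, X (i, true) r * X (j, false) t - X (j, false) t * X (i, true) r
    = if i = j then (D.qi i - (D.qi i)⁻¹)⁻¹ •
        ((if r + t < 0 then 0 else γ ^ (r - t) •
          ((k i : Module.End ℂ V) * expCoeff (fun p => (D.q - D.q⁻¹) • a i (pos p)) (r + t).natAbs))
        - if 0 < r + t then 0 else γ ^ (t - r) • (((k i)⁻¹ : (Module.End ℂ V)ˣ).val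
          * expCoeff (fun p => (-(D.q - D.q⁻¹)) • a i (neg p)) (r + t).natAbs)) else 0
  serre : ∀ i j s, i ≠ j → ∀ n t,
    serreSum D (fun c m => (List.ofFn fun p => X (c p, s) (m p)).prod) i j n t = 0

theorem serreSum_apply (D : Datum I) (f : ∀ {L : ℕ}, (Fin L → I) → (Fin L → ℤ) → Module.End ℂ V)
    (v : V) (i j : I) (n : Fin (D.serreOrder i j) → ℤ) (s : ℤ) :
    serreSum D (fun c m => f c m v) i j n s = serreSum D f i j n s v := by
  simp [serreSum, LinearMap.sum_apply]

theorem isDeg_zero_iff {q : ℂ} {T A : Module.End ℂ V} : IsDeg q T 0 A ↔ Commute T A := by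
  rw [IsDeg, zpow_zero, one_smul, Commute, SemiconjBy]

theorem IsHZModule.isHeis [Fintype I] {D : Datum I} {γ ζ : ℂ} {ρ : HZOps I V} (hg : D.IsGood γ)
    (hρ : IsHZModule D γ ζ ρ) : IsHeis D γ (ρ.qd : Module.End ℂ V) ρ.a where
  good := hg
  bdd := isBdd_of_isRestricted hρ.isZModule.restricted
  a_a := hρ.a_a
  deg := hρ.qd_a

theorem IsHZModule.isDeg_col [Fintype I] {D : Datum I} {γ ζ : ℂ} {ρ : HZOps I V}
    (hρ : IsHZModule D γ ζ ρ) (c : I × Bool) (n : ℤ) :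
    IsDeg D.q (ρ.qd : Module.End ℂ V) n (ρ.col c n) := by
  rcases c with ⟨i, _ | _⟩
  exacts [hρ.isZModule.qd_Zm i n, hρ.isZModule.qd_Zp i n]

theorem IsHZModule.a_col [Fintype I] {D : Datum I} {γ ζ : ℂ} {ρ : HZOps I V}
    (hρ : IsHZModule D γ ζ ρ) (i : I) (l : NZ) (c : I × Bool) (n : ℤ) :
    ρ.a i l * ρ.col c n = ρ.col c n * ρ.a i l := by
  rcases c with ⟨j, _ | _⟩
  exacts [hρ.a_Zm i j l n, hρ.a_Zp i j l n]

section

variable [Fintype I] {D : Datum I} {γ ζ : ℂ} {ρ : HZOps I V}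
  (h : IsHeis D γ (ρ.qd : Module.End ℂ V) ρ.a)
  (hZ : ∀ c n, IsDeg D.q (ρ.qd : Module.End ℂ V) n (ρ.col c n))
  (ha : ∀ i l c n, ρ.a i l * ρ.col c n = ρ.col c n * ρ.a i l)

include h hZ

-- `Dressing.serre_iff` speaks of operators and iterated sums; here the same relation is tested on
-- vectors, with all exponents summed at once.
omit [Fintype I] in
theorem serre_Z_iff (i j : I) (s : Bool) (ha : ∀ i l c n, ρ.a i l * ρ.col c n = ρ.col c n * ρ.a i l) :
    (∀ n t, serreSum D (fun c m => (List.ofFn fun p => h.dressing.X ρ.col (c p, s) (m p)).prod)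
      i j n t = 0) ↔
    ∀ n t v, serreSum D (nPoint (fun i j =>
        ratio (γ ^ 4) (γ ^ (2 * sg s + 2) * (D.q ^ (-D.b i j) * D.κ ^ (-D.M i j)))
        (γ ^ (2 * sg s + 2) * (D.q ^ D.b i j * D.κ ^ (-D.M i j)))) (fun i => ρ.col (i, s)) v)
      i j n t = 0 := by
  rw [Dressing.serre_iff (D := h.dressing) hZ (h.lower_Z ha) (h.raise_Z ha) D fun i => (i, s)]
  refine forall_congr' fun n => forall_congr' fun t => ?_
  rw [LinearMap.ext_iff]
  refine forall_congr' fun v => ?_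
  rw [← serreSum_apply, LinearMap.zero_apply]
  simp only [h.F_same]
  have key : ∀ {L : ℕ} (c : Fin L → I) (m : Fin L → ℤ), nPoint (fun i j =>
        ratio (γ ^ 4) (γ ^ (2 * sg s + 2) * (D.q ^ (-D.b i j) * D.κ ^ (-D.M i j)))
        (γ ^ (2 * sg s + 2) * (D.q ^ D.b i j * D.κ ^ (-D.M i j)))) (fun i => ρ.col (i, s)) v c m
      = word (fun i j =>
        ratio (γ ^ 4) (γ ^ (2 * sg s + 2) * (D.q ^ (-D.b i j) * D.κ ^ (-D.M i j)))
        (γ ^ (2 * sg s + 2) * (D.q ^ D.b i j * D.κ ^ (-D.M i j)))) (fun i => ρ.col (i, s)) L c m v :=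
    fun c m => nPoint_eq_word h.good.q_ne h.bdd (fun i => hZ (i, s)) c m v
  simp only [serreSum, key]

include ha

/-- The equivalence of the relations of the `Z`-algebra with those of the dressed currents. -/
theorem isHZModule_iff :
    IsHZModule D γ ζ ρ ↔ IsCurrentModule D γ ζ ρ.k ρ.qd ρ.a (h.dressing.X ρ.col) := by
  have htp (f : PowerSeries ℂ) (c c' : I × Bool) (r s : ℤ) (v : V) :
      twoPoint f (ρ.col c) (ρ.col c') r s v = tp f (ρ.col c) (ρ.col c') r s v :=
    twoPoint_eq_tp h.bdd (hZ c') f r s v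
  constructor
  · intro hρ
    have hz := hρ.isZModule
    exact
    { heis := h
      restricted := hz.restricted
      k_k := hz.k_k
      qd_k := hz.qd_k
      level_k := hz.level_k
      a_k := hρ.a_k
      deg := Dressing.isDeg_X (D := h.dressing) hZ
      k_X := fun i j s n => h.isDeg_X_of_commute hZ (fun i' l => hρ.a_k i' i l) (fun n => by
        cases s
        · exact (show IsDeg D.q _ _ _ from hz.k_Zm i j n).congr (by simp [sg])
        · exact (show IsDeg D.q _ _ _ from hz.k_Zp i j n).congr (by simp [sg])) n
      a_pos_X := h.a_pos_X hZ ha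
      a_neg_X := h.a_neg_X hZ ha
      X_X := fun i j s => (h.X_X_iff hZ ha i j s).mpr fun r t => LinearMap.ext fun v => by
        rw [LinearMap.smul_apply, ← htp, ← htp]
        cases s
        · exact hz.Zm_Zm i j r t v
        · exact hz.Zp_Zp i j r t v
      mixed := by
        classical
        intro i j
        refine Eq.mpr ?_ ((h.mixed_iff hZ ha i j (K := (ρ.k i).val) (K' := ((ρ.k i)⁻¹).val)
          ?_ ?_ ?_).mpr ?_)
        · congr!
        · exact isDeg_zero_iff.mpr (congrArg Units.val (hz.qd_k i))
        · exact isDeg_zero_iff.mpr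
            (Commute.units_inv_right (congrArg Units.val (hz.qd_k i)))
        · exact fun j l => Commute.units_inv_right (hρ.a_k j i l)
        · intro r t
          refine LinearMap.ext fun v => ?_
          rw [LinearMap.sub_apply, ← htp, ← htp]
          refine (hz.Zp_Zm i j r t v).trans ?_
          split_ifs <;> simp
      serre := fun i j s hij => (serre_Z_iff h hZ i j s ha).mpr fun n t v => by
        cases s
        · have := hz.serre_Zm i j hij n t v
          have e : 2 * sg false + 2 = (4 : ℕ) := rfl
          simp only [e, zpow_natCast, ← mul_assoc]
          exact this
        · have := hz.serre_Zp i j hij n t v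
          have e : 2 * sg true + 2 = 0 := rfl
          simp only [e, zpow_zero, one_mul]
          exact this }
  · intro hc
    -- The bare currents are the undressing of the dressed ones, and undressing preserves the degree
    -- with respect to `k_i`.
    have hkZ (i j : I) (s : Bool) (n : ℤ) :
        IsDeg D.q (ρ.k i : Module.End ℂ V) (-sg s * D.b i j) (ρ.col (j, s) n) := by
      have h1 := h.isDeg_unX_of_commute hc.deg (K := (ρ.k i).val) (fun i' l => hc.a_k i' i l)
        (c := (j, s)) (hc.k_X i j s) n
      rwa [Dressing.unX_X (D := h.dressing) hZ] at h1
    have hXX (i j : I) (s : Bool) (r t : ℤ) (v : V) := by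
      have := LinearMap.congr_fun ((h.X_X_iff hZ ha i j s).mp (hc.X_X i j s) r t) v
      rw [LinearMap.smul_apply, ← htp, ← htp] at this
      exact this
    exact
    { isZModule :=
      { k_k := hc.k_k
        qd_k := hc.qd_k
        qd_Zp := fun i n => hZ (i, true) n
        qd_Zm := fun i n => hZ (i, false) n
        k_Zp := fun i j n => (hkZ i j true n).congr (by simp [sg])
        k_Zm := fun i j n => (hkZ i j false n).congr (by simp [sg])
        level_k := hc.level_k
        restricted := hc.restricted
        Zp_Zp := fun i j => hXX i j true
        Zm_Zm := fun i j => hXX i j false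
        Zp_Zm := by
          classical
          intro i j r t v
          have h1 := (h.mixed_iff hZ ha i j (K := (ρ.k i).val) (K' := ((ρ.k i)⁻¹).val)
            (isDeg_zero_iff.mpr (congrArg Units.val (hc.qd_k i)))
            (isDeg_zero_iff.mpr
              (Commute.units_inv_right (congrArg Units.val (hc.qd_k i))))
            (fun j l => Commute.units_inv_right (hc.a_k j i l))).mp
              (fun r t => (hc.mixed i j r t).trans (by congr!)) r t
          have h2 := LinearMap.congr_fun h1 v
          rw [LinearMap.sub_apply, ← htp, ← htp] at h2
          refine h2.trans ?_
          split_ifs <;> simp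
        serre_Zp := fun i j hij n t v => by
          have := (serre_Z_iff h hZ i j true ha).mp (hc.serre i j true hij) n t v
          have e : 2 * sg true + 2 = 0 := rfl
          simp only [e, zpow_zero, one_mul] at this
          exact this
        serre_Zm := fun i j hij n t v => by
          have := (serre_Z_iff h hZ i j false ha).mp (hc.serre i j false hij) n t v
          have e : 2 * sg false + 2 = (4 : ℕ) := rfl
          simp only [e, zpow_natCast, ← mul_assoc] at this
          exact this }
      a_a := h.a_a
      qd_a := h.deg
      a_k := hc.a_k
      a_Zp := fun i j l n => ha i l (j, true) n
      a_Zm := fun i j l n => ha i l (j, false) n }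

end

/-- The Heisenberg–`Z`-module structure underlying a module of currents. -/
def IsCurrentModule.undress [Fintype I] {D : Datum I} {γ ζ : ℂ} {k : I → (Module.End ℂ V)ˣ}
    {qd : (Module.End ℂ V)ˣ} {a : I → NZ → Module.End ℂ V} {X : I × Bool → ℤ → Module.End ℂ V}
    (hc : IsCurrentModule D γ ζ k qd a X) : HZOps I V where
  Zp i := hc.heis.dressing.unX X (i, true)
  Zm i := hc.heis.dressing.unX X (i, false)
  k := k
  qd := qd
  a := a

theorem IsCurrentModule.col_undress [Fintype I] {D : Datum I} {γ ζ : ℂ}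
    {k : I → (Module.End ℂ V)ˣ}
    {qd : (Module.End ℂ V)ˣ} {a : I → NZ → Module.End ℂ V} {X : I × Bool → ℤ → Module.End ℂ V}
    (hc : IsCurrentModule D γ ζ k qd a X) : hc.undress.col = hc.heis.dressing.unX X := by
  funext ⟨i, s⟩
  cases s <;> rfl

/-- The undressed currents are graded and commute with the Heisenberg operators, and dressing them
gives back `X`. The equivalence `isHZModule_iff` is then read from right to left. -/
theorem IsCurrentModule.isHZModule_undress [Fintype I] {D : Datum I} {γ ζ : ℂ}
    {k : I → (Module.End ℂ V)ˣ}
    {qd : (Module.End ℂ V)ˣ} {a : I → NZ → Module.End ℂ V} {X : I × Bool → ℤ → Module.End ℂ V}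
    (hc : IsCurrentModule D γ ζ k qd a X) : IsHZModule D γ ζ hc.undress := by
  have h : IsHeis D γ (hc.undress.qd : Module.End ℂ V) hc.undress.a := hc.heis
  refine (isHZModule_iff h (fun c n => ?_) fun i l c n => ?_).mpr ?_
  · rw [hc.col_undress]
    exact Dressing.isDeg_unX (D := h.dressing) hc.deg c n
  · rw [hc.col_undress]
    exact h.a_unX hc.deg (fun i m c => hc.a_pos_X i m c) (fun i m c => hc.a_neg_X i m c) i l c n
  · rw [hc.col_undress]
    have h1 : h.dressing.X (hc.heis.dressing.unX X) = X :=
      Dressing.X_unX (D := hc.heis.dressing) hc.deg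
    rw [h1]
    exact hc

/-- The currents of the definition of the dressing are those of `IsHeis.dressing`. -/
theorem IsHeis.dressed_eq_X {D : Datum I} {γ : ℂ} {T : Module.End ℂ V}
    {a : I → NZ → Module.End ℂ V} (h : IsHeis D γ T a) {Z : I × Bool → ℤ → Module.End ℂ V}
    (hZ : ∀ c n, IsDeg D.q T n (Z c n)) (ha : ∀ i l c n, a i l * Z c n = Z c n * a i l)
    (j : I) (s : Bool) (n : ℤ) (v : V) :
    dressed D γ a (sg s) j (Z (j, s)) n v = h.dressing.X Z (j, s) n v := by
  rw [← (h.hasLSum_X hZ (j, s) n).finsum_eq v, dressed]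
  congr 1
  funext p
  have hm : ∀ n, EMinus D γ a (sg s) j n
      = h.lower (expCoeff (fun m => (-(sg s : ℂ) / levelInt D.q γ (m + 1)) • MvPolynomial.X (j, m)) n) :=
    fun n => (h.lower_expCoeff _ _ _).symm
  have hp : ∀ n, EPlus D γ a (sg s) j n
      = h.raise (expCoeff (fun m => ((sg s : ℂ) / levelInt D.q γ (m + 1)) • MvPolynomial.X (j, m)) n) :=
    fun n => (h.raise_expCoeff _ _ _).symm
  have e1 (m : ℕ) : γ ^ (sg s * ((m : ℤ) + 1)) = (γ ^ sg s) ^ (m + 1) := by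
    rw [zpow_mul, ← zpow_natCast]
    push_cast
    rfl
  have e2 : expCoeff (fun m => cm D γ s m • a j (neg m)) p.1
      = (γ ^ sg s) ^ p.1 • EMinus D γ a (sg s) j p.1 := by
    rw [EMinus, ← expCoeff_smul]
    simp only [smul_smul, cm, e1]
  have e3 : expCoeff (fun m => cp D γ s m • a j (pos m)) p.2
      = (γ ^ sg s) ^ p.2 • EPlus D γ a (sg s) j p.2 := by
    rw [EPlus, ← expCoeff_smul]
    simp only [smul_smul, cp, e1]
  have e4 : γ ^ (sg s * ((p.1 : ℤ) + p.2)) = (γ ^ sg s) ^ p.1 * (γ ^ sg s) ^ p.2 := by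
    rw [← pow_add, zpow_mul, ← zpow_natCast]
    push_cast
    rfl
  dsimp only
  -- The rescalings of both exponentials by `γ^ε` combine into one power; the raising operator,
  -- which stands to the left of `Z` in `dressed`, is moved to its right.
  rw [e2, e3, e4, smul_mul_assoc, smul_mul_assoc, mul_smul_comm, smul_smul, mul_assoc, hp,
    ← h.raise_Z ha]
  rfl

end

noncomputable section

/-! ## Representations of the toroidal algebra -/

variable {I V : Type*} [AddCommGroup V] [Module ℂ V]

theorem Datum.IsGood.qInt_d_ne {D : Datum I} {γ : ℂ} (hg : D.IsGood γ) (i : I) :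
    qInt D.q (D.d i) ≠ 0 := by
  have := hg.qi_sub_ne i
  rw [Datum.qi] at this
  refine div_ne_zero ?_ hg.q_sub_ne
  rwa [zpow_neg, zpow_natCast]

theorem Datum.IsGood.qi_sub {D : Datum I} {γ : ℂ} (hg : D.IsGood γ) (i : I) :
    D.qi i - (D.qi i)⁻¹ = qInt D.q (D.d i) * (D.q - D.q⁻¹) := by
  rw [qInt, div_mul_cancel₀ _ hg.q_sub_ne, Datum.qi, zpow_neg, zpow_natCast]

/-- The reason for the normalization `a_{i,n} = [d_i] a^∨_{i,n}`: it replaces the integers in base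
`q_i` by integers in base `q`. -/
theorem Datum.IsGood.qInt_qi {D : Datum I} {γ : ℂ} (hg : D.IsGood γ) (i j : I) (l : ℤ) :
    qInt (D.qi i) (D.A i j * l) = qInt D.q (D.b i j * l) / qInt D.q (D.d i) := by
  have h1 := hg.qInt_d_ne i
  have h2 := hg.q_sub_ne
  have h3 (n : ℤ) : D.qi i ^ n = D.q ^ (D.d i * n) := by
    rw [Datum.qi, ← zpow_natCast, ← zpow_mul]
  have h4 (x : ℂ) (n : ℤ) : qInt x n = (x ^ n - x ^ (-n)) / (x - x⁻¹) := rfl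
  rw [eq_div_iff h1, h4 (D.qi i), hg.qi_sub, h3, h3, h4 D.q (D.b i j * l),
    mul_comm (qInt D.q (D.d i)), ← div_div, div_mul_cancel₀ _ h1, Datum.b]
  ring_nf

/-- The structure constants of the commutators of `a_{i,l}` with `X^±_j`. -/
def aXCoeff (D : Datum I) (γ : ℂ) (i j : I) (s : Bool) (l : ℤ) : ℂ :=
  -(sg s : ℂ) * γ ^ (sg s * |l|) * (qInt D.q (D.b i j * l) / (l : ℂ) * D.κ ^ (-l * D.M i j))

/-- The denominator `[kn]` of the dressing exponent cancels the factor `[kn]` of the Heisenberg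
bracket; hence the bracket with a current has no such factor. -/
theorem cm_mul_w {D : Datum I} {γ : ℂ} (hg : D.IsGood γ) (i j : I) (s : Bool) (m : ℕ) :
    cm D γ s m * D.w γ i j (m + 1) = aXCoeff D γ i j s (pos m) := by
  have h1 := hg.levelInt_ne m
  have h2 : |((pos m : NZ) : ℤ)| = m + 1 := abs_of_pos (by simp only [pos]; omega)
  rw [aXCoeff, h2, cm, Datum.w]
  simp only [pos]
  field_simp

theorem cp_mul_w {D : Datum I} {γ : ℂ} (hg : D.IsGood γ) (i j : I) (s : Bool) (m : ℕ) :
    cp D γ s m * D.w γ i j (-(m + 1)) = aXCoeff D γ i j s (neg m) := by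
  have h1 := hg.levelInt_ne m
  have h2 : |((neg m : NZ) : ℤ)| = m + 1 := by
    simp only [neg]
    rw [abs_neg]
    exact abs_of_pos (by omega)
  have h3 : levelInt D.q γ (-(m + 1)) = -levelInt D.q γ (m + 1) := by
    rw [levelInt, levelInt, mul_neg, neg_neg]
    ring
  rw [aXCoeff, h2, cp, Datum.w, h3]
  simp only [neg]
  field_simp

theorem NZ.forall {P : NZ → Prop} : (∀ l, P l) ↔ (∀ m, P (pos m)) ∧ ∀ m, P (neg m) := by
  refine ⟨fun h => ⟨fun m => h _, fun m => h _⟩, fun h l => ?_⟩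
  obtain ⟨l, hl⟩ := l
  rcases lt_or_gt_of_ne hl with h1 | h1
  · have h2 : (⟨l, hl⟩ : NZ) = neg (-l - 1).toNat := Subtype.ext (by simp [neg]; omega)
    exact h2 ▸ h.2 _
  · have h2 : (⟨l, hl⟩ : NZ) = pos (l - 1).toNat := Subtype.ext (by simp [pos]; omega)
    exact h2 ▸ h.1 _

/-- The values of an algebra homomorphism on the generators of the toroidal algebra. -/
structure IsImage (D : Datum I) (γ : ℂ) (f : FreeAlgebra ℂ (Gen I) →ₐ[ℂ] Module.End ℂ V)
    (k : I → (Module.End ℂ V)ˣ) (qd : (Module.End ℂ V)ˣ) (a : I → NZ → Module.End ℂ V)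
    (X : I × Bool → ℤ → Module.End ℂ V) : Prop where
  good : D.IsGood γ
  a : ∀ i l, f (FreeAlgebra.ι ℂ (Gen.a i l)) = (qInt D.q (D.d i))⁻¹ • a i l
  xp : ∀ i n, f (FreeAlgebra.ι ℂ (Gen.xp i n)) = X (i, true) n
  xm : ∀ i n, f (FreeAlgebra.ι ℂ (Gen.xm i n)) = X (i, false) n
  kinv : ∀ i, f (FreeAlgebra.ι ℂ (Gen.kinv i)) = ((k i)⁻¹ : (Module.End ℂ V)ˣ)
  k : ∀ i, f (FreeAlgebra.ι ℂ (Gen.k i)) = k i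
  ch : f (FreeAlgebra.ι ℂ Gen.ch) = γ • 1
  chinv : f (FreeAlgebra.ι ℂ Gen.chinv) = γ⁻¹ • 1
  qdinv : f (FreeAlgebra.ι ℂ Gen.qdinv) = (qd⁻¹ : (Module.End ℂ V)ˣ)
  qd : f (FreeAlgebra.ι ℂ Gen.qd) = qd

namespace IsImage

variable {D : Datum I} {γ : ℂ} {f : FreeAlgebra ℂ (Gen I) →ₐ[ℂ] Module.End ℂ V}
    {k : I → (Module.End ℂ V)ˣ} {qd : (Module.End ℂ V)ˣ} {a : I → NZ → Module.End ℂ V}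
    {X : I × Bool → ℤ → Module.End ℂ V} (hf : IsImage D γ f k qd a X)

include hf

theorem chPow (n : ℤ) : f (chPow n) = γ ^ n • 1 := by
  cases n with
  | ofNat n =>
    rw [QToroidal.chPow, map_pow, hf.ch, smul_pow, one_pow, Int.ofNat_eq_natCast, zpow_natCast]
  | negSucc n =>
    rw [QToroidal.chPow, map_pow, hf.chinv, smul_pow, one_pow, zpow_negSucc, inv_pow]

theorem phiP (i : I) (n : ℤ) : f (phiP D i n) = if n < 0 then 0 else
    (k i : Module.End ℂ V) * expCoeff (fun p => (D.q - D.q⁻¹) • a i (pos p)) n.natAbs := by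
  rw [QToroidal.phiP]
  split_ifs
  · exact map_zero f
  · rw [map_mul, hf.k, expCoeff_map]
    congr 2
    funext p
    rw [map_smul, hf.a, smul_smul, hf.good.qi_sub, mul_comm, inv_mul_cancel_left₀ (hf.good.qInt_d_ne i)]

theorem phiM (i : I) (n : ℤ) : f (phiM D i n) = if 0 < n then 0 else
    ((k i)⁻¹ : (Module.End ℂ V)ˣ).val * expCoeff (fun p => (-(D.q - D.q⁻¹)) • a i (neg p)) n.natAbs := by
  rw [QToroidal.phiM]
  split_ifs
  · exact map_zero f
  · rw [map_mul, hf.kinv, expCoeff_map]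
    congr 2
    funext p
    rw [map_smul, hf.a, smul_smul, hf.good.qi_sub, neg_mul, mul_comm,
      inv_mul_cancel_left₀ (hf.good.qInt_d_ne i)]

theorem serre_xp (i j : I) (n : Fin (D.serreOrder i j) → ℤ) (s : ℤ) :
    f (serreSum D (fun c m => (List.ofFn fun p => FreeAlgebra.ι ℂ (Gen.xp (c p) (m p))).prod) i j n s)
      = serreSum D (fun c m => (List.ofFn fun p => X (c p, true) (m p)).prod) i j n s := by
  simp only [serreSum, map_sum, map_smul, map_list_prod, List.map_ofFn, Function.comp_def, hf.xp]

theorem serre_xm (i j : I) (n : Fin (D.serreOrder i j) → ℤ) (s : ℤ) :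
    f (serreSum D (fun c m => (List.ofFn fun p => FreeAlgebra.ι ℂ (Gen.xm (c p) (m p))).prod) i j n s)
      = serreSum D (fun c m => (List.ofFn fun p => X (c p, false) (m p)).prod) i j n s := by
  simp only [serreSum, map_sum, map_smul, map_list_prod, List.map_ofFn, Function.comp_def, hf.xm]

theorem k_prod [Fintype I] :
    f (Finset.univ.toList.map fun i => FreeAlgebra.ι ℂ (Gen.k i) ^ D.lab i).prod
      = (Finset.univ.toList.map fun i => (k i : Module.End ℂ V) ^ D.lab i).prod := by
  simp only [map_list_prod, List.map_map, Function.comp_def, map_pow, hf.k]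

theorem a_a_coeff (i j : I) (l : ℤ) :
    qInt (D.qi i) (D.A i j * l) / (l : ℂ) / (D.qi j - (D.qi j)⁻¹) * D.κ ^ (-l * D.M i j)
      * (γ ^ (2 * l) - γ ^ (-(2 * l)))
      = (qInt D.q (D.d i))⁻¹ * (qInt D.q (D.d j))⁻¹ * D.w γ i j l := by
  rw [hf.good.qInt_qi, hf.good.qi_sub, Datum.w, levelInt]
  have h1 := hf.good.qInt_d_ne i
  have h2 := hf.good.qInt_d_ne j
  have h3 := hf.good.q_sub_ne
  generalize D.q - D.q⁻¹ = x at *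
  generalize γ ^ (2 * l) - γ ^ (-(2 * l)) = y
  generalize qInt D.q (D.d i) = d at *
  generalize qInt D.q (D.d j) = d' at *
  simp only [div_eq_mul_inv, mul_inv]
  ring

theorem a_X_coeff (i j : I) (l : ℤ) :
    qInt (D.qi i) (D.A i j * l) / (l : ℂ) * D.κ ^ (-l * D.M i j)
      = (qInt D.q (D.d i))⁻¹ * (qInt D.q (D.b i j * l) / (l : ℂ) * D.κ ^ (-l * D.M i j)) := by
  rw [hf.good.qInt_qi]
  simp only [div_eq_mul_inv]
  ring

/-- Central elements become scalars, and all other relations are those of the currents after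
division by the integers `[d_i]`. -/
theorem rel [Fintype I] {ζ : ℂ} (hc : IsCurrentModule D γ ζ k qd a X) {x y : FreeAlgebra ℂ (Gen I)}
    (h : Rel D x y) : f x = f y := by
  classical
  have haX (i j : I) (s : Bool) (l : NZ) (n : ℤ) : a i l * X (j, s) n - X (j, s) n * a i l
      = aXCoeff D γ i j s l • X (j, s) (n + l) := by
    revert l
    rw [NZ.forall]
    refine ⟨fun m => ?_, fun m => ?_⟩
    · rw [hc.a_pos_X, add_sub_cancel_left, cm_mul_w hf.good]
      rfl
    · rw [hc.a_neg_X, add_sub_cancel_left, cp_mul_w hf.good]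
      rfl
  cases h with
  | ch_inv =>
    simp only [map_mul, map_one, hf.ch, hf.chinv, smul_mul_smul_comm, mul_one,
      mul_inv_cancel₀ hf.good.γ_ne, one_smul]
  | inv_ch =>
    simp only [map_mul, map_one, hf.ch, hf.chinv, smul_mul_smul_comm, mul_one,
      inv_mul_cancel₀ hf.good.γ_ne, one_smul]
  | qd_inv => simp only [map_mul, map_one, hf.qd, hf.qdinv, Units.mul_inv]
  | inv_qd => simp only [map_mul, map_one, hf.qd, hf.qdinv, Units.inv_mul]
  | k_inv i => simp only [map_mul, map_one, hf.k, hf.kinv, Units.mul_inv]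
  | inv_k i => simp only [map_mul, map_one, hf.k, hf.kinv, Units.inv_mul]
  | ch_central x => simp only [map_mul, hf.ch, smul_mul_assoc, mul_smul_comm, one_mul, mul_one]
  | k_central x =>
    rw [map_mul, map_mul, hf.k_prod, hc.level_k, smul_mul_assoc, mul_smul_comm, one_mul, mul_one]
  | k_k i j => simpa only [map_mul, hf.k, Units.val_mul] using congrArg Units.val (hc.k_k i j)
  | k_a i j l =>
    rw [map_mul, map_mul, hf.k, hf.a, smul_mul_assoc, mul_smul_comm, hc.a_k]
  | qd_k i => simpa only [map_mul, hf.k, hf.qd, Units.val_mul] using congrArg Units.val (hc.qd_k i)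
  | qd_a i l =>
    have : (qd : Module.End ℂ V) * a i l = _ := hc.heis.deg i l
    rw [map_mul, map_smul, map_mul, hf.qd, hf.a, smul_mul_assoc, mul_smul_comm, this, smul_comm]
  | qd_xp i n =>
    rw [map_mul, map_smul, map_mul, hf.qd, hf.xp]
    exact hc.deg (i, true) n
  | qd_xm i n =>
    rw [map_mul, map_smul, map_mul, hf.qd, hf.xm]
    exact hc.deg (i, false) n
  | k_xp i j n =>
    simp only [map_mul, map_smul, hf.k, hf.xp]
    exact (hc.k_X i j true n).congr (by simp [sg])
  | k_xm i j n =>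
    simp only [map_mul, map_smul, hf.k, hf.xm]
    exact (hc.k_X i j false n).congr (by simp [sg])
  | a_a i j l m =>
    have := hc.heis.a_a i j l m
    rw [map_sub, map_mul, map_mul, hf.a, hf.a, smul_mul_smul_comm, smul_mul_smul_comm,
      mul_comm (qInt D.q (D.d j))⁻¹, ← smul_sub, this]
    split_ifs
    · rw [map_smul, map_sub, hf.chPow, hf.chPow, ← sub_smul, smul_smul, smul_smul, hf.a_a_coeff]
    · rw [smul_zero, map_zero]
  | a_xp i j l n =>
    rw [map_sub, map_mul, map_mul, hf.a, hf.xp, smul_mul_assoc, mul_smul_comm, ← smul_sub, haX,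
      map_smul, map_mul, hf.chPow, hf.xp, smul_mul_assoc, one_mul, smul_smul, smul_smul,
      hf.a_X_coeff, aXCoeff]
    congr 1
    simp only [sg]
    push_cast
    ring_nf
  | a_xm i j l n =>
    rw [map_sub, map_mul, map_mul, hf.a, hf.xm, smul_mul_assoc, mul_smul_comm, ← smul_sub, haX,
      map_smul, map_mul, hf.chPow, hf.xm, smul_mul_assoc, one_mul, smul_smul, smul_smul,
      hf.a_X_coeff, aXCoeff]
    congr 1
    simp only [sg]
    push_cast
    ring_nf
  | xp_xp i j r s =>
    have := hc.X_X i j true r s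
    simp only [sg, neg_neg, one_mul] at this
    simpa only [map_sub, map_smul, map_mul, hf.xp] using this
  | xm_xm i j r s =>
    have := hc.X_X i j false r s
    simp only [sg, neg_mul, one_mul] at this
    simpa only [map_sub, map_smul, map_mul, hf.xm] using this
  | xp_xm i j r s =>
    rw [map_sub, map_mul, map_mul, hf.xp, hf.xm, hc.mixed]
    by_cases h1 : i = j
    · rw [if_pos h1, if_pos h1, map_smul, map_sub, map_mul, map_mul, hf.phiP, hf.phiM, hf.chPow, hf.chPow, smul_mul_assoc,
        smul_mul_assoc, one_mul, one_mul, smul_ite, smul_ite, smul_zero, smul_zero]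
    · rw [if_neg h1, if_neg h1, map_zero]
  | serre_xp i j hij n s => rw [hf.serre_xp, hc.serre i j true hij, map_zero]
  | serre_xm i j hij n s => rw [hf.serre_xm, hc.serre i j false hij, map_zero]

theorem isCurrentModule [Fintype I] {ζ : ℂ} (hrel : ∀ x y, Rel D x y → f x = f y)
    (hres : IsRestricted D.q (qd : Module.End ℂ V))
    (hlev : (Finset.univ.toList.map fun i => (k i : Module.End ℂ V) ^ D.lab i).prod = ζ • 1) :
    IsCurrentModule D γ ζ k qd a X := by
  have hd := fun i => hf.good.qInt_d_ne i
  have ha (i : I) (l : NZ) : a i l = qInt D.q (D.d i) • f (FreeAlgebra.ι ℂ (Gen.a i l)) := by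
    rw [hf.a, smul_inv_smul₀ (hd i)]
  have hqd (i : I) : (qd : Module.End ℂ V) * k i = k i * qd := by
    simpa only [map_mul, hf.qd, hf.k] using hrel _ _ (Rel.qd_k i)
  have haX (i j : I) (s : Bool) (l : NZ) (n : ℤ) : a i l * X (j, s) n
      = X (j, s) n * a i l + aXCoeff D γ i j s l • X (j, s) (n + l) := by
    rw [← sub_eq_iff_eq_add']
    cases s with
    | true =>
      have := hrel _ _ (Rel.a_xp i j l n)
      rw [map_sub, map_mul, map_mul, map_smul, map_mul, hf.chPow, hf.xp, hf.xp, smul_mul_assoc,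
        one_mul, smul_smul, hf.a_X_coeff] at this
      rw [ha, smul_mul_assoc, mul_smul_comm, ← smul_sub, this, smul_smul, aXCoeff, mul_assoc,
        mul_inv_cancel_left₀ (hd i)]
      congr 1
      simp only [sg]
      push_cast
      ring_nf
    | false =>
      have := hrel _ _ (Rel.a_xm i j l n)
      rw [map_sub, map_mul, map_mul, map_smul, map_mul, hf.chPow, hf.xm, hf.xm, smul_mul_assoc,
        one_mul, smul_smul, hf.a_X_coeff] at this
      rw [ha, smul_mul_assoc, mul_smul_comm, ← smul_sub, this, smul_smul, aXCoeff, neg_mul, mul_neg,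
        mul_assoc, mul_inv_cancel_left₀ (hd i)]
      congr 1
      simp only [sg]
      push_cast
      ring_nf
  exact
  { heis :=
    { good := hf.good
      bdd := isBdd_of_isRestricted hres
      a_a := fun i j l m => by
        have := hrel _ _ (Rel.a_a i j l m)
        rw [map_sub, map_mul, map_mul] at this
        rw [ha, ha, smul_mul_smul_comm, smul_mul_smul_comm, mul_comm (qInt D.q (D.d j)), ← smul_sub,
          this]
        split_ifs
        · rw [map_smul, map_sub, hf.chPow, hf.chPow, ← sub_smul, smul_smul, smul_smul,
            mul_assoc (qInt D.q (D.d i) * qInt D.q (D.d j)), hf.a_a_coeff, ← mul_inv, mul_inv_cancel_left₀ (mul_ne_zero (hd i) (hd j))]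
        · rw [map_zero, smul_zero]
      deg := fun i l => by
        have := hrel _ _ (Rel.qd_a i l)
        rw [map_mul, map_smul, map_mul, hf.qd] at this
        rw [ha, IsDeg, smul_mul_assoc, mul_smul_comm, this, smul_comm] }
    restricted := hres
    k_k := fun i j => Units.ext (by simpa only [map_mul, hf.k, Units.val_mul] using hrel _ _ (Rel.k_k i j))
    qd_k := fun i => Units.ext (hqd i)
    level_k := hlev
    a_k := fun i j l => by
      have := hrel _ _ (Rel.k_a j i l)
      rw [map_mul, map_mul, hf.k] at this
      rw [ha, smul_mul_assoc, mul_smul_comm, this]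
    deg := fun c n => by
      rcases c with ⟨i, _ | _⟩
      · have := hrel _ _ (Rel.qd_xm i n)
        rwa [map_mul, map_smul, map_mul, hf.qd, hf.xm] at this
      · have := hrel _ _ (Rel.qd_xp i n)
        rwa [map_mul, map_smul, map_mul, hf.qd, hf.xp] at this
    k_X := fun i j s n => by
      cases s with
      | true =>
        have := hrel _ _ (Rel.k_xp i j n)
        simp only [map_mul, map_smul, hf.k, hf.xp] at this
        exact (show IsDeg D.q _ _ _ from this).congr (by simp [sg])
      | false =>
        have := hrel _ _ (Rel.k_xm i j n)
        simp only [map_mul, map_smul, hf.k, hf.xm] at this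
        exact (show IsDeg D.q _ _ _ from this).congr (by simp [sg])
    a_pos_X := fun i m c n => by
      rw [cm_mul_w hf.good]
      exact haX i c.1 c.2 (pos m) n
    a_neg_X := fun i m c n => by
      rw [cp_mul_w hf.good]
      exact haX i c.1 c.2 (neg m) n
    X_X := fun i j s r t => by
      cases s with
      | true =>
        simpa only [map_sub, map_smul, map_mul, hf.xp, sg, neg_neg, one_mul]
          using hrel _ _ (Rel.xp_xp i j r t)
      | false =>
        simpa only [map_sub, map_smul, map_mul, hf.xm, sg, neg_mul, one_mul]
          using hrel _ _ (Rel.xm_xm i j r t)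
    mixed := fun i j r t => by
      have := hrel _ _ (Rel.xp_xm i j r t)
      rw [map_sub, map_mul, map_mul, hf.xp, hf.xm] at this
      rw [this]
      by_cases h1 : i = j
      · rw [if_pos h1, if_pos h1, map_smul, map_sub, map_mul, map_mul, hf.phiP, hf.phiM, hf.chPow, hf.chPow,
          smul_mul_assoc, smul_mul_assoc, one_mul, one_mul, smul_ite, smul_ite, smul_zero, smul_zero]
      · rw [if_neg h1, if_neg h1, map_zero]
    serre := fun i j s hij n t => by
      cases s with
      | true => rw [← hf.serre_xp, hrel _ _ (Rel.serre_xp i j hij n t), map_zero]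
      | false => rw [← hf.serre_xm, hrel _ _ (Rel.serre_xm i j hij n t), map_zero] }

end IsImage

end

noncomputable section

/-! ## The correspondence -/

variable {I V : Type*} [AddCommGroup V] [Module ℂ V] [Fintype I] {D : Datum I} {γ ζ : ℂ}

/-- The currents of a representation of the toroidal algebra. -/
def repX (π : Toroidal D →ₐ[ℂ] Module.End ℂ V) (c : I × Bool) (n : ℤ) : Module.End ℂ V :=
  match c.2 with
  | true => π (gen D (Gen.xp c.1 n))
  | false => π (gen D (Gen.xm c.1 n))

theorem rep_rel (π : Toroidal D →ₐ[ℂ] Module.End ℂ V) {x y : FreeAlgebra ℂ (Gen I)}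
    (h : Rel D x y) :
    π.comp (RingQuot.mkAlgHom ℂ (Rel D)) x = π.comp (RingQuot.mkAlgHom ℂ (Rel D)) y :=
  congrArg π (RingQuot.mkAlgHom_rel ℂ h)

/-- The images of the inverse generators are forced by the inverse relations, so prescribing the
generators themselves is enough. -/
theorem isImage_of_rep (hg : D.IsGood γ) (π : Toroidal D →ₐ[ℂ] Module.End ℂ V)
    {k : I → (Module.End ℂ V)ˣ} {qd : (Module.End ℂ V)ˣ} {a : I → NZ → Module.End ℂ V}
    (hk : ∀ i, π (gen D (Gen.k i)) = k i) (hqd : π (gen D Gen.qd) = qd)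
    (hch : π (gen D Gen.ch) = γ • 1) (ha : ∀ i l, qInt D.q (D.d i) • π (gen D (Gen.a i l)) = a i l) :
    IsImage D γ (π.comp (RingQuot.mkAlgHom ℂ (Rel D))) k qd a (repX π) where
  good := hg
  a i l := by
    rw [← ha, inv_smul_smul₀ (hg.qInt_d_ne i)]
    rfl
  xp i n := rfl
  xm i n := rfl
  kinv i := by
    have := rep_rel π (Rel.k_inv i)
    rw [map_mul, map_one] at this
    refine (Units.inv_eq_of_mul_eq_one_right ?_).symm
    rw [← hk]
    exact this
  k := hk
  ch := hch
  chinv := by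
    have := rep_rel π Rel.ch_inv
    rw [map_mul, map_one] at this
    change π (gen D Gen.ch) * _ = 1 at this
    rw [hch, smul_mul_assoc, one_mul] at this
    rw [← this, inv_smul_smul₀ hg.γ_ne]
  qdinv := by
    have := rep_rel π Rel.qd_inv
    rw [map_mul, map_one] at this
    refine (Units.inv_eq_of_mul_eq_one_right ?_).symm
    rw [← hqd]
    exact this
  qd := hqd

/-- The values on the generators that define the representation attached to currents. -/
def genMap (D : Datum I) (γ : ℂ) (k : I → (Module.End ℂ V)ˣ) (qd : (Module.End ℂ V)ˣ)
    (a : I → NZ → Module.End ℂ V) (X : I × Bool → ℤ → Module.End ℂ V) : Gen I → Module.End ℂ V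
  | Gen.a i l => (qInt D.q (D.d i))⁻¹ • a i l
  | Gen.xp i n => X (i, true) n
  | Gen.xm i n => X (i, false) n
  | Gen.k i => k i
  | Gen.kinv i => ((k i)⁻¹ : (Module.End ℂ V)ˣ)
  | Gen.ch => γ • 1
  | Gen.chinv => γ⁻¹ • 1
  | Gen.qd => qd
  | Gen.qdinv => (qd⁻¹ : (Module.End ℂ V)ˣ)

theorem IsCurrentModule.exists_rep {k : I → (Module.End ℂ V)ˣ} {qd : (Module.End ℂ V)ˣ}
    {a : I → NZ → Module.End ℂ V} {X : I × Bool → ℤ → Module.End ℂ V}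
    (hc : IsCurrentModule D γ ζ k qd a X) : ∃ π : Toroidal D →ₐ[ℂ] Module.End ℂ V,
      ∀ x, π (gen D x) = genMap D γ k qd a X x := by
  have hι (x : Gen I) : FreeAlgebra.lift ℂ (genMap D γ k qd a X) (FreeAlgebra.ι ℂ x)
    = genMap D γ k qd a X x := FreeAlgebra.lift_ι_apply _ _
  have hf : IsImage D γ (FreeAlgebra.lift ℂ (genMap D γ k qd a X)) k qd a X :=
    { good := hc.heis.good
      a := fun i l => hι _
      xp := fun i n => hι _
      xm := fun i n => hι _
      kinv := fun i => hι _
      k := fun i => hι _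
      ch := hι _
      chinv := hι _
      qdinv := hι _
      qd := hι _ }
  refine ⟨RingQuot.liftAlgHom ℂ ⟨FreeAlgebra.lift ℂ (genMap D γ k qd a X),
    fun {x y} h => hf.rel hc h⟩, fun x => ?_⟩
  rw [gen, RingQuot.liftAlgHom_mkAlgHom_apply]
  exact hι x

theorem IsHZModule.isCurrentModule {ρ : HZOps I V} (hg : D.IsGood γ) (hρ : IsHZModule D γ ζ ρ) :
    IsCurrentModule D γ ζ ρ.k ρ.qd ρ.a ((hρ.isHeis hg).dressing.X ρ.col) :=
  (isHZModule_iff (hρ.isHeis hg) hρ.isDeg_col hρ.a_col).mp hρ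

theorem IsDressing.repX_eq {ρ : HZOps I V} (hg : D.IsGood γ) (hρ : IsHZModule D γ ζ ρ)
    {π : Toroidal D →ₐ[ℂ] Module.End ℂ V} (hd : IsDressing D γ ρ π) :
    repX π = (hρ.isHeis hg).dressing.X ρ.col := by
  funext ⟨j, s⟩ n
  refine LinearMap.ext fun v => ?_
  rw [← (hρ.isHeis hg).dressed_eq_X hρ.isDeg_col hρ.a_col]
  cases s with
  | true => exact hd.xp j n v
  | false => exact hd.xm j n v

theorem IsDressing.isImage {ρ : HZOps I V} (hg : D.IsGood γ) (hρ : IsHZModule D γ ζ ρ)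
    {π : Toroidal D →ₐ[ℂ] Module.End ℂ V} (hd : IsDressing D γ ρ π) :
    IsImage D γ (π.comp (RingQuot.mkAlgHom ℂ (Rel D))) ρ.k ρ.qd ρ.a
      ((hρ.isHeis hg).dressing.X ρ.col) := by
  rw [← hd.repX_eq hg hρ]
  exact isImage_of_rep hg π hd.k hd.qd hd.ch hd.a

omit [Fintype I] in
theorem IsImage.unique {k : I → (Module.End ℂ V)ˣ} {qd : (Module.End ℂ V)ˣ}
    {a : I → NZ → Module.End ℂ V} {X : I × Bool → ℤ → Module.End ℂ V}
    {f f' : FreeAlgebra ℂ (Gen I) →ₐ[ℂ] Module.End ℂ V} (h : IsImage D γ f k qd a X)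
    (h' : IsImage D γ f' k qd a X) : f = f' := by
  refine FreeAlgebra.hom_ext (funext fun x => ?_)
  cases x with
  | a i l => exact (h.a i l).trans (h'.a i l).symm
  | xp i n => exact (h.xp i n).trans (h'.xp i n).symm
  | xm i n => exact (h.xm i n).trans (h'.xm i n).symm
  | k i => exact (h.k i).trans (h'.k i).symm
  | kinv i => exact (h.kinv i).trans (h'.kinv i).symm
  | ch => exact h.ch.trans h'.ch.symm
  | chinv => exact h.chinv.trans h'.chinv.symm
  | qd => exact h.qd.trans h'.qd.symm
  | qdinv => exact h.qdinv.trans h'.qdinv.symm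

theorem IsHZModule.exists_isDressing {ρ : HZOps I V} (hg : D.IsGood γ)
    (hρ : IsHZModule D γ ζ ρ) : ∃ π : Toroidal D →ₐ[ℂ] Module.End ℂ V, IsDressing D γ ρ π := by
  obtain ⟨π, hπ⟩ := (hρ.isCurrentModule hg).exists_rep
  have hX := (hρ.isHeis hg).dressed_eq_X hρ.isDeg_col hρ.a_col
  exact ⟨π,
    { xp := fun j n v => (LinearMap.congr_fun (hπ (Gen.xp j n)) v).trans (hX j true n v).symm
      xm := fun j n v => (LinearMap.congr_fun (hπ (Gen.xm j n)) v).trans (hX j false n v).symm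
      k := fun j => hπ _
      a := fun j l => by rw [hπ, genMap, smul_inv_smul₀ (hg.qInt_d_ne j)]
      ch := hπ _
      qd := hπ _ }⟩

theorem IsDressing.unique_rep {ρ : HZOps I V} (hg : D.IsGood γ) (hρ : IsHZModule D γ ζ ρ)
    {π π' : Toroidal D →ₐ[ℂ] Module.End ℂ V} (hd : IsDressing D γ ρ π)
    (hd' : IsDressing D γ ρ π') : π = π' :=
  RingQuot.ringQuot_ext' _ _ _ ((hd.isImage hg hρ).unique (hd'.isImage hg hρ))

theorem IsDressing.isRestrictedToroidalModule {ρ : HZOps I V} (hρ : IsHZModule D γ ζ ρ)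
    {π : Toroidal D →ₐ[ℂ] Module.End ℂ V} (hd : IsDressing D γ ρ π) :
    IsRestrictedToroidalModule D γ ζ π where
  level_c := hd.ch
  level_k := by
    rw [← hρ.isZModule.level_k]
    simp only [map_list_prod, List.map_map, Function.comp_def, map_pow, hd.k]
  restricted := by
    rw [hd.qd]
    exact hρ.isZModule.restricted

/-- The exponents of a commutative exponential series are polynomials in its coefficients. -/
theorem mem_of_expCoeff_mem {B : Type*} [Ring B] [Algebra ℂ B] (S : Subalgebra ℂ B) (x : ℕ → B)
    (hx : ∀ i j, x i * x j = x j * x i) (h : ∀ n, expCoeff x n ∈ S) (n : ℕ) : x n ∈ S := by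
  induction n using Nat.strong_induction_on with
  | _ n ih =>
    have h1 := succ_smul_expCoeff_of_commute x hx n
    rw [Finset.Nat.sum_antidiagonal_eq_sum_range_succ_mk, Finset.sum_range_succ, Nat.sub_self,
      expCoeff_zero, mul_one] at h1
    have h2 : ((n : ℂ) + 1) • x n ∈ S := by
      dsimp only at h1
      rw [eq_sub_of_add_eq' h1.symm]
      exact S.sub_mem (S.smul_mem (h _) _) (S.sum_mem fun m hm =>
        S.smul_mem (S.mul_mem (ih m (Finset.mem_range.mp hm)) (h _)) _)
    rw [← inv_smul_smul₀ (Nat.cast_add_one_ne_zero (R := ℂ) n) (x n)]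
    exact S.smul_mem h2 _

/-- For `n > 0` only one of the two terms contributes to the commutator of `X^+_{i,±n}` with
`X^-_{i,0}`. It is a nonzero multiple of `k_i^{±1}` times a coefficient of the exponential in
`Φ^±_i`. Removing `k_i^{±1}` and inverting the exponential gives the modes `a_{i,±n}`. -/
theorem IsCurrentModule.a_mem {k : I → (Module.End ℂ V)ˣ} {qd : (Module.End ℂ V)ˣ}
    {a : I → NZ → Module.End ℂ V} {X : I × Bool → ℤ → Module.End ℂ V}
    (hc : IsCurrentModule D γ ζ k qd a X) (S : Subalgebra ℂ (Module.End ℂ V))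
    (hX : ∀ c n, X c n ∈ S) (hk : ∀ i, (k i : Module.End ℂ V) ∈ S)
    (hk' : ∀ i, ((k i)⁻¹ : (Module.End ℂ V)ˣ).val ∈ S) (i : I) (l : NZ) : a i l ∈ S := by
  have hq := hc.heis.good.q_sub_ne
  have hqi := hc.heis.good.qi_sub_ne i
  have hγ := hc.heis.good.γ_ne
  have hmem (r t : ℤ) : X (i, true) r * X (i, false) t - X (i, false) t * X (i, true) r ∈ S :=
    S.sub_mem (S.mul_mem (hX _ _) (hX _ _)) (S.mul_mem (hX _ _) (hX _ _))
  revert l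
  rw [NZ.forall]
  constructor
  · have h1 : ∀ n, expCoeff (fun p => (D.q - D.q⁻¹) • a i (pos p)) n ∈ S := by
      intro n
      rcases Nat.eq_zero_or_pos n with rfl | hn
      · rw [expCoeff_zero]
        exact S.one_mem
      · have h2 := hmem n 0
        rw [hc.mixed, if_pos rfl, if_neg (by omega), if_pos (by omega), sub_zero, smul_smul] at h2
        have h3 := S.mul_mem (hk' i) (S.smul_mem h2 ((D.qi i - (D.qi i)⁻¹)⁻¹ * γ ^ ((n : ℤ) - 0))⁻¹)
        rwa [inv_smul_smul₀ (mul_ne_zero (inv_ne_zero hqi) (zpow_ne_zero _ hγ)),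
          Units.inv_mul_cancel_left, add_zero, Int.natAbs_natCast] at h3
    intro m
    have h2 := mem_of_expCoeff_mem S _ (fun m m' => by
      rw [smul_mul_smul_comm, smul_mul_smul_comm, hc.heis.comm_pos]) h1 m
    rw [← inv_smul_smul₀ hq (a i (pos m))]
    exact S.smul_mem h2 _
  · have h1 : ∀ n, expCoeff (fun p => (-(D.q - D.q⁻¹)) • a i (neg p)) n ∈ S := by
      intro n
      rcases Nat.eq_zero_or_pos n with rfl | hn
      · rw [expCoeff_zero]
        exact S.one_mem
      · have h2 := S.neg_mem (hmem (-n) 0)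
        rw [hc.mixed, if_pos rfl, if_pos (by omega), if_neg (by omega), zero_sub, smul_neg, neg_neg,
          smul_smul] at h2
        have h3 := S.mul_mem (hk i)
          (S.smul_mem h2 ((D.qi i - (D.qi i)⁻¹)⁻¹ * γ ^ (0 - (-(n : ℤ))))⁻¹)
        rwa [inv_smul_smul₀ (mul_ne_zero (inv_ne_zero hqi) (zpow_ne_zero _ hγ)),
          Units.mul_inv_cancel_left, add_zero, Int.natAbs_neg, Int.natAbs_natCast] at h3
    intro m
    have h2 := mem_of_expCoeff_mem S _ (fun m m' => by
      rw [smul_mul_smul_comm, smul_mul_smul_comm, hc.heis.comm_neg]) h1 m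
    rw [← inv_smul_smul₀ (neg_ne_zero.mpr hq) (a i (neg m))]
    exact S.smul_mem h2 _

/-- Among the generators on the right, the Heisenberg modes are supplied by `IsCurrentModule.a_mem`,
and `q^{±c/2}` act as scalars. -/
theorem IsDressing.adjoin_eq {ρ : HZOps I V} (hg : D.IsGood γ) (hρ : IsHZModule D γ ζ ρ)
    {π : Toroidal D →ₐ[ℂ] Module.End ℂ V} (hd : IsDressing D γ ρ π) :
    Algebra.adjoin ℂ {x | ∃ j, (∃ n, x = π (gen D (Gen.xp j n)) ∨ x = π (gen D (Gen.xm j n))) ∨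
        x = ρ.k j ∨ x = ((ρ.k j)⁻¹ : (Module.End ℂ V)ˣ)}
      = (Toroidal' D).map π := by
  have hf := hd.isImage hg hρ
  have hc := hρ.isCurrentModule hg
  rw [Toroidal', AlgHom.map_adjoin]
  apply le_antisymm
  · refine Algebra.adjoin_mono ?_
    rintro x ⟨j, ⟨n, rfl | rfl⟩ | rfl | rfl⟩
    · exact ⟨_, ⟨_, by simp, by simp, rfl⟩, rfl⟩
    · exact ⟨_, ⟨_, by simp, by simp, rfl⟩, rfl⟩
    · exact ⟨_, ⟨Gen.k j, by simp, by simp, rfl⟩, hd.k j⟩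
    · exact ⟨_, ⟨Gen.kinv j, by simp, by simp, rfl⟩, hf.kinv j⟩
  · refine Algebra.adjoin_le ?_
    set S := Algebra.adjoin ℂ {x | ∃ j, (∃ n, x = π (gen D (Gen.xp j n)) ∨
      x = π (gen D (Gen.xm j n))) ∨ x = ρ.k j ∨ x = ((ρ.k j)⁻¹ : (Module.End ℂ V)ˣ)}
    have hxp (j : I) (n : ℤ) : π (gen D (Gen.xp j n)) ∈ S :=
      Algebra.subset_adjoin ⟨j, Or.inl ⟨n, Or.inl rfl⟩⟩
    have hxm (j : I) (n : ℤ) : π (gen D (Gen.xm j n)) ∈ S :=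
      Algebra.subset_adjoin ⟨j, Or.inl ⟨n, Or.inr rfl⟩⟩
    have hk (j : I) : (ρ.k j : Module.End ℂ V) ∈ S :=
      Algebra.subset_adjoin ⟨j, Or.inr (Or.inl rfl)⟩
    have hk' (j : I) : ((ρ.k j)⁻¹ : (Module.End ℂ V)ˣ).val ∈ S :=
      Algebra.subset_adjoin ⟨j, Or.inr (Or.inr rfl)⟩
    have hX (c : I × Bool) (n : ℤ) : (hρ.isHeis hg).dressing.X ρ.col c n ∈ S := by
      rw [← hd.repX_eq hg hρ]
      rcases c with ⟨j, _ | _⟩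
      exacts [hxm j n, hxp j n]
    rintro _ ⟨_, ⟨x, h1, h2, rfl⟩, rfl⟩
    cases x with
    | a i l =>
      have h3 : π (gen D (Gen.a i l)) = (qInt D.q (D.d i))⁻¹ • ρ.a i l := hf.a i l
      rw [h3]
      exact S.smul_mem (hc.a_mem S hX hk hk' i l) _
    | xp i n => exact hxp i n
    | xm i n => exact hxm i n
    | k i =>
      rw [hd.k]
      exact hk i
    | kinv i =>
      have h3 : π (gen D (Gen.kinv i)) = _ := hf.kinv i
      rw [h3]
      exact hk' i
    | ch =>
      rw [hd.ch]
      exact S.smul_mem S.one_mem _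
    | chinv =>
      have h3 : π (gen D Gen.chinv) = _ := hf.chinv
      rw [h3]
      exact S.smul_mem S.one_mem _
    | qd => exact absurd rfl h1
    | qdinv => exact absurd rfl h2

/-- The representation fixes `k`, `q^d` and the Heisenberg operators, hence the exponentials;
undressing its currents then fixes the `Z`-currents. -/
theorem IsDressing.unique_ops {ρ ρ' : HZOps I V} (hg : D.IsGood γ) (hρ : IsHZModule D γ ζ ρ)
    (hρ' : IsHZModule D γ ζ ρ') {π : Toroidal D →ₐ[ℂ] Module.End ℂ V} (hd : IsDressing D γ ρ π)
    (hd' : IsDressing D γ ρ' π) : ρ = ρ' := by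
  have hk : ρ.k = ρ'.k := funext fun i => Units.ext ((hd.k i).symm.trans (hd'.k i))
  have hqd : ρ.qd = ρ'.qd := Units.ext (hd.qd.symm.trans hd'.qd)
  have ha : ρ.a = ρ'.a := funext fun i => funext fun l => (hd.a i l).symm.trans (hd'.a i l)
  have hX := (hd.repX_eq hg hρ).symm.trans (hd'.repX_eq hg hρ')
  have hu := Dressing.unX_X (D := (hρ.isHeis hg).dressing) hρ.isDeg_col
  have hu' := Dressing.unX_X (D := (hρ'.isHeis hg).dressing) hρ'.isDeg_col
  rcases ρ with ⟨⟨Zp, Zm, k, qd⟩, a⟩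
  rcases ρ' with ⟨⟨Zp', Zm', k', qd'⟩, a'⟩
  dsimp only at hk hqd ha
  subst hk hqd ha
  have hcol := hu.symm.trans ((congrArg _ hX).trans hu')
  have h1 : Zp = Zp' := funext fun i => congrFun hcol (i, true)
  have h2 : Zm = Zm' := funext fun i => congrFun hcol (i, false)
  rw [h1, h2]

theorem IsRestrictedToroidalModule.exists_ops (hg : D.IsGood γ)
    {π : Toroidal D →ₐ[ℂ] Module.End ℂ V} (hπ : IsRestrictedToroidalModule D γ ζ π) :
    ∃ ρ : HZOps I V, IsHZModule D γ ζ ρ ∧ IsDressing D γ ρ π := by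
  have hu {x y : Gen I} (h : Rel D (FreeAlgebra.ι ℂ x * FreeAlgebra.ι ℂ y) 1) :
      π (gen D x) * π (gen D y) = 1 := by
    have := rep_rel π h
    rwa [map_mul, map_one] at this
  let k : I → (Module.End ℂ V)ˣ := fun i =>
    ⟨π (gen D (Gen.k i)), π (gen D (Gen.kinv i)), hu (Rel.k_inv i), hu (Rel.inv_k i)⟩
  let qd : (Module.End ℂ V)ˣ :=
    ⟨π (gen D Gen.qd), π (gen D Gen.qdinv), hu Rel.qd_inv, hu Rel.inv_qd⟩
  have hf := isImage_of_rep hg π (k := k) (qd := qd)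
    (a := fun i l => qInt D.q (D.d i) • π (gen D (Gen.a i l))) (fun i => rfl) rfl hπ.level_c
    fun i l => rfl
  have hc := hf.isCurrentModule (ζ := ζ) (fun x y h => rep_rel π h) hπ.restricted (by
    rw [← hπ.level_k]
    simp only [map_list_prod, List.map_map, Function.comp_def, map_pow]
    rfl)
  have hρ := hc.isHZModule_undress
  have hX : (hρ.isHeis hg).dressing.X hc.undress.col = repX π := by
    rw [hc.col_undress]
    exact Dressing.X_unX (D := hc.heis.dressing) hc.deg
  have hdX := (hρ.isHeis hg).dressed_eq_X hρ.isDeg_col hρ.a_col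
  rw [hX] at hdX
  exact ⟨hc.undress, hρ,
    { xp := fun j n v => (hdX j true n v).symm
      xm := fun j n v => (hdX j false n v).symm
      k := fun j => rfl
      a := fun j l => rfl
      ch := hπ.level_c
      qd := rfl }⟩

end

noncomputable section

/-! ## The Fock module -/

section FockModule

variable {I : Type*} {D : Datum I} {γ : ℂ}

theorem fockA_neg [Fintype I] (i : I) (m : ℕ) :
    fockA D γ i (neg m) = LinearMap.mulLeft ℂ (MvPolynomial.X (i, m)) := by
  have h1 : ((neg m : NZ) : ℤ) < 0 := by simp only [neg]; omega
  have h2 : ((neg m : NZ) : ℤ).natAbs - 1 = m := by simp only [neg]; omega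
  rw [fockA, if_pos h1, h2]

/-- The derivation by which `a_{i,m+1}` acts on the Fock module. -/
def fockDer [Fintype I] (D : Datum I) (γ : ℂ) (i : I) (m : ℕ) :
    Derivation ℂ (Fock I) (Fock I) :=
  ∑ j, D.w γ i j (m + 1) • MvPolynomial.pderiv (j, m)

theorem fockDer_apply [Fintype I] (i : I) (m : ℕ) (f : Fock I) :
    fockDer D γ i m f = ∑ j, D.w γ i j (m + 1) • MvPolynomial.pderiv (j, m) f := by
  have := congrFun (map_sum (Derivation.coeFnAddMonoidHom (R := ℂ) (A := Fock I) (M := Fock I))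
    (fun j => D.w γ i j (m + 1) • MvPolynomial.pderiv (j, m)) Finset.univ) f
  rw [Finset.sum_apply] at this
  exact this

theorem fockA_pos [Fintype I] (i : I) (m : ℕ) :
    fockA D γ i (pos m) = (fockDer D γ i m).toLinearMap := by
  have h1 : ¬ ((pos m : NZ) : ℤ) < 0 := by simp only [pos]; omega
  have h2 : ((pos m : NZ) : ℤ).natAbs - 1 = m := by simp only [pos]; omega
  rw [fockA, if_neg h1, h2]
  refine LinearMap.ext fun f => ?_
  change _ = fockDer D γ i m f
  rw [fockDer_apply, LinearMap.sum_apply]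
  simp [Datum.w, pos]

theorem fockDer_X [Fintype I] (i j : I) (m m' : ℕ) : fockDer D γ i m (MvPolynomial.X (j, m'))
    = if m = m' then MvPolynomial.C (D.w γ i j (m + 1)) else 0 := by
  classical
  simp only [fockDer_apply, MvPolynomial.pderiv_X, Pi.single_apply, Prod.mk.injEq, eq_comm (a := j)]
  by_cases h : m = m'
  · simp [h, MvPolynomial.smul_eq_C_mul]
  · simp [h, Ne.symm h]

/-- The bracket of two derivations is a derivation. It vanishes on the variables because each
derivation sends these to constants. -/
theorem fockDer_comm [Fintype I] (i j : I) (m m' : ℕ) (f : Fock I) :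
    fockDer D γ i m (fockDer D γ j m' f) = fockDer D γ j m' (fockDer D γ i m f) := by
  have h : ⁅fockDer D γ i m, fockDer D γ j m'⁆ = 0 := by
    refine MvPolynomial.derivation_ext fun x => ?_
    rw [Derivation.commutator_apply, fockDer_X, fockDer_X]
    split_ifs <;> simp
  have := congrArg (fun d : Derivation ℂ (Fock I) (Fock I) => d f) h
  simpa [Derivation.commutator_apply, sub_eq_zero] using this

theorem fockA_comm [Fintype I] (hg : D.IsGood γ) (i j : I) (l m : NZ) :
    fockA D γ i l * fockA D γ j m - fockA D γ j m * fockA D γ i l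
      = if (l : ℤ) + m = 0 then D.w γ i j l • (1 : Module.End ℂ (Fock I)) else 0 := by
  have hpn (i j : I) (m m' : ℕ) : fockA D γ i (pos m) * fockA D γ j (neg m')
      - fockA D γ j (neg m') * fockA D γ i (pos m)
      = if ((pos m : NZ) : ℤ) + (neg m' : NZ) = 0 then
        D.w γ i j (pos m : NZ) • (1 : Module.End ℂ (Fock I)) else 0 := by
    rw [fockA_pos, fockA_neg]
    refine LinearMap.ext fun f => ?_
    change fockDer D γ i m (MvPolynomial.X (j, m') * f)
      - MvPolynomial.X (j, m') * fockDer D γ i m f = _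
    rw [Derivation.leibniz, fockDer_X, smul_eq_mul, smul_eq_mul, add_sub_cancel_left]
    by_cases h : m = m'
    · subst h
      rw [if_pos rfl, if_pos (by simp [pos, neg]), mul_comm, ← MvPolynomial.smul_eq_C_mul]
      rfl
    · rw [if_neg h, if_neg (by simp only [pos, neg]; omega), mul_zero]
      rfl
  revert l
  rw [NZ.forall]
  refine ⟨fun l => ?_, fun l => ?_⟩ <;> revert m <;> rw [NZ.forall] <;>
    refine ⟨fun m => ?_, fun m => ?_⟩
  · rw [if_neg (by simp only [pos]; omega), sub_eq_zero, fockA_pos, fockA_pos]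
    exact LinearMap.ext fun f => fockDer_comm i j l m f
  · exact hpn i j l m
  -- The bracket of a multiplication with a derivation is reduced to the opposite order; `w_neg`
  -- makes the structure constants agree.
  · rw [← neg_sub, hpn j i m l, add_comm]
    split_ifs with h
    · have h1 : ((neg l : NZ) : ℤ) = -(pos m : NZ) := by omega
      rw [h1, hg.w_neg]
      exact (neg_smul _ _).symm
    · rw [neg_zero]
  · rw [if_neg (by simp only [neg]; omega), sub_eq_zero, fockA_neg, fockA_neg]
    refine LinearMap.ext fun f => ?_
    exact mul_left_comm _ _ _

/-- An algebra homomorphism that intertwines a derivation up to a scalar on the variables does so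
everywhere. -/
theorem algHom_derivation_comm {σ : Type*} {φ : MvPolynomial σ ℂ →ₐ[ℂ] MvPolynomial σ ℂ}
    {δ : Derivation ℂ (MvPolynomial σ ℂ) (MvPolynomial σ ℂ)} {c : ℂ}
    (h : ∀ x, φ (δ (MvPolynomial.X x)) = c • δ (φ (MvPolynomial.X x))) (f : MvPolynomial σ ℂ) :
    φ (δ f) = c • δ (φ f) := by
  have key {A : Type _} [CommRing A] [Algebra ℂ A] (φ : A →ₐ[ℂ] A) (δ : Derivation ℂ A A) {f g : A}
      (hf : φ (δ f) = c • δ (φ f)) (hg : φ (δ g) = c • δ (φ g)) :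
      φ (δ (f * g)) = c • δ (φ (f * g)) := by
    rw [Derivation.leibniz, map_add, map_mul φ f g, Derivation.leibniz, smul_eq_mul, smul_eq_mul,
      smul_eq_mul, smul_eq_mul, map_mul, map_mul, hf, hg, smul_add, mul_smul_comm, mul_smul_comm]
  induction f using MvPolynomial.induction_on with
  | C a =>
    rw [MvPolynomial.derivation_C, map_zero, ← MvPolynomial.algebraMap_eq, AlgHom.commutes,
      Derivation.map_algebraMap, smul_zero]
  | add f g hf hg => rw [map_add, map_add, hf, hg, map_add, map_add, smul_add]
  | mul_X f x hf => exact key φ δ hf (h x)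

theorem fockD_X (c : ℂ) (x : I × ℕ) :
    fockD c (MvPolynomial.X x : Fock I) = c ^ (x.2 + 1) • MvPolynomial.X x :=
  MvPolynomial.aeval_X _ _

theorem fockD_mul_apply (c : ℂ) (f g : Fock I) : fockD c (f * g) = fockD c f * fockD c g :=
  map_mul (MvPolynomial.aeval fun x : I × ℕ => c ^ (x.2 + 1) • MvPolynomial.X (R := ℂ) x) f g

theorem fockD_fockA [Fintype I] {q : ℂ} (hq : q ≠ 0) (i : I) (l : NZ) :
    fockD q⁻¹ * fockA D γ i l = q ^ (l : ℤ) • (fockA D γ i l * fockD q⁻¹) := by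
  revert l
  rw [NZ.forall]
  refine ⟨fun m => ?_, fun m => ?_⟩
  · rw [fockA_pos]
    refine LinearMap.ext fun f => ?_
    change fockD q⁻¹ (fockDer D γ i m f) = q ^ ((pos m : NZ) : ℤ) • fockDer D γ i m (fockD q⁻¹ f)
    have hp : q ^ ((pos m : NZ) : ℤ) = q ^ (m + 1) := by
      rw [← zpow_natCast]
      simp only [pos]
      push_cast
      rfl
    rw [hp]
    refine algHom_derivation_comm (φ := MvPolynomial.aeval fun x : I × ℕ =>
      q⁻¹ ^ (x.2 + 1) • MvPolynomial.X (R := ℂ) x) (fun x => ?_) f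
    rw [MvPolynomial.aeval_X, Derivation.map_smul, fockDer_X]
    split_ifs with h
    · rw [MvPolynomial.aeval_C, h, smul_smul, inv_pow, mul_inv_cancel₀ (pow_ne_zero _ hq), one_smul]
      rfl
    · rw [map_zero, smul_zero, smul_zero]
  · rw [fockA_neg]
    refine LinearMap.ext fun f => ?_
    have hp : q ^ ((neg m : NZ) : ℤ) = q⁻¹ ^ (m + 1) := by
      rw [inv_pow, ← zpow_natCast, ← zpow_neg]
      simp only [neg]
      push_cast
      rfl
    rw [hp, LinearMap.smul_apply, Module.End.mul_apply, Module.End.mul_apply,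
      LinearMap.mulLeft_apply, LinearMap.mulLeft_apply, fockD_mul_apply, fockD_X, smul_mul_assoc]

/-- The degree of a monomial in the Fock module. -/
def fockDeg (s : I × ℕ →₀ ℕ) : ℕ := s.sum fun x n => (x.2 + 1) * n

theorem fockD_monomial (c : ℂ) (s : I × ℕ →₀ ℕ) (a : ℂ) :
    fockD c (MvPolynomial.monomial s a : Fock I) = c ^ fockDeg s • MvPolynomial.monomial s a := by
  change MvPolynomial.aeval (fun x : I × ℕ => c ^ (x.2 + 1) • MvPolynomial.X (R := ℂ) x) _ = _
  rw [MvPolynomial.aeval_monomial, MvPolynomial.monomial_eq]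
  have h1 : (s.prod fun x n => (c ^ (x.2 + 1) • MvPolynomial.X (R := ℂ) x : Fock I) ^ n)
      = c ^ fockDeg s • s.prod fun x n => (MvPolynomial.X x : Fock I) ^ n := by
    simp only [smul_pow, Finsupp.prod, Finset.prod_smul, ← pow_mul, Finset.prod_pow_eq_pow_sum]
    rfl
  rw [h1, mul_smul_comm]
  rfl

end FockModule

/-! ### Tensor products of the Fock module with `Z`-modules -/

section Tensor

variable {I W : Type*} [AddCommGroup W] [Module ℂ W]

/-- Monomials tensored with eigenvectors are eigenvectors and span. Conversely, the component of an
eigenvector for `c q^n` along a monomial of degree `N` is an eigenvector of `T` for `c q^(n+N)`. The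
index only increases, so the bound for `T` also serves the tensor product. -/
theorem isRestricted_fock_tensor {q : ℂ} (hq : q ≠ 0) {T : Module.End ℂ W} (hT : IsRestricted q T) :
    IsRestricted q (TensorProduct.map (fockD q⁻¹ : Module.End ℂ (Fock I)) T) := by
  constructor
  · rw [eq_top_iff]
    rintro x -
    induction x using TensorProduct.induction_on with
    | zero => exact Submodule.zero_mem _
    | add x y hx hy => exact Submodule.add_mem _ hx hy
    | tmul f w =>
      induction f using MvPolynomial.induction_on' with
      | add f g hf hg =>
        rw [TensorProduct.add_tmul]
        exact Submodule.add_mem _ hf hg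
      | monomial s a =>
        have hw : w ∈ ⨆ c : ℂ, Module.End.eigenspace T c := hT.1 ▸ Submodule.mem_top
        induction hw using Submodule.iSup_induction' with
        | zero =>
          rw [TensorProduct.tmul_zero]
          exact Submodule.zero_mem _
        | add x y _ _ hx hy =>
          rw [TensorProduct.tmul_add]
          exact Submodule.add_mem _ hx hy
        | mem c w hw =>
          refine Submodule.mem_iSup_of_mem (q⁻¹ ^ fockDeg s * c) ?_
          rw [Module.End.mem_eigenspace_iff] at hw ⊢
          rw [TensorProduct.map_tmul, fockD_monomial, hw, TensorProduct.smul_tmul_smul]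
  · classical
    intro c
    obtain ⟨n₀, hn₀⟩ := hT.2 c
    refine ⟨n₀, fun n hn => ?_⟩
    rw [eq_bot_iff]
    intro x hx
    rw [Module.End.mem_eigenspace_iff] at hx
    rw [Submodule.mem_bot]
    -- Coordinates with values in `W` along the monomial basis, on which the operator is diagonal.
    let e := TensorProduct.equivFinsuppOfBasisLeft (R := ℂ) (N := W)
      (MvPolynomial.basisMonomials (I × ℕ) ℂ)
    have he (x : Fock I ⊗[ℂ] W) (s : I × ℕ →₀ ℕ) :
        e (TensorProduct.map (fockD q⁻¹) T x) s = q⁻¹ ^ fockDeg s • T (e x s) := by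
      induction x using TensorProduct.induction_on with
      | zero => simp
      | add x y hx hy => simp only [map_add, Finsupp.add_apply, hx, hy, smul_add]
      | tmul f w =>
        rw [TensorProduct.map_tmul, TensorProduct.equivFinsuppOfBasisLeft_apply_tmul_apply,
          TensorProduct.equivFinsuppOfBasisLeft_apply_tmul_apply, map_smul, smul_smul]
        congr 1
        change MvPolynomial.coeff s (fockD q⁻¹ f) = _ * MvPolynomial.coeff s f
        induction f using MvPolynomial.induction_on' with
        | add f g hf hg => rw [map_add, MvPolynomial.coeff_add, hf, hg, MvPolynomial.coeff_add, mul_add]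
        | monomial s' a =>
          rw [fockD_monomial, MvPolynomial.coeff_smul, MvPolynomial.coeff_monomial, smul_eq_mul]
          split_ifs with h
          · rw [h]
          · rw [mul_zero, mul_zero]
    refine e.injective ?_
    rw [map_zero]
    ext s
    have h1 := he x s
    rw [hx, map_smul, Finsupp.smul_apply, inv_pow, eq_inv_smul_iff₀ (pow_ne_zero _ hq),
      smul_smul] at h1
    have h2 : e x s ∈ Module.End.eigenspace T (c * q ^ (n + fockDeg s)) := by
      rw [Module.End.mem_eigenspace_iff, ← h1, pow_add]
      congr 1
      ring
    rw [hn₀ _ (by omega)] at h2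
    exact h2

variable {V : Type*} [AddCommGroup V] [Module ℂ V]

/-- The operators `1 ⊗ A`. -/
def amp (V : Type*) [AddCommGroup V] [Module ℂ V] :
    Module.End ℂ W →ₐ[ℂ] Module.End ℂ (V ⊗[ℂ] W) := Module.End.lTensorAlgHom ℂ W V

theorem amp_apply (A : Module.End ℂ W) :
    amp V A = TensorProduct.map LinearMap.id A := rfl

/-- Tensoring with the identity is an algebra homomorphism that preserves locally finite sums. Hence
the two-point function can be computed in `W`, with no restrictedness of the tensor product needed.
-/
theorem twoPoint_amp {q : ℂ} {T : Module.End ℂ W} (hT : IsBdd q T) {A B : ℤ → Module.End ℂ W}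
    (hB : ∀ n, IsDeg q T n (B n)) (f : PowerSeries ℂ) (r s : ℤ) (v : V ⊗[ℂ] W) :
    twoPoint f (fun n => amp V (A n)) (fun n => amp V (B n)) r s v = amp V (tp f A B r s) v := by
  have h := (hasLSum_tp (A := A) hT hB f r s).lTensor (V := V) |>.congr
    (B := fun n : ℕ => PowerSeries.coeff n f • (amp V (A (r - n)) * amp V (B (s + n))))
    (fun n => by rw [← amp_apply, map_smul, map_mul]) rfl
  exact h.finsum_eq v

theorem nPoint_amp {J : Type*} {F : J → J → PowerSeries ℂ} {Z : J → ℤ → Module.End ℂ W} {q : ℂ}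
    {T : Module.End ℂ W} (hq : q ≠ 0) (hT : IsBdd q T) (hZ : ∀ c n, IsDeg q T n (Z c n)) {L : ℕ}
    (c : Fin L → J) (m : Fin L → ℤ) (v : V ⊗[ℂ] W) :
    nPoint F (fun c n => amp V (Z c n)) v c m = amp V (word F Z L c m) v := by
  have h := (hasLSum_nPoint (F := F) hq hT hZ c m).lTensor (V := V) |>.congr
    (B := fun e => (∏ x, PowerSeries.coeff (e x) (F (c x.1.1) (c x.1.2))) •
      (List.ofFn fun p => amp V (Z (c p) (m p + (∑ x, if x.1.2 = p then (e x : ℤ) else 0)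
        - (∑ x, if x.1.1 = p then (e x : ℤ) else 0)))).prod)
    (fun e => by rw [← amp_apply, map_smul, map_list_prod, List.map_ofFn]; rfl) rfl
  exact h.finsum_eq v

theorem serreSum_amp {D : Datum I} {F : I → I → PowerSeries ℂ} {Z : I → ℤ → Module.End ℂ W} {q : ℂ}
    {T : Module.End ℂ W} (hq : q ≠ 0) (hT : IsBdd q T) (hZ : ∀ c n, IsDeg q T n (Z c n)) {i j : I}
    {n : Fin (D.serreOrder i j) → ℤ} {s : ℤ} (h : ∀ w, serreSum D (nPoint F Z w) i j n s = 0)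
    (v : V ⊗[ℂ] W) : serreSum D (nPoint F (fun c n => amp V (Z c n)) v) i j n s = 0 := by
  have h1 : serreSum D (fun {L} c m => word F Z L c m) i j n s = 0 := by
    refine LinearMap.ext fun w => ?_
    rw [← serreSum_apply, LinearMap.zero_apply, ← h w]
    simp only [serreSum, nPoint_eq_word hq hT hZ]
  have h2 : serreSum D (nPoint F (fun c n => amp V (Z c n)) v) i j n s
      = amp V (serreSum D (fun {L} c m => word F Z L c m) i j n s) v := by
    simp only [serreSum, nPoint_amp hq hT hZ, map_sum, map_smul, LinearMap.sum_apply,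
      LinearMap.smul_apply]
  rw [h2, h1, map_zero, LinearMap.zero_apply]

/-- Stated for an arbitrary left factor: the proof uses only the brackets and the grading of the
operators `A`, and the restrictedness of the tensor product, so the concrete form of the Fock module
never has to be unfolded. -/
theorem isHZModule_of_amp [Fintype I] {D : Datum I} {γ ζ : ℂ} (hg : D.IsGood γ)
    {σ : ZOps I W} (hσ : IsZModule D γ ζ σ) {ρ : HZOps I (V ⊗[ℂ] W)} {T : Module.End ℂ V}
    {A : I → NZ → Module.End ℂ V} (hZp : ∀ i, ρ.Zp i = fun n => amp V (σ.Zp i n))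
    (hZm : ∀ i, ρ.Zm i = fun n => amp V (σ.Zm i n))
    (hk : ∀ i, (ρ.k i).val = amp V (σ.k i).val)
    (hk' : ∀ i, ((ρ.k i)⁻¹ : (Module.End ℂ (V ⊗[ℂ] W))ˣ).val
      = amp V ((σ.k i)⁻¹ : (Module.End ℂ W)ˣ).val)
    (hqd : ρ.qd.val = TensorProduct.map T σ.qd.val)
    (ha : ∀ i l, ρ.a i l = Module.End.rTensorAlgHom ℂ V W (A i l))
    (hAA : ∀ i j (l m : NZ), A i l * A j m - A j m * A i l
      = if (l : ℤ) + m = 0 then D.w γ i j l • (1 : Module.End ℂ V) else 0)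
    (hTA : ∀ i l, IsDeg D.q T (l : NZ) (A i l))
    (hres : IsRestricted D.q (TensorProduct.map T σ.qd.val)) : IsHZModule D γ ζ ρ := by
  have hbdd := isBdd_of_isRestricted hσ.restricted
  have hdeg {A : Module.End ℂ W} {n : ℤ} (hA : IsDeg D.q σ.qd.val n A) :
      TensorProduct.map T σ.qd.val * amp V A
        = D.q ^ n • (amp V A * TensorProduct.map T σ.qd.val) := by
    rw [amp_apply, ← TensorProduct.map_mul, ← TensorProduct.map_mul,
      show σ.qd.val * A = _ from hA, TensorProduct.map_smul_right]
    rfl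
  have hcomm (B : Module.End ℂ V) (A : Module.End ℂ W) :
      Module.End.rTensorAlgHom ℂ V W B * amp V A = amp V A * Module.End.rTensorAlgHom ℂ V W B := by
    change TensorProduct.map B LinearMap.id * _ = _ * TensorProduct.map B LinearMap.id
    rw [amp_apply, ← TensorProduct.map_mul, ← TensorProduct.map_mul]
    rfl
  have hqk (i : I) : TensorProduct.map T σ.qd.val * amp V (σ.k i).val
      = amp V (σ.k i).val * TensorProduct.map T σ.qd.val := by
    have h : Commute σ.qd.val (σ.k i).val := congrArg Units.val (hσ.qd_k i)
    have := hdeg (isDeg_zero_iff.mpr h)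
    rwa [zpow_zero, one_smul] at this
  have hkk (i j : I) : ρ.k i * ρ.k j = ρ.k j * ρ.k i := by
    refine Units.ext ?_
    rw [Units.val_mul, Units.val_mul, hk, hk, ← map_mul, ← map_mul]
    exact congrArg (amp V) (congrArg Units.val (hσ.k_k i j))
  have hqk' (i : I) : ρ.qd * ρ.k i = ρ.k i * ρ.qd := by
    refine Units.ext ?_
    rw [Units.val_mul, Units.val_mul, hqd, hk, hqk]
  exact
  { isZModule :=
    { k_k := hkk
      qd_k := hqk'
      qd_Zp := fun i n => by
        rw [hqd, hZp]
        exact hdeg (hσ.qd_Zp i n)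
      qd_Zm := fun i n => by
        rw [hqd, hZm]
        exact hdeg (hσ.qd_Zm i n)
      k_Zp := fun i j n => by
        rw [hk, hZp, ← map_mul, ← map_mul, ← map_smul, hσ.k_Zp]
      k_Zm := fun i j n => by
        rw [hk, hZm, ← map_mul, ← map_mul, ← map_smul, hσ.k_Zm]
      level_k := by
        have := congrArg (amp V) hσ.level_k
        rw [map_smul, map_one, map_list_prod, List.map_map] at this
        rw [← this]
        congr 2
        funext i
        rw [Function.comp_apply, map_pow, hk]
      restricted := by
        rw [hqd]
        exact hres
      Zp_Zp := fun i j r s v => by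
        have h1 : tp _ (σ.Zp i) (σ.Zp j) (r + 1) s
            = -(D.κ ^ (-D.M i j)) • tp _ (σ.Zp j) (σ.Zp i) (s + 1) r := LinearMap.ext fun w => by
          rw [LinearMap.smul_apply, ← twoPoint_eq_tp hbdd (hσ.qd_Zp j),
            ← twoPoint_eq_tp hbdd (hσ.qd_Zp i)]
          exact hσ.Zp_Zp i j r s w
        rw [hZp, hZp, twoPoint_amp hbdd (hσ.qd_Zp j), twoPoint_amp hbdd (hσ.qd_Zp i), h1, map_smul,
          LinearMap.smul_apply]
      Zm_Zm := fun i j r s v => by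
        have h1 : tp _ (σ.Zm i) (σ.Zm j) (r + 1) s
            = -(D.κ ^ (-D.M i j)) • tp _ (σ.Zm j) (σ.Zm i) (s + 1) r := LinearMap.ext fun w => by
          rw [LinearMap.smul_apply, ← twoPoint_eq_tp hbdd (hσ.qd_Zm j),
            ← twoPoint_eq_tp hbdd (hσ.qd_Zm i)]
          exact hσ.Zm_Zm i j r s w
        rw [hZm, hZm, twoPoint_amp hbdd (hσ.qd_Zm j), twoPoint_amp hbdd (hσ.qd_Zm i), h1, map_smul,
          LinearMap.smul_apply]
      Zp_Zm := fun i j r s v => by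
        classical
        have h1 : tp _ (σ.Zp i) (σ.Zm j) r s - tp _ (σ.Zm j) (σ.Zp i) s r
            = if i = j ∧ r + s = 0 then
            (D.qi i - (D.qi i)⁻¹)⁻¹ • ((γ ^ 2) ^ r • (σ.k i).val
              - (γ ^ 2) ^ (-r) • ((σ.k i)⁻¹ : (Module.End ℂ W)ˣ).val) else 0 :=
          LinearMap.ext fun w => by
            rw [LinearMap.sub_apply, ← twoPoint_eq_tp hbdd (hσ.qd_Zm j),
              ← twoPoint_eq_tp hbdd (hσ.qd_Zp i)]
            refine (hσ.Zp_Zm i j r s w).trans ?_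
            split_ifs <;> rfl
        rw [hZp, hZm, twoPoint_amp hbdd (hσ.qd_Zm j), twoPoint_amp hbdd (hσ.qd_Zp i),
          ← LinearMap.sub_apply, ← map_sub, h1, hk, hk']
        split_ifs
        · rw [map_smul, map_sub, map_smul, map_smul]
          rfl
        · rw [map_zero]
          rfl
      serre_Zp := fun i j hij n s v => by
        rw [show ρ.Zp = _ from funext hZp]
        exact serreSum_amp hg.q_ne hbdd hσ.qd_Zp (hσ.serre_Zp i j hij n s) v
      serre_Zm := fun i j hij n s v => by
        rw [show ρ.Zm = _ from funext hZm]
        exact serreSum_amp hg.q_ne hbdd hσ.qd_Zm (hσ.serre_Zm i j hij n s) v }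
    a_a := fun i j l m => by
      rw [ha, ha, ← map_mul, ← map_mul, ← map_sub, hAA]
      split_ifs
      · rw [map_smul, map_one]
        rfl
      · exact map_zero _
    qd_a := fun i l => by
      rw [hqd, ha]
      change _ * TensorProduct.map _ _ = _ • (TensorProduct.map _ _ * _)
      rw [← TensorProduct.map_mul, ← TensorProduct.map_mul, show T * A i l = _ from hTA i l,
        TensorProduct.map_smul_left]
      rfl
    a_k := fun i j l => by
      rw [ha, hk]
      exact hcomm _ _
    a_Zp := fun i j l n => by
      rw [ha, hZp]
      exact hcomm _ _
    a_Zm := fun i j l n => by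
      rw [ha, hZm]
      exact hcomm _ _ }

theorem isHZModule_fockTensor [Fintype I] {D : Datum I} {γ ζ : ℂ} (hg : D.IsGood γ)
    {σ : ZOps I W} (hσ : IsZModule D γ ζ σ) {q : ℂˣ} (hq : (q : ℂ) = D.q) :
    IsHZModule D γ ζ (fockTensor D γ q σ) := by
  refine isHZModule_of_amp hg hσ (T := fockD D.q⁻¹) (A := fockA D γ) (fun i => rfl) (fun i => rfl)
    (fun i => rfl) (fun i => rfl) ?_ (fun i l => rfl) (fockA_comm hg) (fockD_fockA hg.q_ne)
    (isRestricted_fock_tensor hg.q_ne hσ.restricted)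
  rw [← hq, ← Units.val_inv_eq_inv_val]
  rfl

end Tensor

end

/-- The twist matrix is antisymmetric. -/
theorem IsTwistMatrix.antisymm {J : Type*} {A M : Matrix (Option J) (Option J) ℤ}
    (h : IsTwistMatrix A M) (i j : Option J) : M i j = -M j i := by
  rcases h with ⟨N, e, -, h⟩ | ⟨-, rfl⟩
  · simp only [h, neg_sub, eq_comm]
  · simp

end QToroidal

/-! ### The correspondence for untwisted affine data -/

theorem mainTheorem9
    -- the simple Lie algebra, through its root system, a base and the highest root
    {ι X Y : Type*} [Finite ι] [AddCommGroup X] [Module ℂ X] [AddCommGroup Y] [Module ℂ Y]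
    (P : RootPairing ι ℂ X Y) [P.IsRootSystem] [P.IsCrystallographic] [P.IsReduced]
    [P.IsIrreducible] (b : P.Base) (θ : ι) (hθ : QToroidal.IsHighestRoot b θ)
    -- the symmetrization, the matrix `M` and the labels
    (d : Option b.support → ℕ) (hd : ∀ i, 0 < d i)
    (hdA : ∀ i j, (d i : ℤ) * QToroidal.affineCartan b θ i j = d j * QToroidal.affineCartan b θ j i)
    (M : Matrix (Option b.support) (Option b.support) ℤ)
    (hM : QToroidal.IsTwistMatrix (QToroidal.affineCartan b θ) M)
    (lab : Option b.support → ℕ) (hlab0 : lab none = 1)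
    (hlab : P.root θ = ∑ i : b.support, lab (some i) • P.root i)
    -- the parameters: `q = exp τ` and `q ^ x = exp (x τ)`
    (τ κ k l : ℂ) (hq : ∀ n : ℕ, 0 < n → Complex.exp τ ^ n ≠ 1) (hκ : κ ≠ 0)
    (hk : ‖Complex.exp (2 * k * τ)‖ < 1)
    (D : QToroidal.Datum (Option b.support))
    (hD : D = ⟨QToroidal.affineCartan b θ, d, M, lab, Complex.exp τ, κ⟩)
    (γ ζ : ℂ) (hγ : γ = Complex.exp (k / 2 * τ)) (hζ : ζ = Complex.exp (-l * τ)) :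
    -- the Fock module tensored with a `Z`-module carries commuting Heisenberg and `Z`-actions
    (∀ (W : Type*) [AddCommGroup W] [Module ℂ W] (σ : QToroidal.ZOps (Option b.support) W),
      QToroidal.IsZModule D γ ζ σ →
      QToroidal.IsHZModule D γ ζ
        (QToroidal.fockTensor D γ (Units.mk0 (Complex.exp τ) (Complex.exp_ne_zero τ)) σ)) ∧
    -- the dressed currents give a representation of the quantum toroidal algebra
    -- and generate its image
    (∀ (V : Type*) [AddCommGroup V] [Module ℂ V] (ρ : QToroidal.HZOps (Option b.support) V),
      QToroidal.IsHZModule D γ ζ ρ →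
      ∃! π : QToroidal.Toroidal D →ₐ[ℂ] Module.End ℂ V,
        QToroidal.IsDressing D γ ρ π ∧
        QToroidal.IsRestrictedToroidalModule D γ ζ π ∧
        Algebra.adjoin ℂ
          {x | ∃ j, (∃ n, x = π (QToroidal.gen D (QToroidal.Gen.xp j n)) ∨
              x = π (QToroidal.gen D (QToroidal.Gen.xm j n))) ∨
            x = ρ.k j ∨ x = ((ρ.k j)⁻¹ : (Module.End ℂ V)ˣ)}
          = (QToroidal.Toroidal' D).map π) ∧
    -- every restricted module of the same level over the quantum toroidal algebra arises in this way
    (∀ (V : Type*) [AddCommGroup V] [Module ℂ V]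
      (π : QToroidal.Toroidal D →ₐ[ℂ] Module.End ℂ V),
      QToroidal.IsRestrictedToroidalModule D γ ζ π →
      ∃! ρ : QToroidal.HZOps (Option b.support) V,
        QToroidal.IsHZModule D γ ζ ρ ∧ QToroidal.IsDressing D γ ρ π) := by
  subst hD
  -- The base `q^{2k}` of the infinite products, in terms of `γ = q^{k/2}`.
  have hγ4 : γ ^ 4 = Complex.exp (2 * k * τ) := by
    rw [hγ, ← Complex.exp_nat_mul]
    congr 1
    push_cast
    ring
  have hg : (⟨QToroidal.affineCartan b θ, d, M, lab, Complex.exp τ, κ⟩ :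
      QToroidal.Datum (Option b.support)).IsGood γ :=
    { q_ne := Complex.exp_ne_zero τ
      q_pow_ne := fun n => hq (n + 1) n.succ_pos
      κ_ne := hκ
      γ_ne := hγ ▸ Complex.exp_ne_zero _
      -- Positive powers of a number of absolute value less than 1 have absolute value less than 1.
      γ_pow_ne := fun n h => by
        have := congrArg norm h
        rw [hγ4, norm_pow, norm_one] at this
        exact (pow_lt_one₀ (norm_nonneg _) hk n.succ_ne_zero).ne this
      d_pos := hd
      b_symm := hdA
      M_antisymm := hM.antisymm }
  refine ⟨fun W _ _ σ hσ => QToroidal.isHZModule_fockTensor hg hσ rfl, fun V _ _ ρ hρ => ?_,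
    fun V _ _ π hπ => ?_⟩
  · obtain ⟨π, hd⟩ := hρ.exists_isDressing hg
    exact ⟨π, ⟨hd, QToroidal.IsDressing.isRestrictedToroidalModule hρ hd,
      QToroidal.IsDressing.adjoin_eq hg hρ hd⟩,
      fun π' h => QToroidal.IsDressing.unique_rep hg hρ h.1 hd⟩
  · obtain ⟨ρ, hρ, hd⟩ := hπ.exists_ops hg
    exact ⟨ρ, ⟨hρ, hd⟩, fun ρ' h => QToroidal.IsDressing.unique_ops hg h.1 hρ h.2 hd⟩
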